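/- Let $(W,S)$ be a Coxeter system with $S$ finite, with set of roots (half-spaces of $W$) $\Phi$, simple roots $\alpha_s$ ($s\in S$), and growth series $\sum_{n\ge 0}c_nt^n$, where $c_n=\#\{w\in W:\ell_S(w)=n\}$. Let $\Gamma$ be a group with a twin root group datum $\big((U_\alpha)_{\alpha\in\Phi},T\big)$ of type $(W,S)$, that is, subgroups $U_\alpha\neq\{1\}$ and $T$ of $\Gamma$ such that * $[U_\alpha,U_\beta]\le\langle U_\gamma:\gamma\in(\alpha,\beta)\rangle$ for every prenilpotent pair $\alpha\ne\beta$ in $\Phi$. Here $\{\alpha,\beta\}$ is prenilpotent if $\alpha\cap\beta$ and $(-\alpha)\cap(-\beta)$ are nonempty, and $(\alpha,\beta)$ is the set of roots $\gamma\ne\alpha,\beta$ with $\alpha\cap\beta\subseteq\gamma$ and $(-\alpha)\cap(-\beta)\subseteq-\gamma$; * for every $s\in S$ and every $u\in U_{\alpha_s}\setminus\{1\}$ there is an element $m(u)\in U_{-\alpha_s}uU_{-\alpha_s}$ with $m(u)U_\alpha m(u)^{-1}=U_{s\alpha}$ for all $\alpha\in\Phi$, chosen so that $m(u)^{-1}m(v)\in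 T$ for all $u,v\in U_{\alpha_s}\setminus\{1\}$; * $U_{-\alpha_s}\not\le U_+$ and $U_{\alpha_s}\not\le U_-$ for every $s\in S$, where $U_+$ (resp. $U_-$) is generated by the $U_\alpha$ with $\alpha$ positive (resp. negative); * $T$ normalizes every $U_\alpha$, and $\Gamma$ is generated by $T$ and the $U_\alpha$. Let $X_\pm$ be the associated twinned buildings: the chambers of $X_\pm$ are the cosets $\Gamma/B_\pm$ with $B_\pm=TU_\pm$, and $gB_\pm$, $hB_\pm$ are $s$-adjacent if $g^{-1}h\in B_\pm\cup B_\pm sB_\pm$. Let $G=\mathrm{Aut}(X_+)\times\mathrm{Aut}(X_-)$ be the product of their automorphism groups (adjacency-preserving permutations of the chambers, up to a permutation of $S$), with the topology of pointwise convergence on chambers, and let $\mathrm dh$ be a Haar measure on $G$. Assume that all root groups are finite and that the diagonal action $\Gamma\to G$ is injective, so that $\Gamma<G$. Put $q_{\min}=\min_{\alpha\in\Phi}|U_\alpha|$ and assume that $$\sum_{n\ge 0}c_n\,q_{\min}^{-n}<\infty .$$ Then $\Gamma$ is finitely generated, and there is a Borel fundamental domain $\mathscr F\subset G$ for $G/\Gamma$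 (for every $g\in G$ there is exactly one $\gamma\in\Gamma$ with $g\gamma\in\mathscr F$) of finite Haar measure such that, for every $g\in G$ and every $p\in[1,\infty)$, the induction cocycle $\alpha_{\mathscr F}$, defined by $\alpha_{\mathscr F}(g,h)=\gamma\iff gh\gamma\in\mathscr F$, has the property that $h\mapsto\alpha_{\mathscr F}(g,h)$ belongs to $L^p(\mathscr F,\mathrm dh)$. That is, $h\mapsto|\alpha_{\mathscr F}(g,h)|_\Sigma$ is measurable and $$\int_{\mathscr F}\big(|\alpha_{\mathscr F}(g,h)|_\Sigma\big)^p\,\mathrm dh<\infty ,$$ where $|\cdot|_\Sigma$ is the word length for any finite generating set $\Sigma$ of $\Gamma$. -/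

import Mathlib

open MeasureTheory
open scoped ENNReal

noncomputable section

namespace TwinLattice

/-! ### Roots of a Coxeter system, as half-spaces of `W` -/

section Roots

variable {B W : Type*} [Group W] {M : CoxeterMatrix B} (cs : CoxeterSystem M W)

/-- The half-space `α_s = {w | ℓ(w) < ℓ(s w)}` of `W` attached to a simple reflection `s`. -/
def simpleHalfSpace (i : B) : Set W := {w | cs.length w < cs.length (cs.simple i * w)}

/-- A subset of `W` is a root if it is a left translate `w α_s` of some `α_s`. -/
def IsRoot (α : Set W) : Prop :=
  ∃ (w : W) (i : B), α = (fun x => w * x) '' simpleHalfSpace cs i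

/-- The set `Φ` of roots of `(W, S)`. -/
def Root : Type _ := {α : Set W // IsRoot cs α}

variable {cs}

theorem compl_simpleHalfSpace (i : B) :
    (simpleHalfSpace cs i)ᶜ = (fun x => cs.simple i * x) '' simpleHalfSpace cs i := by
  ext x
  constructor
  · intro hx
    refine ⟨cs.simple i * x, ?_, by simp⟩
    have hne := cs.length_simple_mul_ne x i
    simp only [simpleHalfSpace, Set.mem_compl_iff, Set.mem_ofPred_eq] at hx ⊢
    simp only [CoxeterSystem.simple_mul_simple_cancel_left]
    omega
  · rintro ⟨y, hy, rfl⟩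
    simp only [simpleHalfSpace, Set.mem_compl_iff, Set.mem_ofPred_eq,
      CoxeterSystem.simple_mul_simple_cancel_left] at hy ⊢
    omega

/-- The half-space of `W` given by a root. -/
def Root.halfSpace (α : Root cs) : Set W := α.1

/-- The opposite root `-α`, the complementary half-space. -/
def Root.neg (α : Root cs) : Root cs :=
  ⟨α.1ᶜ, by
    obtain ⟨w, i, h⟩ := α.2
    refine ⟨w * cs.simple i, i, ?_⟩
    rw [h, ← Set.image_compl_eq (Group.mulLeft_bijective w), compl_simpleHalfSpace,
      Set.image_image]
    simp only [mul_assoc]⟩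

/-- The action of `W` on the roots by left translation. -/
def Root.translate (w : W) (α : Root cs) : Root cs :=
  ⟨(fun x => w * x) '' α.1, by
    obtain ⟨v, i, h⟩ := α.2
    refine ⟨w * v, i, ?_⟩
    rw [h, Set.image_image]
    simp only [mul_assoc]⟩

/-- The simple root `α_s`. -/
def Root.simple (cs : CoxeterSystem M W) (i : B) : Root cs :=
  ⟨simpleHalfSpace cs i, 1, i, by simp⟩

/-- A root is positive if it contains the identity of `W`. -/
def Root.IsPos (α : Root cs) : Prop := (1 : W) ∈ α.halfSpace

/-- The pair `{α, β}` is prenilpotent if `α ∩ β` and `(-α) ∩ (-β)` are both nonempty. -/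
def Root.Prenilpotent (α β : Root cs) : Prop :=
  (α.halfSpace ∩ β.halfSpace).Nonempty ∧ (α.neg.halfSpace ∩ β.neg.halfSpace).Nonempty

/-- The open interval `(α, β)`: the roots `γ` other than `α` and `β` such that
`α ∩ β ⊆ γ` and `(-α) ∩ (-β) ⊆ -γ`. -/
def Root.openInterval (α β : Root cs) : Set (Root cs) :=
  {γ | γ ≠ α ∧ γ ≠ β ∧ α.halfSpace ∩ β.halfSpace ⊆ γ.halfSpace ∧
    α.neg.halfSpace ∩ β.neg.halfSpace ⊆ γ.neg.halfSpace}

/-- `c_n = #{w ∈ W | ℓ_S(w) = n}`, the coefficients of the growth series of `(W, S)`. -/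
def growthCoeff (cs : CoxeterSystem M W) (n : ℕ) : ℕ := Set.ncard {w : W | cs.length w = n}

end Roots

/-! ### Root group data -/

/-- A (twin) root group datum of type `(W, S)` in the group `Γ`: root groups `U α`, indexed by all
the roots of `(W, S)`, and a subgroup `T` normalizing them. -/
structure RootGroupDatum {B W : Type*} [Group W] {M : CoxeterMatrix B} (cs : CoxeterSystem M W)
    (Γ : Type*) [Group Γ] where
  /-- the root groups -/
  U : Root cs → Subgroup Γ
  /-- the torus -/
  T : Subgroup Γ
  nontrivial : ∀ α, U α ≠ ⊥
  commutator_le : ∀ α β, α ≠ β → α.Prenilpotent β →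
    ⁅U α, U β⁆ ≤ ⨆ γ : {γ : Root cs // γ ∈ α.openInterval β}, U γ.1
  exists_reflection : ∀ i : B, ∃ m : Γ → Γ,
    (∀ u ∈ U (Root.simple cs i), u ≠ 1 →
      (∃ v ∈ U (Root.simple cs i).neg, ∃ v' ∈ U (Root.simple cs i).neg, m u = v * u * v') ∧
      ∀ (α : Root cs) (g : Γ), g ∈ U α ↔ m u * g * (m u)⁻¹ ∈ U (α.translate (cs.simple i))) ∧
    ∀ u ∈ U (Root.simple cs i), ∀ v ∈ U (Root.simple cs i), u ≠ 1 → v ≠ 1 → (m u)⁻¹ * m v ∈ T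
  neg_simple_not_le : ∀ i : B,
    ¬ U (Root.simple cs i).neg ≤ ⨆ α : {α : Root cs // α.IsPos}, U α.1
  simple_not_le : ∀ i : B,
    ¬ U (Root.simple cs i) ≤ ⨆ α : {α : Root cs // ¬ α.IsPos}, U α.1
  generate : T ⊔ ⨆ α, U α = ⊤
  normalize : ∀ t ∈ T, ∀ (α : Root cs), ∀ u ∈ U α, t * u * t⁻¹ ∈ U α

/-! ### Coset chamber systems and their automorphism groups -/

/-- The `i`-adjacency relation on the set `Γ / H` of chambers, where `H` is contained in the
subgroups `P i`: the chambers `gH` and `hH` are `i`-adjacent if `g P_i = h P_i`. -/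
def cosetAdj {B Γ : Type*} [Group Γ] (H : Subgroup Γ) (P : B → Subgroup Γ) (i : B)
    (x y : Γ ⧸ H) : Prop :=
  ∃ g h : Γ, (QuotientGroup.mk g : Γ ⧸ H) = x ∧ (QuotientGroup.mk h : Γ ⧸ H) = y ∧ g⁻¹ * h ∈ P i

/-- The group of all automorphisms of a chamber system with type set `B`: the permutations of
the chambers that preserve the adjacency relations up to a permutation of the types. -/
def chamberAut {B C : Type*} (adj : B → C → C → Prop) : Subgroup (Equiv.Perm C) where
  carrier := {σ | ∃ π : Equiv.Perm B, ∀ i x y, adj i x y ↔ adj (π i) (σ x) (σ y)}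
  one_mem' := ⟨1, fun _ _ _ => Iff.rfl⟩
  mul_mem' := by
    rintro σ τ ⟨π, hπ⟩ ⟨ρ, hρ⟩
    exact ⟨π * ρ, fun i x y => (hρ i x y).trans (hπ _ _ _)⟩
  inv_mem' := by
    rintro σ ⟨π, hπ⟩
    refine ⟨π⁻¹, fun i x y => ?_⟩
    have h := hπ (π⁻¹ i) (σ⁻¹ x) (σ⁻¹ y)
    have e1 : ∀ j, π (π⁻¹ j) = j := fun j => π.apply_symm_apply j
    have e2 : ∀ z, σ (σ⁻¹ z) = z := fun z => σ.apply_symm_apply z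
    rw [e1, e2, e2] at h
    exact h.symm

/-- The topology of pointwise convergence on chambers: the chamber stabilizers and their finite
intersections form a basis of neighbourhoods of the identity. -/
instance {B C : Type*} (adj : B → C → C → Prop) : TopologicalSpace (chamberAut adj) :=
  TopologicalSpace.induced (fun σ => ((σ : Equiv.Perm C) : C → C))
    (@Pi.topologicalSpace C (fun _ => C) (fun _ => ⊥))

/-- The action of `Γ` by left translation on the chambers of a coset chamber system. -/
def cosetAction {B Γ : Type*} [Group Γ] (H : Subgroup Γ) (P : B → Subgroup Γ) :
    Γ →* chamberAut (cosetAdj H P) :=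
  (MulAction.toPermHom Γ (Γ ⧸ H)).codRestrict _ (by
    intro γ
    refine ⟨1, fun i x y => ⟨?_, ?_⟩⟩
    · rintro ⟨g, h, rfl, rfl, hP⟩
      exact ⟨γ * g, γ * h, rfl, rfl, by simpa [mul_assoc] using hP⟩
    · rintro ⟨g, h, hx, hy, hP⟩
      refine ⟨γ⁻¹ * g, γ⁻¹ * h, ?_, ?_, by simpa [mul_assoc] using hP⟩
      · have : (QuotientGroup.mk (γ⁻¹ * g) : Γ ⧸ H) = γ⁻¹ • (QuotientGroup.mk g : Γ ⧸ H) := rfl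
        rw [this, hx]
        exact inv_smul_smul γ x
      · have : (QuotientGroup.mk (γ⁻¹ * h) : Γ ⧸ H) = γ⁻¹ • (QuotientGroup.mk h : Γ ⧸ H) := rfl
        rw [this, hy]
        exact inv_smul_smul γ y)

/-! ### The twin buildings of a root group datum -/

namespace RootGroupDatum

variable {B W : Type*} [Group W] {M : CoxeterMatrix B} {cs : CoxeterSystem M W}
  {Γ : Type*} [Group Γ] (D : RootGroupDatum cs Γ)

/-- `B₊ = T U₊`, where `U₊` is generated by the positive root groups. -/
def borelPos : Subgroup Γ := D.T ⊔ ⨆ α : {α : Root cs // α.IsPos}, D.U α.1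

/-- `B₋ = T U₋`, where `U₋` is generated by the negative root groups. -/
def borelNeg : Subgroup Γ := D.T ⊔ ⨆ α : {α : Root cs // ¬ α.IsPos}, D.U α.1

/-- The minimal parabolic subgroup `B₊ ∪ B₊ s B₊`, which is generated by `B₊` and the root
group of `-α_s`. -/
def parabolicPos (i : B) : Subgroup Γ := D.borelPos ⊔ D.U (Root.simple cs i).neg

/-- The minimal parabolic subgroup `B₋ ∪ B₋ s B₋`, which is generated by `B₋` and the root
group of `α_s`. -/
def parabolicNeg (i : B) : Subgroup Γ := D.borelNeg ⊔ D.U (Root.simple cs i)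

/-- The automorphism group of the positive building `X₊`, whose set of chambers is `Γ / B₊`. -/
abbrev AutPos : Type _ := chamberAut (cosetAdj D.borelPos D.parabolicPos)

/-- The automorphism group of the negative building `X₋`, whose set of chambers is `Γ / B₋`. -/
abbrev AutNeg : Type _ := chamberAut (cosetAdj D.borelNeg D.parabolicNeg)

/-- The ambient topological group `G = Aut(X₊) × Aut(X₋)`. -/
abbrev Ambient : Type _ := D.AutPos × D.AutNeg

/-- The diagonal homomorphism `Γ → G` given by the actions of `Γ` on `X₊` and on `X₋`. -/
def toAmbient : Γ →* D.Ambient :=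
  (cosetAction D.borelPos D.parabolicPos).prod (cosetAction D.borelNeg D.parabolicNeg)

/-- The minimal order of the root groups. -/
def qMin : ℕ := ⨅ α : Root cs, Nat.card (D.U α)

end RootGroupDatum

/-! ### Fundamental domains, the induction cocycle, word length -/

/-- `F` is a Borel fundamental domain for `G / Γ`, where `Γ` acts on `G` by right translations
through `ι`: every `Γ`-orbit meets `F`, at exactly one group element. -/
structure IsBorelFundamentalDomain {Γ G : Type*} [Group Γ] [Group G] [TopologicalSpace G]
    (ι : Γ →* G) (F : Set G) : Prop where
  measurableSet : MeasurableSet[borel G] F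
  existsUnique : ∀ g : G, ∃! γ : Γ, g * ι γ ∈ F

/-- The induction cocycle: `α(g, h)` is the unique `γ ∈ Γ` such that `g h γ ∈ F`. -/
def inductionCocycle {Γ G : Type*} [Group Γ] [Group G] [TopologicalSpace G] {ι : Γ →* G}
    {F : Set G} (hF : IsBorelFundamentalDomain ι F) (g h : G) : Γ :=
  (hF.existsUnique (g * h)).choose

/-- The word length of `γ` with respect to a generating set `A`: the least length of a word in
the elements of `A` and their inverses that represents `γ`. -/
def wordLength {Γ : Type*} [Group Γ] (A : Set Γ) (γ : Γ) : ℕ :=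
  sInf {n | ∃ l : List Γ, l.length = n ∧ (∀ x ∈ l, x ∈ A ∨ x⁻¹ ∈ A) ∧ l.prod = γ}

end TwinLattice

end

/-! Write `c₊`, `c₋` for the base chambers, `A_w` for `negStab w`, `q` for `qMin`, and `K` for the
compact open stabilizer in `G` of `(c₊, c₋)`.

By the Birkhoff decomposition of `Γ` into double cosets `B₋ w B₊` (`exists_birkhoff`,
`birkhoff_unique`), the pairs `(w c₊, c₋)` represent the `Γ`-orbits on pairs of chambers of `X₊` and
`X₋`, and `A_w` is the stabilizer of such a pair. Hence every coset `gΓ` meets exactly one `cell w`,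
in a single `A_w`-orbit, and a fundamental domain is obtained by choosing one point in each of these
finite orbits. The cells are right translates of `K` by elements coming from `Γ`. As `Γ` is
generated by finite subgroups, the modular character is trivial on these elements and all cells have
measure `μ K`. An ascent `w < ws` enlarges `A_w` by the root group of `-wα_s`, so `|A_w| ≥ q ^ ℓ(w)`
and the domain has measure at most `μ K` times the sum of `c_n q⁻ⁿ`.

For `h` in the part over `w`, the element `γ = α(g, h)` moves `c₋` a distance bounded in terms of
`g`, and some `γ w' c₊` is within `ℓ(w) + O(1)` of `c₊`. Following galleries in both buildings gives
a word length linear in `ℓ(w)` (`le_of_mem_ball`). Since `c_n` is submultiplicative, summability of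
`c_n q⁻ⁿ` forces exponential decay, so polynomial weights do no harm and every finite moment
converges.

The main algebraic difficulty is uniqueness in the Birkhoff decomposition, derived here from the
axioms by a covering argument. The pairs `(w, b A_w)` with `b` in `B₋` form a chamber system over
`X₊` by `(w, b A_w) ↦ b w c₊`. Panels map bijectively and spherical residues injectively. Minimal
galleries from `c₊` lift, and comparing the last letters of two of them inside a spherical rank two
residue shows that the end of the lift depends only on the end of the gallery
(`GalleryLift.eq_of_sameChamber`). Every pair is such an end, so the covering map is injective. -/

noncomputable section
namespace TwinLattice

/-! ### The exchange condition for Coxeter systems -/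

section Coxeter

variable {B W : Type*} [Group W] {M : CoxeterMatrix B} (cs : CoxeterSystem M W)

open Classical in
/-- The signed conjugation by a simple reflection. -/
def signedConj (i : B) : Equiv.Perm (W × ZMod 2) :=
  Function.Involutive.toPerm
    (fun p => (cs.simple i * p.1 * cs.simple i, p.2 + if p.1 = cs.simple i then 1 else 0)) (by
      rintro ⟨t, e⟩
      have h : cs.simple i * t * cs.simple i = cs.simple i ↔ t = cs.simple i := by
        constructor
        · intro h
          have := congrArg (fun x => cs.simple i * x * cs.simple i) h
          simpa [mul_assoc] using this
        · rintro rfl; simp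
      simp only [h, Prod.mk.injEq]
      refine ⟨by simp [mul_assoc], ?_⟩
      split_ifs <;> simp [add_assoc, CharTwo.add_self_eq_zero])

open Classical in
theorem signedConj_apply (i : B) (t : W) (e : ZMod 2) :
    signedConj cs i (t, e) =
      (cs.simple i * t * cs.simple i, e + if t = cs.simple i then 1 else 0) := rfl

open Classical in
-- The elements `s_j (s_i s_j)^r`, for `r < 2m`, are the walls crossed by the dihedral word `(s_i
-- s_j)^m`; the sign counts modulo 2 how often `t` occurs among them.
theorem signedConj_mul_pow (i j : B) (m : ℕ) (t : W) (e : ZMod 2) :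
    ((signedConj cs i * signedConj cs j) ^ m) (t, e) =
      ((cs.simple i * cs.simple j) ^ m * t * ((cs.simple i * cs.simple j) ^ m)⁻¹,
        e + ∑ r ∈ Finset.range (2 * m),
          if t = cs.simple j * (cs.simple i * cs.simple j) ^ r then 1 else 0) := by
  induction m with
  | zero => simp
  | succ m ih =>
    rw [pow_succ', Equiv.Perm.mul_apply, ih, Equiv.Perm.mul_apply, signedConj_apply,
      signedConj_apply, show 2 * (m + 1) = 2 * m + 1 + 1 by ring, Finset.sum_range_succ,
      Finset.sum_range_succ]
    set c := cs.simple i * cs.simple j with hc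
    have hj : cs.simple j * c * cs.simple j = c⁻¹ := by simp [hc, mul_assoc]
    have hjc : ∀ n : ℕ, cs.simple j * c ^ n * cs.simple j = (c ^ n)⁻¹ := by
      intro n
      have : (cs.simple j * c * cs.simple j) ^ n = (c⁻¹) ^ n := by rw [hj]
      rw [inv_pow] at this
      rw [← this]
      conv_rhs => rw [← cs.inv_simple j]
      rw [show (cs.simple j)⁻¹ * c * (cs.simple j)⁻¹ =
        (cs.simple j)⁻¹ * c * ((cs.simple j)⁻¹)⁻¹ by simp, conj_pow]
      simp
    have h1 : c ^ m * t * (c ^ m)⁻¹ = cs.simple j ↔ t = cs.simple j * c ^ (2 * m) := by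
      have e : (c ^ m)⁻¹ * cs.simple j * c ^ m = cs.simple j * c ^ (2 * m) := by
        rw [← hjc m]; simp [mul_assoc, two_mul, pow_add]
      constructor
      · intro h
        rw [← e, ← h]; group
      · rintro rfl
        rw [← e]; group
    have h2 : cs.simple j * (c ^ m * t * (c ^ m)⁻¹) * cs.simple j = cs.simple i ↔
        t = cs.simple j * c ^ (2 * m + 1) := by
      have e : (c ^ m)⁻¹ * (cs.simple j * cs.simple i * cs.simple j) * c ^ m =
          cs.simple j * c ^ (2 * m + 1) := by
        rw [← hjc m, show 2 * m + 1 = m + (1 + m) by ring, pow_add, pow_add]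
        simp [mul_assoc, hc]
      constructor
      · intro h
        rw [← e, ← h]; simp [mul_assoc]
      · rintro rfl
        rw [← e]; simp [mul_assoc]
    simp only [h1, h2, Prod.mk.injEq]
    refine ⟨?_, by ring⟩
    rw [pow_succ', mul_inv_rev, hc]
    simp [mul_assoc]

/-- With `m = M i j` the walls numbered `r` and `r + m` coincide, so the sum over `2m` walls cancels
in pairs modulo 2. -/
theorem signedConj_liftable : M.IsLiftable (signedConj cs) := by
  classical
  intro i j
  ext1 ⟨t, e⟩
  rw [signedConj_mul_pow, two_mul, Finset.sum_range_add]
  simp only [pow_add, cs.simple_mul_simple_pow, one_mul, CharTwo.add_self_eq_zero]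
  simp

/-- The signed conjugation action of a Coxeter group. -/
def signedConjHom : W →* Equiv.Perm (W × ZMod 2) := cs.lift ⟨signedConj cs, signedConj_liftable cs⟩

/-- The parity of the number of occurrences of `t` among the walls crossed by a gallery of
type `w`. -/
def wallParity (w t : W) : ZMod 2 := (signedConjHom cs w (t, 0)).2

open Classical in
theorem signedConjHom_wordProd (ω : List B) (t : W) (e : ZMod 2) :
    signedConjHom cs (cs.wordProd ω) (t, e) =
      (cs.wordProd ω * t * (cs.wordProd ω)⁻¹, e + ((cs.rightInvSeq ω).count t : ZMod 2)) := by
  induction ω with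
  | nil => simp
  | cons i ω ih =>
    rw [cs.wordProd_cons, map_mul, Equiv.Perm.mul_apply, ih]
    have : signedConjHom cs (cs.simple i) = signedConj cs i := cs.lift_apply_simple _ i
    rw [this, signedConj_apply, CoxeterSystem.rightInvSeq, List.count_cons]
    have h : cs.wordProd ω * t * (cs.wordProd ω)⁻¹ = cs.simple i ↔
        (cs.wordProd ω)⁻¹ * cs.simple i * cs.wordProd ω = t := by
      constructor
      · intro h; rw [← h]; group
      · rintro rfl; group
    simp only [h, beq_iff_eq, Prod.mk.injEq, Nat.cast_add]
    refine ⟨by simp [mul_assoc], ?_⟩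
    split_ifs <;> simp [add_assoc]

open Classical in
theorem wallParity_wordProd (ω : List B) (t : W) :
    wallParity cs (cs.wordProd ω) t = ((cs.rightInvSeq ω).count t : ZMod 2) := by
  simp [wallParity, signedConjHom_wordProd]

theorem signedConjHom_apply (w t : W) (e : ZMod 2) :
    signedConjHom cs w (t, e) = (w * t * w⁻¹, e + wallParity cs w t) := by
  classical
  obtain ⟨ω, rfl⟩ := cs.wordProd_surjective w
  rw [signedConjHom_wordProd, wallParity_wordProd]

theorem wallParity_mul (x y t : W) :
    wallParity cs (x * y) t = wallParity cs y t + wallParity cs x (y * t * y⁻¹) := by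
  simp only [wallParity, map_mul, Equiv.Perm.mul_apply]
  rw [signedConjHom_apply cs y, signedConjHom_apply]
  simp [wallParity]

theorem wallParity_one (t : W) : wallParity cs 1 t = 0 := by
  simp [wallParity]

open Classical in
theorem wallParity_simple (i : B) (t : W) :
    wallParity cs (cs.simple i) t = if cs.simple i = t then 1 else 0 := by
  have := wallParity_wordProd cs [i] t
  simp only [CoxeterSystem.wordProd_singleton, CoxeterSystem.rightInvSeq_singleton,
    List.count_singleton, beq_iff_eq] at this
  rw [this]; split_ifs <;> simp

/-- Write `t = w s w⁻¹`. By the cocycle rule the contributions of `w` and `w⁻¹` cancel, and the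
middle letter crosses its own wall once. -/
theorem wallParity_self {t : W} (ht : cs.IsReflection t) : wallParity cs t t = 1 := by
  obtain ⟨w, i, rfl⟩ := ht
  have h1 := wallParity_mul cs w⁻¹ w (cs.simple i)
  rw [inv_mul_cancel, wallParity_one] at h1
  rw [mul_assoc w, wallParity_mul, wallParity_mul, wallParity_simple]
  simp only [mul_assoc, inv_inv, inv_mul_cancel_left, inv_mul_cancel, mul_one,
    cs.inv_simple, mul_inv_rev] at h1 ⊢
  simp only [mul_one,
    CoxeterSystem.simple_mul_simple_self, ↓reduceIte] at h1 ⊢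
  linear_combination -h1

theorem length_mul_lt_of_wallParity {w t : W} (h : wallParity cs w t = 1) :
    cs.length (w * t) < cs.length w := by
  classical
  obtain ⟨ω, hω, rfl⟩ := cs.exists_isReduced w
  rw [wallParity_wordProd] at h
  refine (cs.isRightInversion_of_mem_rightInvSeq hω (t := t) ?_).2
  by_contra hn
  rw [List.count_eq_zero_of_not_mem hn] at h
  simp at h

theorem zmod_two_eq_one_of_ne {a : ZMod 2} (h : a ≠ 0) : a = 1 := by
  revert h; revert a; decide

/-- For the converse: if the parity for `w` is zero, the cocycle rule makes it one for `w t`, so `t`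
shortens `w t` and therefore lengthens `w`. -/
theorem wallParity_eq_one_iff {w t : W} (ht : cs.IsReflection t) :
    wallParity cs w t = 1 ↔ cs.length (w * t) < cs.length w := by
  refine ⟨length_mul_lt_of_wallParity cs, fun h => ?_⟩
  by_contra hn
  have h0 : wallParity cs w t = 0 := by
    by_contra h'; exact hn (zmod_two_eq_one_of_ne h')
  have h1 : wallParity cs (w * t) t = 1 := by
    rw [wallParity_mul, wallParity_self cs ht]
    simp [h0]
  have := length_mul_lt_of_wallParity cs h1
  rw [mul_assoc, ht.mul_self, mul_one] at this
  omega

/-- A shortening reflection is crossed an odd number of times, hence at least once, by any word,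
reduced or not. The letter at a crossing is the one to delete. -/
theorem exchange {ω : List B} {t : W} (ht : cs.IsReflection t)
    (h : cs.length (cs.wordProd ω * t) < cs.length (cs.wordProd ω)) :
    ∃ j < ω.length, cs.wordProd ω * t = cs.wordProd (ω.eraseIdx j) := by
  classical
  rw [← wallParity_eq_one_iff cs ht, wallParity_wordProd] at h
  have hm : t ∈ cs.rightInvSeq ω := by
    by_contra hn
    rw [List.count_eq_zero_of_not_mem hn] at h
    simp at h
  obtain ⟨j, hj, rfl⟩ := List.mem_iff_getElem.mp hm
  refine ⟨j, by simpa using hj, ?_⟩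
  rw [← List.getD_eq_getElem _ 1 hj, cs.wordProd_mul_getD_rightInvSeq]

/-! ### Parabolic subgroups -/

/-- The standard parabolic subgroup of type `J`. -/
def stdParabolic (J : Set B) : Subgroup W := Subgroup.closure (cs.simple '' J)

variable {cs}

theorem simple_mem_stdParabolic {J : Set B} {i : B} (hi : i ∈ J) :
    cs.simple i ∈ stdParabolic cs J := Subgroup.subset_closure ⟨i, hi, rfl⟩

theorem exists_reduced_word_stdParabolic {J : Set B} {x : W} (hx : x ∈ stdParabolic cs J) :
    ∃ ω : List B, (∀ i ∈ ω, i ∈ J) ∧ cs.IsReduced ω ∧ x = cs.wordProd ω := by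
  have key : ∀ i ∈ J, ∀ y : W,
      (∃ ω : List B, (∀ i ∈ ω, i ∈ J) ∧ cs.IsReduced ω ∧ y = cs.wordProd ω) →
      ∃ ω : List B, (∀ i ∈ ω, i ∈ J) ∧ cs.IsReduced ω ∧ y * cs.simple i = cs.wordProd ω := by
    rintro i hi y ⟨ω, hω, hr, rfl⟩
    rcases cs.length_mul_simple (cs.wordProd ω) i with h | h
    · refine ⟨ω ++ [i], ?_, ?_, by simp [cs.wordProd_append]⟩
      · intro k hk
        rcases List.mem_append.1 hk with hk | hk
        · exact hω k hk
        · rw [List.mem_singleton.1 hk]; exact hi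
      · rw [CoxeterSystem.IsReduced, cs.wordProd_append, cs.wordProd_singleton, h, hr.eq]
        simp
    · obtain ⟨j, hj, he⟩ := exchange cs (cs.isReflection_simple i) (ω := ω) (by omega)
      refine ⟨ω.eraseIdx j, fun k hk => hω k (List.mem_of_mem_eraseIdx hk), ?_, he⟩
      rw [CoxeterSystem.IsReduced, ← he]
      have := List.length_eraseIdx_add_one hj
      have := hr.eq
      omega
  induction hx using Subgroup.closure_induction_right with
  | one => exact ⟨[], by simp, by simp [CoxeterSystem.IsReduced], by simp⟩
  | mul_right y _ z hz ih =>
    obtain ⟨i, hi, rfl⟩ := hz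
    exact key i hi y ih
  | mul_inv_cancel y _ z hz ih =>
    obtain ⟨i, hi, rfl⟩ := hz
    rw [cs.inv_simple]
    exact key i hi y ih

/-- Such a `u` is the longest element of `u W_J`. The formula bounds lengths in `W_J` by `ℓ(u)`,
which is how sphericity of a residue enters later. -/
theorem length_mul_of_descents {J : Set B} {u : W}
    (hu : ∀ i ∈ J, cs.length (u * cs.simple i) < cs.length u) {x : W}
    (hx : x ∈ stdParabolic cs J) : cs.length (u * x) + cs.length x = cs.length u := by
  obtain ⟨ω, hω, hr, rfl⟩ := exists_reduced_word_stdParabolic hx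
  clear hx
  induction ω with
  | nil => simp
  | cons i ω ih =>
    have hr' : cs.IsReduced ω := by simpa using hr.drop 1
    have ih := ih (fun k hk => hω k (List.mem_cons_of_mem _ hk)) hr'
    set x := cs.wordProd ω with hx
    have hlen : cs.length (cs.wordProd (i :: ω)) = cs.length x + 1 := by
      rw [hr.eq, hr'.eq]; simp
    rw [hlen, cs.wordProd_cons, ← hx]
    obtain ⟨ω₁, h₁, e₁⟩ := cs.exists_isReduced (u * x)
    have hi := hu i (hω i List.mem_cons_self)
    have e : u = cs.wordProd (ω₁ ++ ω.reverse) := by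
      rw [cs.wordProd_append, ← e₁, cs.wordProd_reverse, ← hx]; group
    have hi' := hi
    rw [e] at hi'
    obtain ⟨j, hj, he⟩ := exchange cs (cs.isReflection_simple i) hi'
    rw [← e] at he
    have hge : cs.length u ≤ cs.length (u * (cs.simple i * x)) + (cs.length x + 1) := by
      have := cs.length_le_length_mul_add_right u (cs.simple i * x)
      have h2 : cs.length (cs.simple i * x) = cs.length x + 1 := by
        rw [← hlen, cs.wordProd_cons]
      omega
    refine le_antisymm ?_ hge
    rw [List.eraseIdx_append] at he
    split_ifs at he with hj'
    -- The deleted letter belongs to the word of `u x`, so `u s_i x` is represented by a word one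
    -- letter shorter.
    · rw [cs.wordProd_append, cs.wordProd_reverse, ← hx] at he
      have h3 : u * (cs.simple i * x) = cs.wordProd (ω₁.eraseIdx j) := by
        rw [← mul_assoc, he]; group
      have h4 := cs.length_wordProd_le (ω₁.eraseIdx j)
      rw [← h3] at h4
      have := List.length_eraseIdx_add_one hj'
      have := h₁.eq
      rw [← e₁] at this
      omega
    -- A letter deleted from the word of `x⁻¹` would express `s_i x` by fewer than `ℓ(x)` letters,
    -- against the reducedness of `i :: ω`.
    · exfalso
      rw [cs.wordProd_append, ← e₁, mul_assoc, mul_right_inj] at he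
      have h3 : cs.simple i * x = (cs.wordProd (ω.reverse.eraseIdx (j - ω₁.length)))⁻¹ := by
        have : cs.wordProd (ω.reverse.eraseIdx (j - ω₁.length)) = x⁻¹ * cs.simple i := by
          rw [he]; group
        rw [this]; simp
      have h4 := cs.length_wordProd_le (ω.reverse.eraseIdx (j - ω₁.length))
      rw [← cs.length_inv, ← h3, ← cs.wordProd_cons, hlen] at h4
      have h5 : j - ω₁.length < ω.reverse.length := by
        rw [List.length_append] at hj; omega
      have h6 := List.length_eraseIdx_add_one h5
      have := hr'.eq
      rw [← hx] at this
      rw [List.length_reverse] at h6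
      omega

/-! ### Roots and reflections -/

theorem wallParity_inv_simple (v x : W) (i : B) :
    wallParity cs (x⁻¹ * v) (cs.simple i) =
      wallParity cs v (cs.simple i) + wallParity cs x⁻¹ (v * cs.simple i * v⁻¹) := by
  rw [wallParity_mul]

theorem mem_simpleHalfSpace_iff (i : B) (x : W) :
    x ∈ simpleHalfSpace cs i ↔ wallParity cs x⁻¹ (cs.simple i) = 0 := by
  have h : cs.length (x⁻¹ * cs.simple i) = cs.length (cs.simple i * x) := by
    rw [← cs.length_inv]; simp
  have h1 := wallParity_eq_one_iff cs (w := x⁻¹) (cs.isReflection_simple i)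
  rw [h, cs.length_inv] at h1
  have hne := cs.length_simple_mul_ne x i
  simp only [simpleHalfSpace, Set.mem_ofPred_eq]
  constructor
  · intro hl
    by_contra h'
    have := h1.1 (zmod_two_eq_one_of_ne h')
    omega
  · intro h0
    rw [h0] at h1
    have : ¬ cs.length (cs.simple i * x) < cs.length x := fun h => zero_ne_one (h1.2 h)
    omega

/-- A root is one of the two sides of the wall of `v s v⁻¹`, and `e` records which side. Roots can
then be compared through their walls. -/
theorem IsRoot.exists_wallParity {α : Set W} (hα : IsRoot cs α) :
    ∃ (v : W) (i : B) (e : ZMod 2), α = (fun x => v * x) '' simpleHalfSpace cs i ∧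
      ∀ x, x ∈ α ↔ wallParity cs x⁻¹ (v * cs.simple i * v⁻¹) = e := by
  obtain ⟨v, i, rfl⟩ := hα
  refine ⟨v, i, wallParity cs v (cs.simple i), rfl, fun x => ?_⟩
  have : x ∈ (fun x => v * x) '' simpleHalfSpace cs i ↔ v⁻¹ * x ∈ simpleHalfSpace cs i := by
    constructor
    · rintro ⟨y, hy, rfl⟩; simpa using hy
    · intro h; exact ⟨_, h, by simp⟩
  rw [this, mem_simpleHalfSpace_iff, mul_inv_rev, inv_inv, wallParity_inv_simple]
  generalize wallParity cs x⁻¹ _ = a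
  generalize wallParity cs v _ = b
  revert a b; decide

namespace Root

@[ext] theorem ext {α β : Root cs} (h : ∀ x, x ∈ α.halfSpace ↔ x ∈ β.halfSpace) : α = β :=
  Subtype.ext (Set.ext h)

theorem mem_neg {α : Root cs} {x : W} : x ∈ α.neg.halfSpace ↔ x ∉ α.halfSpace := Iff.rfl

theorem mem_translate {α : Root cs} {w x : W} :
    x ∈ (α.translate w).halfSpace ↔ w⁻¹ * x ∈ α.halfSpace := by
  constructor
  · rintro ⟨y, hy, rfl⟩
    change w⁻¹ * (w * y) ∈ α.1
    rwa [inv_mul_cancel_left]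
  · intro h; exact ⟨_, h, by simp⟩

theorem mem_simple {i : B} {x : W} :
    x ∈ (Root.simple cs i).halfSpace ↔ cs.length x < cs.length (cs.simple i * x) := Iff.rfl

theorem neg_neg (α : Root cs) : α.neg.neg = α := by
  ext x; simp [mem_neg]

theorem translate_translate (α : Root cs) (v w : W) :
    (α.translate w).translate v = α.translate (v * w) := by
  ext x; simp [mem_translate, mul_assoc]

theorem translate_one (α : Root cs) : α.translate 1 = α := by
  ext x; simp [mem_translate]

theorem translate_neg (α : Root cs) (w : W) : (α.neg).translate w = (α.translate w).neg := by
  ext x; simp [mem_translate, mem_neg]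

theorem exists_eq_translate (α : Root cs) : ∃ w i, α = (Root.simple cs i).translate w := by
  obtain ⟨w, i, h⟩ := α.2
  exact ⟨w, i, Subtype.ext h⟩

theorem translate_simple_self (i : B) :
    (Root.simple cs i).translate (cs.simple i) = (Root.simple cs i).neg :=
  Subtype.ext (compl_simpleHalfSpace i).symm

theorem translate_simple_neg (i : B) :
    (Root.simple cs i).neg.translate (cs.simple i) = Root.simple cs i := by
  rw [translate_neg, translate_simple_self, neg_neg]

theorem one_mem_simple (i : B) : (1 : W) ∈ (Root.simple cs i).halfSpace := by
  simp [mem_simple]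

theorem simple_notMem_simple (i : B) : cs.simple i ∉ (Root.simple cs i).halfSpace := by
  simp [mem_simple]

theorem nonempty_halfSpace (α : Root cs) : α.halfSpace.Nonempty := by
  obtain ⟨w, i, rfl⟩ := α.exists_eq_translate
  exact ⟨w, by simp [mem_translate, one_mem_simple]⟩

theorem eq_or_eq_neg_of_wall {α : Root cs} {t : W} {e : ZMod 2}
    (h : ∀ x, x ∈ α.halfSpace ↔ wallParity cs x⁻¹ t = e) {i : B} (ht : t = cs.simple i) :
    α = Root.simple cs i ∨ α = (Root.simple cs i).neg := by
  subst ht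
  by_cases he : e = 0
  · left
    ext x
    rw [h, he]
    exact (mem_simpleHalfSpace_iff i x).symm
  · right
    ext x
    rw [h, zmod_two_eq_one_of_ne he, mem_neg]
    have := mem_simpleHalfSpace_iff (cs := cs) i x
    change _ ↔ ¬ (x ∈ simpleHalfSpace cs i)
    rw [this]
    generalize wallParity cs x⁻¹ _ = a
    revert a; decide

theorem translate_simple_of_conj {w : W} {i j : B}
    (h : w * cs.simple i * w⁻¹ = cs.simple j) :
    (Root.simple cs i).translate w = Root.simple cs j ∨
      (Root.simple cs i).translate w = (Root.simple cs j).neg := by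
  refine eq_or_eq_neg_of_wall (t := w * cs.simple i * w⁻¹) (e := wallParity cs w (cs.simple i))
    (fun x => ?_) h
  rw [mem_translate]
  change w⁻¹ * x ∈ simpleHalfSpace cs i ↔ _
  rw [mem_simpleHalfSpace_iff, mul_inv_rev, inv_inv, wallParity_inv_simple]
  generalize wallParity cs x⁻¹ _ = a
  generalize wallParity cs w _ = b
  revert a b; decide

/-- The gallery from `1` to `s_i` has a single step and crosses only the wall of `s_i`. -/
theorem eq_simple_or_neg_of_separates {α : Root cs} {i : B}
    (h : ¬ ((1 : W) ∈ α.halfSpace ↔ cs.simple i ∈ α.halfSpace)) :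
    α = Root.simple cs i ∨ α = (Root.simple cs i).neg := by
  classical
  obtain ⟨v, j, e, -, he⟩ := IsRoot.exists_wallParity α.2
  refine eq_or_eq_neg_of_wall he ?_
  by_contra hne
  apply h
  change (1 : W) ∈ α.1 ↔ cs.simple i ∈ α.1
  rw [he, he, cs.inv_simple, inv_one, wallParity_one, wallParity_simple, if_neg (Ne.symm hne)]

theorem eq_simple_of_one_mem {α : Root cs} {i : B} (h1 : (1 : W) ∈ α.halfSpace)
    (hs : cs.simple i ∉ α.halfSpace) : α = Root.simple cs i := by
  rcases eq_simple_or_neg_of_separates (α := α) (i := i) (by tauto) with h | h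
  · exact h
  · rw [h, mem_neg] at h1
    exact absurd (one_mem_simple i) h1

/-- The only root containing `w` but not `w s` is `w α_s`. -/
theorem eq_translate_of_mem {α : Root cs} {w : W} {i : B} (h1 : w ∈ α.halfSpace)
    (hs : w * cs.simple i ∉ α.halfSpace) : α = (Root.simple cs i).translate w := by
  have := eq_simple_of_one_mem (α := α.translate w⁻¹) (i := i)
    (by simpa [mem_translate] using h1) (by simpa [mem_translate] using hs)
  rw [← this, translate_translate]
  simp [translate_one]

theorem one_mem_translate_simple {w : W} {i : B} :
    (1 : W) ∈ ((Root.simple cs i).translate w).halfSpace ↔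
      cs.length w < cs.length (w * cs.simple i) := by
  rw [mem_translate, mem_simple, mul_one, cs.length_inv, ← cs.length_inv (cs.simple i * w⁻¹)]
  simp

theorem simple_mem_of_one_mem {α : Root cs} {i : B} (h1 : (1 : W) ∈ α.halfSpace)
    (hne : α ≠ Root.simple cs i) : cs.simple i ∈ α.halfSpace := by
  by_contra hs
  exact hne (eq_simple_of_one_mem h1 hs)

end Root

/-! ### Spheres in the Coxeter group and submultiplicativity of the growth coefficients -/

theorem finite_length_eq [Finite B] (n : ℕ) : {w : W | cs.length w = n}.Finite := by
  refine Set.Finite.subset ((List.finite_length_eq B n).image cs.wordProd) fun w hw => ?_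
  obtain ⟨ω, hω, rfl⟩ := cs.exists_isReduced w
  exact ⟨ω, by change ω.length = n; rw [← hω.eq]; exact hw, rfl⟩

/-- A reduced word of length `m + n` is cut after `m` letters; both pieces are reduced and their
product recovers the element. -/
theorem growthCoeff_add_le [Finite B] (m n : ℕ) :
    growthCoeff cs (m + n) ≤ growthCoeff cs m * growthCoeff cs n := by
  unfold growthCoeff
  rw [← Set.ncard_prod]
  have hfin : ({w : W | cs.length w = m} ×ˢ {w : W | cs.length w = n}).Finite :=
    (finite_length_eq m).prod (finite_length_eq n)
  refine (Set.ncard_le_ncard (t := (fun p : W × W => p.1 * p.2) '' _) ?_ (hfin.image _)).trans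
    (Set.ncard_image_le hfin)
  intro w hw
  obtain ⟨ω, hω, rfl⟩ := cs.exists_isReduced w
  have hl : ω.length = m + n := by rw [← hω.eq]; exact hw
  refine ⟨(cs.wordProd (ω.take m), cs.wordProd (ω.drop m)), ⟨?_, ?_⟩, ?_⟩
  · change cs.length _ = m
    rw [(hω.take m).eq]; simp [hl]
  · change cs.length _ = n
    rw [(hω.drop m).eq]; simp [hl]
  · simp only [← cs.wordProd_append, List.take_append_drop]

end Coxeter

end TwinLattice
end

noncomputable section
namespace TwinLattice
namespace RootGroupDatum

variable {B W : Type*} [Group W] {M : CoxeterMatrix B} {cs : CoxeterSystem M W}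
  {Γ : Type*} [Group Γ] (D : RootGroupDatum cs Γ)

/-! ### Elements permuting the root groups -/

/-- The element `g` of `Γ` permutes the root groups as `w` permutes the roots. -/
def Acts (g : Γ) (w : W) : Prop :=
  ∀ (α : Root cs) (x : Γ), x ∈ D.U α ↔ g * x * g⁻¹ ∈ D.U (α.translate w)

/-- The group `U₊` generated by the positive root groups. -/
def upos : Subgroup Γ := ⨆ α : {α : Root cs // α.IsPos}, D.U α.1

/-- The group `U₋` generated by the negative root groups. -/
def uneg : Subgroup Γ := ⨆ α : {α : Root cs // ¬ α.IsPos}, D.U α.1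

/-- The root group of the simple root `α_i`. -/
abbrev us (i : B) : Subgroup Γ := D.U (Root.simple cs i)

/-- The root group of the root `-α_i`. -/
abbrev vs (i : B) : Subgroup Γ := D.U (Root.simple cs i).neg

variable {D}

theorem Acts.mul {g h : Γ} {v w : W} (hg : D.Acts g v) (hh : D.Acts h w) :
    D.Acts (g * h) (v * w) := by
  intro α x
  rw [hh α x, hg, Root.translate_translate]
  simp [mul_assoc]

theorem Acts.inv {g : Γ} {w : W} (hg : D.Acts g w) : D.Acts g⁻¹ w⁻¹ := by
  intro α x
  rw [hg (α.translate w⁻¹) (g⁻¹ * x * g⁻¹⁻¹), Root.translate_translate]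
  simp [mul_assoc, Root.translate_one]

theorem Acts.mem {g : Γ} {w : W} (hg : D.Acts g w) {α : Root cs} {x : Γ} (hx : x ∈ D.U α) :
    g * x * g⁻¹ ∈ D.U (α.translate w) := (hg α x).1 hx

theorem Acts.mem_inv {g : Γ} {w : W} (hg : D.Acts g w) {α : Root cs} {x : Γ} (hx : x ∈ D.U α) :
    g⁻¹ * x * g ∈ D.U (α.translate w⁻¹) := by simpa using hg.inv.mem hx

theorem acts_of_mem_T {t : Γ} (ht : t ∈ D.T) : D.Acts t 1 := by
  intro α x
  rw [Root.translate_one]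
  refine ⟨fun hx => D.normalize t ht α x hx, fun hx => ?_⟩
  have := D.normalize t⁻¹ (D.T.inv_mem ht) α _ hx
  simpa [mul_assoc] using this

theorem Acts.inv_simple {g : Γ} {i : B} (hg : D.Acts g (cs.simple i)) :
    D.Acts g⁻¹ (cs.simple i) := by simpa using hg.inv

theorem Acts.us_to_vs {g : Γ} {i : B} (hg : D.Acts g (cs.simple i)) {x : Γ} (hx : x ∈ D.us i) :
    g * x * g⁻¹ ∈ D.vs i := by
  have := hg.mem hx
  rwa [Root.translate_simple_self] at this

theorem Acts.vs_to_us {g : Γ} {i : B} (hg : D.Acts g (cs.simple i)) {x : Γ} (hx : x ∈ D.vs i) :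
    g * x * g⁻¹ ∈ D.us i := by
  have := hg.mem hx
  rwa [Root.translate_simple_neg] at this

theorem Acts.us_to_vs' {g : Γ} {i : B} (hg : D.Acts g (cs.simple i)) {x : Γ} (hx : x ∈ D.us i) :
    g⁻¹ * x * g ∈ D.vs i := by simpa using hg.inv_simple.us_to_vs hx

theorem Acts.vs_to_us' {g : Γ} {i : B} (hg : D.Acts g (cs.simple i)) {x : Γ} (hx : x ∈ D.vs i) :
    g⁻¹ * x * g ∈ D.us i := by simpa using hg.inv_simple.vs_to_us hx

theorem conj_ne_one {g x : Γ} (hx : x ≠ 1) : g * x * g⁻¹ ≠ 1 := by simpa using hx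

theorem conj_ne_one' {g x : Γ} (hx : x ≠ 1) : g⁻¹ * x * g ≠ 1 := by
  simpa using conj_ne_one (g := g⁻¹) hx

variable (D)

theorem U_le_upos {α : Root cs} (h : α.IsPos) : D.U α ≤ D.upos :=
  le_iSup (fun α : {α : Root cs // α.IsPos} => D.U α.1) ⟨α, h⟩

theorem U_le_uneg {α : Root cs} (h : ¬ α.IsPos) : D.U α ≤ D.uneg :=
  le_iSup (fun α : {α : Root cs // ¬ α.IsPos} => D.U α.1) ⟨α, h⟩

theorem us_le_upos (i : B) : D.us i ≤ D.upos := D.U_le_upos (Root.one_mem_simple i)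

theorem exists_ne_one (α : Root cs) : ∃ u ∈ D.U α, u ≠ 1 := by
  obtain ⟨u, hu⟩ := Subgroup.ne_bot_iff_exists_ne_one.1 (D.nontrivial α)
  exact ⟨u, u.2, fun h => hu (Subtype.ext h)⟩

variable {D}

theorem exists_acts_of_mem_us {i : B} {u : Γ} (hu : u ∈ D.us i) (h1 : u ≠ 1) :
    ∃ a ∈ D.vs i, ∃ a' ∈ D.vs i, D.Acts (a * u * a') (cs.simple i) := by
  obtain ⟨m, hm, -⟩ := D.exists_reflection i
  obtain ⟨⟨v, hv, v', hv', e⟩, h⟩ := hm u hu h1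
  exact ⟨v, hv, v', hv', e ▸ h⟩

/-- The axiom speaks only of `U_{α_s}`; conjugation by one reflection, which exchanges `U_{α_s}` and
`U_{-α_s}`, carries it over. -/
theorem exists_acts_of_mem_vs {i : B} {v : Γ} (hv : v ∈ D.vs i) (h1 : v ≠ 1) :
    ∃ a ∈ D.us i, ∃ a' ∈ D.us i, D.Acts (a * v * a') (cs.simple i) := by
  obtain ⟨u, hu, hu1⟩ := D.exists_ne_one (Root.simple cs i)
  obtain ⟨b, -, b', -, hg⟩ := exists_acts_of_mem_us hu hu1
  generalize b * u * b' = g at hg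
  obtain ⟨a, ha, a', ha', h⟩ := exists_acts_of_mem_us (hg.vs_to_us' hv) (conj_ne_one' h1)
  refine ⟨_, hg.vs_to_us ha, _, hg.vs_to_us ha', ?_⟩
  have := (hg.mul h).mul hg.inv_simple
  simp only [cs.simple_mul_simple_self, one_mul] at this
  convert this using 1
  group

/-- A nontrivial `v` would put a reflection `a v a'` inside `U₊`; conjugating `U_{α_s}` by it would
place all of `U_{-α_s}` in `U₊`, which the axioms exclude. -/
theorem eq_one_of_mem_vs_of_mem_upos {i : B} {v : Γ} (hv : v ∈ D.vs i) (h : v ∈ D.upos) :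
    v = 1 := by
  by_contra h1
  obtain ⟨a, ha, a', ha', hg⟩ := exists_acts_of_mem_vs hv h1
  have hmem : a * v * a' ∈ D.upos :=
    mul_mem (mul_mem (D.us_le_upos i ha) h) (D.us_le_upos i ha')
  refine D.neg_simple_not_le i fun x hx => ?_
  have := mul_mem (mul_mem hmem (D.us_le_upos i (hg.vs_to_us' hx))) (inv_mem hmem)
  change x ∈ D.upos
  convert this using 1
  group

theorem eq_one_of_mem_us_of_mem_vs {i : B} {v : Γ} (hu : v ∈ D.us i) (hv : v ∈ D.vs i) :
    v = 1 := eq_one_of_mem_vs_of_mem_upos hv (D.us_le_upos i hu)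

/-- If `y ≠ 1`, the reflection `a y a'` carries `U_{-α_s}` into itself and also into `U_{α_s}`,
although these two groups meet trivially. -/
theorem eq_one_of_normalizes_vs {i : B} {y : Γ} (hy : y ∈ D.us i)
    (h : ∀ x ∈ D.vs i, y * x * y⁻¹ ∈ D.vs i) : y = 1 := by
  by_contra h1
  obtain ⟨a, ha, a', ha', hg⟩ := exists_acts_of_mem_us hy h1
  obtain ⟨v, hv, hv1⟩ := D.exists_ne_one (Root.simple cs i).neg
  refine conj_ne_one hv1 (eq_one_of_mem_us_of_mem_vs (hg.vs_to_us hv) ?_)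
  have h2 := mul_mem (mul_mem ha (h _ (mul_mem (mul_mem ha' hv) (inv_mem ha')))) (inv_mem ha)
  convert h2 using 1
  group

theorem eq_one_of_normalizes_us {i : B} {y : Γ} (hy : y ∈ D.vs i)
    (h : ∀ x ∈ D.us i, y * x * y⁻¹ ∈ D.us i) : y = 1 := by
  by_contra h1
  obtain ⟨a, ha, a', ha', hg⟩ := exists_acts_of_mem_vs hy h1
  obtain ⟨v, hv, hv1⟩ := D.exists_ne_one (Root.simple cs i)
  refine conj_ne_one hv1 (eq_one_of_mem_us_of_mem_vs ?_ (hg.us_to_vs hv))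
  have h2 := mul_mem (mul_mem ha (h _ (mul_mem (mul_mem ha' hv) (inv_mem ha')))) (inv_mem ha)
  convert h2 using 1
  group

/-- There is at most one element permuting the root groups as `s` does in `U_{-α_s} u U_{-α_s}`. -/
theorem acts_unique {i : B} {u a a' b b' : Γ} (ha : a ∈ D.vs i) (ha' : a' ∈ D.vs i)
    (hb : b ∈ D.vs i) (hb' : b' ∈ D.vs i) (h : D.Acts (a * u * a') (cs.simple i))
    (h' : D.Acts (b * u * b') (cs.simple i)) : a * u * a' = b * u * b' := by
  set g := a * u * a' with hg
  have hv : b * a⁻¹ ∈ D.vs i := mul_mem hb (inv_mem ha)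
  have hv' : a'⁻¹ * b' ∈ D.vs i := mul_mem (inv_mem ha') hb'
  have e : b * u * b' = b * a⁻¹ * g * (a'⁻¹ * b') := by rw [hg]; group
  rw [e] at h' ⊢
  generalize b * a⁻¹ = v at *
  generalize a'⁻¹ * b' = v' at *
  have h2 := h.inv_simple.mul h'
  rw [cs.simple_mul_simple_self] at h2
  -- Both `g` and `v g v'` act as `s`, so `(g⁻¹ v g) v'` preserves every root group. As `v'` lies in
  -- `U_{-α_s}`, its partner `g⁻¹ v g` in `U_{α_s}` normalizes `U_{-α_s}`.
  have hv1 : g⁻¹ * v * g = 1 := by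
    refine eq_one_of_normalizes_vs (h.vs_to_us' hv) fun x hx => ?_
    have h3 := h2.mem (mul_mem (mul_mem (inv_mem hv') hx) hv')
    rw [Root.translate_one] at h3
    convert h3 using 1
    group
  have hv1' : v = 1 := by
    by_contra hne; exact conj_ne_one' hne hv1
  subst hv1'
  have : v' = 1 := by
    refine eq_one_of_normalizes_us hv' fun x hx => ?_
    have h3 := h2.mem hx
    rw [Root.translate_one] at h3
    convert h3 using 1
    group
  simp [this]

variable (D)

/-- The axiom compares modulo `T` only the chosen elements `m(u)`. By `acts_unique` they are the
only candidates, so the comparison holds for all elements of this shape. -/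
theorem exists_refl (i : B) : ∃ m : Γ, D.Acts m (cs.simple i) ∧
    (∃ u ∈ D.us i, u ≠ 1 ∧ ∃ a ∈ D.vs i, ∃ a' ∈ D.vs i, m = a * u * a') ∧
    (∀ u ∈ D.us i, u ≠ 1 → ∀ a ∈ D.vs i, ∀ a' ∈ D.vs i, D.Acts (a * u * a') (cs.simple i) →
      m⁻¹ * (a * u * a') ∈ D.T) := by
  obtain ⟨m, hm, hT⟩ := D.exists_reflection i
  obtain ⟨u, hu, hu1⟩ := D.exists_ne_one (Root.simple cs i)
  refine ⟨m u, (hm u hu hu1).2, ?_, ?_⟩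
  · obtain ⟨⟨v, hv, v', hv', e⟩, -⟩ := hm u hu hu1
    exact ⟨u, hu, hu1, v, hv, v', hv', e⟩
  · intro x hx hx1 a ha a' ha' h
    obtain ⟨⟨v, hv, v', hv', e⟩, h'⟩ := hm x hx hx1
    rw [acts_unique ha ha' hv hv' h (e ▸ h'), ← e]
    exact hT u hu x hx hu1 hx1

/-- An element lifting the simple reflection `s_i`. -/
def refl (i : B) : Γ := (D.exists_refl i).choose

theorem acts_refl (i : B) : D.Acts (D.refl i) (cs.simple i) := (D.exists_refl i).choose_spec.1

theorem refl_eq (i : B) : ∃ u ∈ D.us i, u ≠ 1 ∧ ∃ a ∈ D.vs i, ∃ a' ∈ D.vs i,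
    D.refl i = a * u * a' := (D.exists_refl i).choose_spec.2.1

variable {D}

theorem refl_inv_mul_mem {i : B} {u a a' : Γ} (hu : u ∈ D.us i) (h1 : u ≠ 1) (ha : a ∈ D.vs i)
    (ha' : a' ∈ D.vs i) (h : D.Acts (a * u * a') (cs.simple i)) :
    (D.refl i)⁻¹ * (a * u * a') ∈ D.T :=
  (D.exists_refl i).choose_spec.2.2 u hu h1 a ha a' ha' h

/-- The conjugate `t m t⁻¹` is again a product of the type covered by `refl_inv_mul_mem`, so it lies
in `m T`. -/
theorem conj_refl_mem {t : Γ} (ht : t ∈ D.T) (i : B) :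
    (D.refl i)⁻¹ * t * D.refl i ∈ D.T := by
  obtain ⟨u, hu, hu1, a, ha, a', ha', e⟩ := D.refl_eq i
  have hu' := D.normalize t ht _ u hu
  have hb := D.normalize t ht _ a ha
  have hb' := D.normalize t ht _ a' ha'
  have hA : D.Acts (t * D.refl i * t⁻¹) (cs.simple i) := by
    simpa using ((acts_of_mem_T ht).mul (D.acts_refl i)).mul (acts_of_mem_T ht).inv
  have e2 : t * D.refl i * t⁻¹ = t * a * t⁻¹ * (t * u * t⁻¹) * (t * a' * t⁻¹) := by
    rw [e]; group
  have h := refl_inv_mul_mem hu' (conj_ne_one hu1) hb hb' (e2 ▸ hA)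
  rw [← e2] at h
  convert mul_mem h ht using 1
  group

theorem refl_mul_refl_mem (i : B) : D.refl i * D.refl i ∈ D.T := by
  obtain ⟨u, hu, hu1, a, ha, a', ha', e⟩ := D.refl_eq i
  have e2 : (D.refl i)⁻¹ = a'⁻¹ * u⁻¹ * a⁻¹ := by rw [e]; group
  have h := refl_inv_mul_mem (inv_mem hu) (inv_ne_one.2 hu1) (inv_mem ha') (inv_mem ha)
    (e2 ▸ (D.acts_refl i).inv_simple)
  rw [← e2] at h
  simpa using inv_mem h

theorem conj_refl_mem' {t : Γ} (ht : t ∈ D.T) (i : B) :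
    D.refl i * t * (D.refl i)⁻¹ ∈ D.T := by
  have h := mul_mem (mul_mem (refl_mul_refl_mem i) (conj_refl_mem ht i))
    (inv_mem (refl_mul_refl_mem (D := D) i))
  convert h using 1
  group

/-- Conjugation by `m` reduces to `refl_inv_mul_mem`. This version with `α_s` and `-α_s` exchanged
makes the axioms symmetric, as `op` requires. -/
theorem refl_inv_mul_mem_neg {i : B} {v a a' : Γ} (hv : v ∈ D.vs i) (h1 : v ≠ 1)
    (ha : a ∈ D.us i) (ha' : a' ∈ D.us i) (h : D.Acts (a * v * a') (cs.simple i)) :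
    (D.refl i)⁻¹ * (a * v * a') ∈ D.T := by
  have hm := D.acts_refl i
  set m := D.refl i with hmdef
  have hA : D.Acts (m⁻¹ * (a * v * a') * m) (cs.simple i) := by
    simpa using (hm.inv_simple.mul h).mul hm
  have e2 : m⁻¹ * (a * v * a') * m = m⁻¹ * a * m * (m⁻¹ * v * m) * (m⁻¹ * a' * m) := by group
  have h2 := refl_inv_mul_mem (hm.vs_to_us' hv) (conj_ne_one' h1) (hm.us_to_vs' ha)
    (hm.us_to_vs' ha') (e2 ▸ hA)
  rw [← e2, ← hmdef] at h2
  have h3 := conj_refl_mem' h2 i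
  rw [← hmdef] at h3
  convert h3 using 1
  group

theorem exists_mul_eq_refl_of_mem_us {i : B} {u : Γ} (hu : u ∈ D.us i) (h1 : u ≠ 1) :
    ∃ a ∈ D.vs i, ∃ a' ∈ D.vs i, ∃ t ∈ D.T, u = a * D.refl i * t * a' := by
  obtain ⟨a, ha, a', ha', h⟩ := exists_acts_of_mem_us hu h1
  refine ⟨a⁻¹, inv_mem ha, a'⁻¹, inv_mem ha', _, refl_inv_mul_mem hu h1 ha ha' h, ?_⟩
  group

theorem exists_mul_eq_refl_of_mem_vs {i : B} {u : Γ} (hu : u ∈ D.vs i) (h1 : u ≠ 1) :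
    ∃ a ∈ D.us i, ∃ a' ∈ D.us i, ∃ t ∈ D.T, u = a * D.refl i * t * a' := by
  obtain ⟨a, ha, a', ha', h⟩ := exists_acts_of_mem_vs hu h1
  refine ⟨a⁻¹, inv_mem ha, a'⁻¹, inv_mem ha', _, refl_inv_mul_mem_neg hu h1 ha ha' h, ?_⟩
  group

theorem refl_mem_sup (i : B) : D.refl i ∈ D.us i ⊔ D.vs i := by
  obtain ⟨u, hu, -, a, ha, a', ha', e⟩ := D.refl_eq i
  rw [e]
  exact mul_mem (mul_mem (Subgroup.mem_sup_right ha) (Subgroup.mem_sup_left hu))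
    (Subgroup.mem_sup_right ha')

/-! ### The opposite root group datum -/

theorem prenilpotent_neg {α β : Root cs} (h : α.Prenilpotent β) : α.neg.Prenilpotent β.neg := by
  refine ⟨h.2, ?_⟩
  rw [Root.neg_neg, Root.neg_neg]
  exact h.1

theorem neg_mem_openInterval {α β γ : Root cs} (h : γ ∈ α.neg.openInterval β.neg) :
    γ.neg ∈ α.openInterval β := by
  obtain ⟨h1, h2, h3, h4⟩ := h
  rw [Root.neg_neg, Root.neg_neg] at h4
  refine ⟨fun h => h1 (by rw [← h, Root.neg_neg]), fun h => h2 (by rw [← h, Root.neg_neg]),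
    h4, ?_⟩
  rwa [Root.neg_neg]

theorem isPos_neg {α : Root cs} : α.neg.IsPos ↔ ¬ α.IsPos := Iff.rfl

theorem iSup_neg (U : Root cs → Subgroup Γ) (p q : Root cs → Prop) (h : ∀ α, q α ↔ p α.neg) :
    ⨆ α : {α : Root cs // p α}, U (α.1.neg) = ⨆ α : {α : Root cs // q α}, U α.1 := by
  apply le_antisymm
  · refine iSup_le fun α => ?_
    exact le_iSup (fun α : {α : Root cs // q α} => U α.1)
      ⟨α.1.neg, by rw [h, Root.neg_neg]; exact α.2⟩
  · refine iSup_le fun α => ?_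
    have := le_iSup (fun α : {α : Root cs // p α} => U (α.1.neg)) ⟨α.1.neg, (h _).1 α.2⟩
    simpa only [Root.neg_neg] using this

variable (D)

theorem upos_eq_iSup_neg : ⨆ α : {α : Root cs // ¬ α.IsPos}, D.U (α.1.neg) = D.upos :=
  iSup_neg D.U _ _ fun α => by rw [isPos_neg, not_not]

theorem uneg_eq_iSup_neg : ⨆ α : {α : Root cs // α.IsPos}, D.U (α.1.neg) = D.uneg :=
  iSup_neg D.U _ _ fun α => by rw [isPos_neg]

/-- The opposite root group datum, obtained by exchanging positive and negative roots. -/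
def op : RootGroupDatum cs Γ where
  U α := D.U α.neg
  T := D.T
  nontrivial α := D.nontrivial _
  commutator_le α β hne hp := by
    refine (D.commutator_le α.neg β.neg ?_ (prenilpotent_neg hp)).trans
      (iSup_le fun γ => ?_)
    · intro h
      exact hne (by rw [← Root.neg_neg α, h, Root.neg_neg])
    · have := le_iSup (fun γ : {γ : Root cs // γ ∈ α.openInterval β} => D.U γ.1.neg)
        ⟨γ.1.neg, neg_mem_openInterval γ.2⟩
      simpa only [Root.neg_neg] using this
  exists_reflection i := by
    choose! a ha a' ha' h using fun v (hv : v ∈ D.vs i) (h1 : v ≠ 1) => exists_acts_of_mem_vs hv h1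
    refine ⟨fun v => a v * v * a' v, fun v hv h1 => ?_, fun u hu v hv hu1 hv1 => ?_⟩
    · rw [Root.neg_neg]
      refine ⟨⟨_, ha v hv h1, _, ha' v hv h1, rfl⟩, fun α g => ?_⟩
      rw [h v hv h1 α.neg g, Root.translate_neg]
    · have := mul_mem (inv_mem (refl_inv_mul_mem_neg hu hu1 (ha u hu hu1) (ha' u hu hu1)
        (h u hu hu1))) (refl_inv_mul_mem_neg hv hv1 (ha v hv hv1) (ha' v hv hv1) (h v hv hv1))
      convert this using 1
      group
  neg_simple_not_le i := by
    rw [D.uneg_eq_iSup_neg, Root.neg_neg]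
    exact D.simple_not_le i
  simple_not_le i := by
    rw [D.upos_eq_iSup_neg]
    exact D.neg_simple_not_le i
  generate := by
    rw [← D.generate]
    congr 1
    refine le_antisymm (iSup_le fun α => le_iSup D.U α.neg) (iSup_le fun α => ?_)
    have := le_iSup (fun α : Root cs => D.U α.neg) α.neg
    simpa only [Root.neg_neg] using this
  normalize t ht α := D.normalize t ht α.neg

theorem op_upos : D.op.upos = D.uneg := D.uneg_eq_iSup_neg

theorem op_borelPos : D.op.borelPos = D.borelNeg := by
  change D.T ⊔ D.op.upos = D.T ⊔ D.uneg
  rw [op_upos]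

theorem op_parabolicPos (i : B) : D.op.parabolicPos i = D.parabolicNeg i := by
  change D.op.borelPos ⊔ D.U (Root.simple cs i).neg.neg = D.borelNeg ⊔ D.U (Root.simple cs i)
  rw [op_borelPos, Root.neg_neg]

theorem op_vs (i : B) : D.op.vs i = D.us i := by
  change D.U (Root.simple cs i).neg.neg = _
  rw [Root.neg_neg]

end RootGroupDatum
end TwinLattice
end

noncomputable section
namespace TwinLattice
namespace RootGroupDatum

variable {B W : Type*} [Group W] {M : CoxeterMatrix B} {cs : CoxeterSystem M W}
  {Γ : Type*} [Group Γ] {D : RootGroupDatum cs Γ}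

/-! ### Lifting the Coxeter group -/

/-- If `w s_i w⁻¹ = s_j` then `w α_i` is `α_j` or `-α_j`; the two signs are handled by the two forms
of `refl_inv_mul_mem`. -/
theorem acts_conj_refl {n : Γ} {w : W} (hn : D.Acts n w) {i j : B}
    (h : w * cs.simple i * w⁻¹ = cs.simple j) :
    (D.refl j)⁻¹ * (n * D.refl i * n⁻¹) ∈ D.T := by
  obtain ⟨u, hu, hu1, a, ha, a', ha', e⟩ := D.refl_eq i
  have hA : D.Acts (n * D.refl i * n⁻¹) (cs.simple j) := by
    rw [← h]; exact (hn.mul (D.acts_refl i)).mul hn.inv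
  have e2 : n * D.refl i * n⁻¹ = n * a * n⁻¹ * (n * u * n⁻¹) * (n * a' * n⁻¹) := by
    rw [e]; group
  have hu := hn.mem hu
  have ha := hn.mem ha
  have ha' := hn.mem ha'
  rw [Root.translate_neg] at ha ha'
  rcases Root.translate_simple_of_conj h with h | h
  · rw [h] at hu ha ha'
    rw [e2] at hA ⊢
    exact refl_inv_mul_mem hu (conj_ne_one hu1) ha ha' hA
  · rw [h] at hu ha ha'
    rw [Root.neg_neg] at ha ha'
    rw [e2] at hA ⊢
    exact refl_inv_mul_mem_neg hu (conj_ne_one hu1) ha ha' hA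

/-- A dihedral relation is rewritten as a conjugacy relation between generators. In that form it
passes from `W` to the quotient of the normalizer of `T`, through `conj_reflClass`. -/
theorem conj_eq_iff_pow_even {G : Type*} [Group G] {x y : G} (hx : x * x = 1) (hy : y * y = 1)
    (k : ℕ) : (y * x) ^ k * y * x * ((y * x) ^ k * y)⁻¹ = x ↔ (x * y) ^ (2 * (k + 1)) = 1 := by
  have hx' : x⁻¹ = x := inv_eq_of_mul_eq_one_left hx
  have hy' : y⁻¹ = y := inv_eq_of_mul_eq_one_left hy
  have hz : ((y * x) ^ k * y)⁻¹ = (y * x) ^ k * y := by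
    rw [mul_inv_rev, ← inv_pow, mul_inv_rev, hx', hy', mul_pow_mul]
  have hxz : x * ((y * x) ^ k * y) = (x * y) ^ (k + 1) := by
    rw [← mul_assoc, ← mul_pow_mul, mul_assoc, pow_succ]
  rw [mul_inv_eq_iff_eq_mul, hxz, ← inv_inj, mul_inv_rev, hz, hx', hxz,
    eq_inv_iff_mul_eq_one, ← pow_add, two_mul]

theorem conj_eq_iff_pow_odd {G : Type*} [Group G] {x y : G} (hx : x * x = 1) (hy : y * y = 1)
    (k : ℕ) : (y * x) ^ k * y * ((y * x) ^ k)⁻¹ = x ↔ (x * y) ^ (2 * k + 1) = 1 := by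
  have hx' : x⁻¹ = x := inv_eq_of_mul_eq_one_left hx
  have hy' : y⁻¹ = y := inv_eq_of_mul_eq_one_left hy
  rw [mul_inv_eq_iff_eq_mul, mul_pow_mul, ← inv_mul_eq_one (a := y * (x * y) ^ k), mul_inv_rev,
    ← inv_pow, mul_inv_rev, hx', hy', ← mul_pow_mul,
    show (y * x) ^ k * y * ((x * y) ^ k * x) = (y * x) ^ (2 * k + 1) by
      rw [mul_assoc, ← mul_assoc y, ← mul_pow_mul, mul_assoc _ y x, ← pow_succ, ← pow_add]
      congr 1; ring,
    ← inv_eq_one, ← inv_pow, mul_inv_rev, hx', hy']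

theorem Acts.pow {g : Γ} {w : W} (hg : D.Acts g w) (k : ℕ) : D.Acts (g ^ k) (w ^ k) := by
  induction k with
  | zero => simpa using acts_of_mem_T D.T.one_mem
  | succ k ih => rw [pow_succ, pow_succ]; exact ih.mul hg

variable (D) in
theorem refl_mem_normalizer (i : B) : D.refl i ∈ Subgroup.normalizer (D.T : Set Γ) := by
  rw [Subgroup.mem_normalizer_iff]
  refine fun t => ⟨fun ht => conj_refl_mem' ht i, fun ht => ?_⟩
  simpa [mul_assoc] using conj_refl_mem ht i

variable (D) in
/-- The quotient of the normalizer of `T` by `T`. -/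
abbrev WeylQuotient : Type _ :=
  Subgroup.normalizer (D.T : Set Γ) ⧸ D.T.subgroupOf (Subgroup.normalizer (D.T : Set Γ))

variable (D) in
/-- The class of the lift of a simple reflection. -/
def reflClass (i : B) : D.WeylQuotient := QuotientGroup.mk ⟨D.refl i, D.refl_mem_normalizer i⟩

theorem reflClass_mul_self (i : B) : D.reflClass i * D.reflClass i = 1 := by
  rw [reflClass, ← QuotientGroup.mk_mul, QuotientGroup.eq_one_iff, Subgroup.mem_subgroupOf]
  exact refl_mul_refl_mem i

theorem conj_reflClass {n : Subgroup.normalizer (D.T : Set Γ)} {w : W} (hn : D.Acts n w) {i j : B}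
    (h : w * cs.simple i * w⁻¹ = cs.simple j) :
    (n : D.WeylQuotient) * D.reflClass i * (n : D.WeylQuotient)⁻¹ = D.reflClass j := by
  rw [reflClass, reflClass, ← QuotientGroup.mk_mul, ← QuotientGroup.mk_inv, ← QuotientGroup.mk_mul,
    eq_comm, QuotientGroup.eq, Subgroup.mem_subgroupOf]
  exact acts_conj_refl hn h

variable (D) in
theorem reflClass_liftable : M.IsLiftable D.reflClass := by
  intro i j
  set a : Subgroup.normalizer (D.T : Set Γ) := ⟨D.refl i, D.refl_mem_normalizer i⟩ with ha
  set b : Subgroup.normalizer (D.T : Set Γ) := ⟨D.refl j, D.refl_mem_normalizer j⟩ with hb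
  have hA : D.Acts (a : Γ) (cs.simple i) := D.acts_refl i
  have hB : D.Acts (b : Γ) (cs.simple j) := D.acts_refl j
  have hσ : D.reflClass i = (a : D.WeylQuotient) := rfl
  have hτ : D.reflClass j = (b : D.WeylQuotient) := rfl
  have hi := D.reflClass_mul_self i
  have hj := D.reflClass_mul_self j
  set σ := D.reflClass i
  set τ := D.reflClass j
  have hi' := cs.simple_mul_simple_self i
  have hj' := cs.simple_mul_simple_self j
  have hM := cs.simple_mul_simple_pow i j
  rcases Nat.even_or_odd' (M i j) with ⟨k, hk | hk⟩
  -- The value `M i j = 0` encodes infinite order, and then there is no relation to check.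
  · rcases k with _ | k
    · rw [hk]; simp
    · have hx : D.Acts (((b * a) ^ k * b : Subgroup.normalizer (D.T : Set Γ)) : Γ)
          ((cs.simple j * cs.simple i) ^ k * cs.simple j) := by
        simpa using ((hB.mul hA).pow k).mul hB
      rw [hk] at hM ⊢
      exact (conj_eq_iff_pow_even hi hj k).1
        (conj_reflClass hx ((conj_eq_iff_pow_even hi' hj' k).2 hM))
  · have hx : D.Acts (((b * a) ^ k : Subgroup.normalizer (D.T : Set Γ)) : Γ)
        ((cs.simple j * cs.simple i) ^ k) := by
      simpa using (hB.mul hA).pow k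
    rw [hk] at hM ⊢
    exact (conj_eq_iff_pow_odd hi hj k).1
      (conj_reflClass hx ((conj_eq_iff_pow_odd hi' hj' k).2 hM))

variable (D) in
/-- The homomorphism from `W` to the quotient of the normalizer of `T` by `T`. -/
def weylHom : W →* D.WeylQuotient := cs.lift ⟨D.reflClass, D.reflClass_liftable⟩

variable (D) in
/-- The element `n` of the normalizer of `T` lifts `w`. -/
def Lifts (n : Γ) (w : W) : Prop :=
  ∃ h : n ∈ Subgroup.normalizer (D.T : Set Γ), (QuotientGroup.mk ⟨n, h⟩ : D.WeylQuotient) =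
    D.weylHom w

theorem Lifts.mul {n n' : Γ} {w w' : W} (h : D.Lifts n w) (h' : D.Lifts n' w') :
    D.Lifts (n * n') (w * w') := by
  obtain ⟨h, e⟩ := h
  obtain ⟨h', e'⟩ := h'
  refine ⟨mul_mem h h', ?_⟩
  rw [map_mul, ← e, ← e', ← QuotientGroup.mk_mul]
  rfl

theorem Lifts.inv {n : Γ} {w : W} (h : D.Lifts n w) : D.Lifts n⁻¹ w⁻¹ := by
  obtain ⟨h, e⟩ := h
  refine ⟨inv_mem h, ?_⟩
  rw [map_inv, ← e, ← QuotientGroup.mk_inv]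
  rfl

theorem lifts_refl (i : B) : D.Lifts (D.refl i) (cs.simple i) :=
  ⟨D.refl_mem_normalizer i, by rw [weylHom, cs.lift_apply_simple]; rfl⟩

theorem lifts_one_iff {t : Γ} : D.Lifts t 1 ↔ t ∈ D.T := by
  constructor
  · rintro ⟨h, e⟩
    rwa [map_one, QuotientGroup.eq_one_iff, Subgroup.mem_subgroupOf] at e
  · intro ht
    refine ⟨Subgroup.le_normalizer ht, ?_⟩
    rwa [map_one, QuotientGroup.eq_one_iff, Subgroup.mem_subgroupOf]

theorem exists_lifts (w : W) : ∃ n, D.Lifts n w := by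
  obtain ⟨⟨n, h⟩, e⟩ := QuotientGroup.mk_surjective (D.weylHom w)
  exact ⟨n, h, e⟩

theorem Lifts.inv_mul_mem {n n' : Γ} {w : W} (h : D.Lifts n w) (h' : D.Lifts n' w) :
    n⁻¹ * n' ∈ D.T := by
  have := h.inv.mul h'
  rwa [inv_mul_cancel, lifts_one_iff] at this

theorem Lifts.mul_refl {n : Γ} {w : W} (h : D.Lifts n w) (i : B) :
    D.Lifts (n * D.refl i) (w * cs.simple i) := h.mul (lifts_refl i)

theorem Lifts.conj_mem {n t : Γ} {w : W} (h : D.Lifts n w) (ht : t ∈ D.T) :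
    n * t * n⁻¹ ∈ D.T := by
  simpa [lifts_one_iff] using (h.mul (lifts_one_iff.2 ht)).mul h.inv

theorem Lifts.acts {n : Γ} {w : W} (h : D.Lifts n w) : D.Acts n w := by
  induction w using cs.simple_induction_left generalizing n with
  | one => exact acts_of_mem_T (lifts_one_iff.1 h)
  | mul_simple_left w i ih =>
    have h' := (lifts_refl i).inv.mul h
    rw [inv_mul_cancel_left] at h'
    have := (D.acts_refl i).mul (ih h')
    rwa [mul_inv_cancel_left] at this

/-! ### Groups generated by root groups -/

variable (D) in
/-- The group generated by the root groups of the roots satisfying `p`. -/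
def span (p : Root cs → Prop) : Subgroup Γ := ⨆ α : {α : Root cs // p α}, D.U α.1

theorem U_le_span {p : Root cs → Prop} {α : Root cs} (h : p α) : D.U α ≤ D.span p :=
  le_iSup (fun α : {α : Root cs // p α} => D.U α.1) ⟨α, h⟩

theorem span_le {p : Root cs → Prop} {H : Subgroup Γ} : D.span p ≤ H ↔ ∀ α, p α → D.U α ≤ H := by
  rw [span, iSup_le_iff]
  exact ⟨fun h α hα => h ⟨α, hα⟩, fun h α => h α.1 α.2⟩

theorem Acts.conj_span {g : Γ} {w : W} (hg : D.Acts g w) {p q : Root cs → Prop}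
    (h : ∀ α, p α → q (α.translate w)) {x : Γ} (hx : x ∈ D.span p) : g * x * g⁻¹ ∈ D.span q := by
  have : D.span p ≤ (D.span q).comap (MulAut.conj g).toMonoidHom :=
    span_le.2 fun α hα y hy => U_le_span (h α hα) (hg.mem hy)
  exact this hx

theorem conj_span_of_mem_T {t : Γ} (ht : t ∈ D.T) {p : Root cs → Prop} {x : Γ}
    (hx : x ∈ D.span p) : t * x * t⁻¹ ∈ D.span p :=
  (acts_of_mem_T ht).conj_span (fun α h => by rwa [Root.translate_one]) hx

theorem mem_sup_T_span {p : Root cs → Prop} {x : Γ} :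
    x ∈ D.T ⊔ D.span p ↔ ∃ t ∈ D.T, ∃ y ∈ D.span p, x = t * y := by
  constructor
  · intro hx
    rw [Subgroup.sup_eq_closure_mul] at hx
    refine Subgroup.closure_induction (p := fun x _ => ∃ t ∈ D.T, ∃ y ∈ D.span p, x = t * y)
      ?_ ⟨1, one_mem _, 1, one_mem _, by simp⟩ ?_ ?_ hx
    · rintro x ⟨t, ht, y, hy, rfl⟩
      exact ⟨t, ht, y, hy, rfl⟩
    · rintro _ _ - - ⟨t, ht, y, hy, rfl⟩ ⟨t', ht', y', hy', rfl⟩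
      refine ⟨t * t', mul_mem ht ht', t'⁻¹ * y * t' * y', mul_mem ?_ hy', by group⟩
      simpa using conj_span_of_mem_T (inv_mem ht') hy
    · rintro _ - ⟨t, ht, y, hy, rfl⟩
      exact ⟨t⁻¹, inv_mem ht, t * y⁻¹ * t⁻¹, conj_span_of_mem_T ht (inv_mem hy), by group⟩
  · rintro ⟨t, ht, y, hy, rfl⟩
    exact mul_mem (Subgroup.mem_sup_left ht) (Subgroup.mem_sup_right hy)

theorem conj_mem_span_of_commutator {α β : Root cs} {p : Root cs → Prop} (hne : α ≠ β)
    (hp : α.Prenilpotent β) (hβ : p β) (h : ∀ γ ∈ α.openInterval β, p γ) {x y : Γ}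
    (hx : x ∈ D.U α) (hy : y ∈ D.U β) : x * y * x⁻¹ ∈ D.span p := by
  have h2 := D.commutator_le α β hne hp (Subgroup.commutator_mem_commutator hx hy)
  have hle : ⨆ γ : {γ : Root cs // γ ∈ α.openInterval β}, D.U γ.1 ≤ D.span p :=
    iSup_le fun γ => U_le_span (h γ.1 γ.2)
  have := mul_mem (hle h2) (U_le_span hβ hy)
  rwa [commutatorElement_def, inv_mul_cancel_right] at this

/-- The elements whose left multiplications preserve a set. -/
def leftStab (S : Γ → Prop) : Subgroup Γ where
  carrier := {g | ∀ h, S (g * h) ↔ S h}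
  one_mem' h := by simp
  mul_mem' {a b} ha hb h := by rw [mul_assoc, ha, hb]
  inv_mem' {a} ha h := by rw [← ha, mul_inv_cancel_left]

theorem le_leftStab {S : Γ → Prop} {H : Subgroup Γ} (h : ∀ g ∈ H, ∀ x, S x → S (g * x)) :
    H ≤ leftStab S := fun g hg x =>
  ⟨fun hx => by simpa using h g⁻¹ (inv_mem hg) _ hx, fun hx => h g hg x hx⟩

theorem U_translate_le {g : Γ} {w : W} (hg : D.Acts g w) {α : Root cs} {H : Subgroup Γ}
    (hα : D.U α ≤ H) (hgH : g ∈ H) : D.U (α.translate w) ≤ H := by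
  intro x hx
  have h1 := hg.mem_inv hx
  rw [Root.translate_translate, inv_mul_cancel, Root.translate_one] at h1
  convert mul_mem (mul_mem hgH (hα h1)) (inv_mem hgH) using 1
  group

/-- Each reflection lies in the group generated by `U_{α_s}` and `U_{-α_s}`, and every root group is
conjugate to a simple one by a product of reflections. -/
theorem U_le_of_simple_le {H : Subgroup Γ} (h : ∀ i, D.us i ≤ H) (h' : ∀ i, D.vs i ≤ H)
    (α : Root cs) : D.U α ≤ H := by
  have hr : ∀ i, D.refl i ∈ H := fun i => sup_le (h i) (h' i) (refl_mem_sup i)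
  obtain ⟨w, i, rfl⟩ := α.exists_eq_translate
  induction w using cs.simple_induction_left with
  | one => rw [Root.translate_one]; exact h i
  | mul_simple_left w j ih =>
    rw [← Root.translate_translate]
    exact U_translate_le (D.acts_refl j) ih (hr j)

theorem eq_top_of_le {H : Subgroup Γ} (hT : D.T ≤ H) (h : ∀ i, D.us i ≤ H)
    (h' : ∀ i, D.vs i ≤ H) : H = ⊤ := by
  rw [eq_top_iff, ← D.generate]
  exact sup_le hT (iSup_le (U_le_of_simple_le h h'))

end RootGroupDatum
end TwinLattice
end

noncomputable section
namespace TwinLattice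
namespace RootGroupDatum

variable {B W : Type*} [Group W] {M : CoxeterMatrix B} {cs : CoxeterSystem M W}
  {Γ : Type*} [Group Γ] {D : RootGroupDatum cs Γ}

/-! ### The structure of the minimal parabolic subgroups -/

theorem T_le_borelPos : D.T ≤ D.borelPos := le_sup_left

theorem T_le_borelNeg : D.T ≤ D.borelNeg := le_sup_left

theorem upos_le_borelPos : D.upos ≤ D.borelPos := le_sup_right

theorem uneg_le_borelNeg : D.uneg ≤ D.borelNeg := le_sup_right

theorem us_le_borelPos (i : B) : D.us i ≤ D.borelPos := (D.us_le_upos i).trans upos_le_borelPos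

variable (D) in
/-- The group generated by the root groups of the roots containing `s_i`. -/
def uposSimple (i : B) : Subgroup Γ := D.span fun α => cs.simple i ∈ α.halfSpace

theorem Acts.upos_to_uposSimple {g : Γ} {i : B} (hg : D.Acts g (cs.simple i)) {x : Γ}
    (hx : x ∈ D.upos) : g * x * g⁻¹ ∈ D.uposSimple i :=
  hg.conj_span (fun α (h : (1 : W) ∈ α.halfSpace) => by simpa [Root.mem_translate] using h) hx

theorem Acts.uposSimple_to_upos {g : Γ} {i : B} (hg : D.Acts g (cs.simple i)) {x : Γ}
    (hx : x ∈ D.uposSimple i) : g * x * g⁻¹ ∈ D.upos :=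
  hg.conj_span (q := Root.IsPos) (fun α h => by
    simpa [Root.IsPos, Root.mem_translate] using h) hx

theorem eq_one_of_mem_us_of_mem_uposSimple {i : B} {u : Γ} (hu : u ∈ D.us i)
    (h : u ∈ D.uposSimple i) : u = 1 := by
  by_contra h1
  exact conj_ne_one h1 (eq_one_of_mem_vs_of_mem_upos ((D.acts_refl i).us_to_vs hu)
    ((D.acts_refl i).uposSimple_to_upos h))

/-- If `{α_s, β}` is prenilpotent, the commutator involves only positive roots other than `α_s`, and
these contain `s`. Otherwise `{-α_s, β}` is prenilpotent. Then `u = a⁻¹ m a'⁻¹` with `m` acting as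
`s`: conjugation by `a'⁻¹` stays in `U₊`, `m` moves `U₊` to the group of the roots containing `s`,
and `a` already lies in that group. -/
theorem conj_mem_uposSimple {i : B} {u : Γ} (hu : u ∈ D.us i) {β : Root cs} (hβ : β.IsPos)
    (hne : β ≠ Root.simple cs i) {x : Γ} (hx : x ∈ D.U β) : u * x * u⁻¹ ∈ D.uposSimple i := by
  have hs := Root.simple_mem_of_one_mem hβ hne
  have hvs : D.vs i ≤ D.uposSimple i :=
    U_le_span (p := fun α => cs.simple i ∈ α.halfSpace) (Root.simple_notMem_simple i)
  by_cases hp : (Root.simple cs i).Prenilpotent β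
  · refine conj_mem_span_of_commutator (p := fun α => cs.simple i ∈ α.halfSpace) hne.symm hp hs
      (fun γ hγ => ?_) hu hx
    exact Root.simple_mem_of_one_mem (hγ.2.2.1 ⟨Root.one_mem_simple i, hβ⟩) hγ.1
  · by_cases h1 : u = 1
    · subst h1
      rw [one_mul, inv_one, mul_one]
      exact U_le_span (p := fun α => cs.simple i ∈ α.halfSpace) hs hx
    obtain ⟨a, ha, a', ha', hg⟩ := exists_acts_of_mem_us hu h1
    have hp' : (Root.simple cs i).neg.Prenilpotent β := by
      refine ⟨⟨cs.simple i, Root.simple_notMem_simple i, hs⟩, ?_⟩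
      obtain ⟨y, hy⟩ := β.neg.nonempty_halfSpace
      refine ⟨y, ?_, hy⟩
      rw [Root.neg_neg]
      by_contra hy'
      exact hp ⟨⟨1, Root.one_mem_simple i, hβ⟩, ⟨y, hy', hy⟩⟩
    have hne' : (Root.simple cs i).neg ≠ β := by
      rintro rfl
      exact hβ (Root.one_mem_simple i)
    have h2 : a'⁻¹ * x * a'⁻¹⁻¹ ∈ D.upos := by
      refine conj_mem_span_of_commutator (p := Root.IsPos) hne' hp' hβ (fun γ hγ => ?_)
        (inv_mem ha') hx
      by_contra hγ1
      have hγs : cs.simple i ∈ γ.halfSpace := hγ.2.2.1 ⟨Root.simple_notMem_simple i, hs⟩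
      refine hγ.1 ?_
      rw [← Root.eq_simple_of_one_mem (α := γ.neg) (i := i) hγ1 (fun h => h hγs), Root.neg_neg]
    have h3 := hg.upos_to_uposSimple h2
    have h4 := mul_mem (mul_mem (inv_mem (hvs ha)) h3) (hvs ha)
    convert h4 using 1
    group

variable (D) in
/-- The complement of `U_{α_s}` in `U₊`. -/
def usCompl (i : B) : Subgroup Γ :=
  Subgroup.closure {x | ∃ u ∈ D.us i, ∃ β : Root cs, β.IsPos ∧ β ≠ Root.simple cs i ∧
    ∃ y ∈ D.U β, x = u * y * u⁻¹}

theorem usCompl_le_upos (i : B) : D.usCompl i ≤ D.upos := by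
  rw [usCompl, Subgroup.closure_le]
  rintro _ ⟨u, hu, β, hβ, -, y, hy, rfl⟩
  exact mul_mem (mul_mem (D.us_le_upos i hu) (D.U_le_upos hβ hy)) (inv_mem (D.us_le_upos i hu))

theorem usCompl_le_uposSimple (i : B) : D.usCompl i ≤ D.uposSimple i := by
  rw [usCompl, Subgroup.closure_le]
  rintro _ ⟨u, hu, β, hβ, hne, y, hy, rfl⟩
  exact conj_mem_uposSimple hu hβ hne hy

theorem conj_us_mem_usCompl {i : B} {u x : Γ} (hu : u ∈ D.us i) (hx : x ∈ D.usCompl i) :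
    u * x * u⁻¹ ∈ D.usCompl i := by
  have : D.usCompl i ≤ (D.usCompl i).comap (MulAut.conj u).toMonoidHom := by
    conv_lhs => rw [usCompl]
    rw [Subgroup.closure_le]
    rintro _ ⟨u', hu', β, hβ, hne, y, hy, rfl⟩
    refine Subgroup.subset_closure ⟨u * u', mul_mem hu hu', β, hβ, hne, y, hy, ?_⟩
    simp [mul_assoc]
  exact this hx

theorem exists_us_mul_usCompl {i : B} {x : Γ} (hx : x ∈ D.upos) :
    ∃ u ∈ D.us i, ∃ q ∈ D.usCompl i, x = u * q := by
  refine Subgroup.iSup_induction (C := fun x => ∃ u ∈ D.us i, ∃ q ∈ D.usCompl i, x = u * q)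
    _ hx ?_ ⟨1, one_mem _, 1, one_mem _, by simp⟩ ?_
  · rintro ⟨β, hβ⟩ y hy
    by_cases hne : β = Root.simple cs i
    · subst hne
      exact ⟨y, hy, 1, one_mem _, by simp⟩
    · exact ⟨1, one_mem _, y, Subgroup.subset_closure
        ⟨1, one_mem _, β, hβ, hne, y, hy, by simp⟩, by simp⟩
  · rintro _ _ ⟨u, hu, q, hq, rfl⟩ ⟨u', hu', q', hq', rfl⟩
    refine ⟨u * u', mul_mem hu hu', u'⁻¹ * q * u' * q', mul_mem ?_ hq', by group⟩
    simpa using conj_us_mem_usCompl (inv_mem hu') hq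

/-- The complement is thereby the intersection of `U₊` with its conjugate by `s`, a description
symmetric under `s`; hence elements acting as `s` normalize it. -/
theorem mem_usCompl_iff {i : B} {x : Γ} :
    x ∈ D.usCompl i ↔ x ∈ D.upos ∧ x ∈ D.uposSimple i := by
  refine ⟨fun h => ⟨usCompl_le_upos i h, usCompl_le_uposSimple i h⟩, ?_⟩
  rintro ⟨h, h'⟩
  obtain ⟨u, hu, q, hq, rfl⟩ := exists_us_mul_usCompl (i := i) h
  have : u = 1 := by
    refine eq_one_of_mem_us_of_mem_uposSimple hu ?_
    simpa using mul_mem h' (inv_mem (usCompl_le_uposSimple i hq))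
  simpa [this] using hq

theorem Acts.conj_mem_usCompl {g : Γ} {i : B} (hg : D.Acts g (cs.simple i)) {x : Γ}
    (hx : x ∈ D.usCompl i) : g * x * g⁻¹ ∈ D.usCompl i := by
  rw [mem_usCompl_iff] at hx ⊢
  exact ⟨hg.uposSimple_to_upos hx.2, hg.upos_to_uposSimple hx.1⟩

theorem Acts.conj_mem_usCompl' {g : Γ} {i : B} (hg : D.Acts g (cs.simple i)) {x : Γ}
    (hx : x ∈ D.usCompl i) : g⁻¹ * x * g ∈ D.usCompl i := by
  simpa using hg.inv_simple.conj_mem_usCompl hx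

theorem conj_upos_of_mem_borelPos {b x : Γ} (hb : b ∈ D.borelPos) (hx : x ∈ D.upos) :
    b * x * b⁻¹ ∈ D.upos := by
  obtain ⟨t, ht, y, hy, rfl⟩ := mem_sup_T_span.1 hb
  have := conj_span_of_mem_T ht (mul_mem (mul_mem hy hx) (inv_mem hy))
  change _ ∈ D.span Root.IsPos
  convert this using 1
  group

theorem refl_notMem_borelPos (i : B) : D.refl i ∉ D.borelPos := by
  intro h
  obtain ⟨v, hv, hv1⟩ := D.exists_ne_one (Root.simple cs i).neg
  refine hv1 (eq_one_of_mem_vs_of_mem_upos hv ?_)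
  have := conj_upos_of_mem_borelPos h (D.us_le_upos i ((D.acts_refl i).vs_to_us' hv))
  convert this using 1
  group

theorem eq_one_of_mem_vs_of_mem_borelPos {i : B} {v : Γ} (hv : v ∈ D.vs i)
    (h : v ∈ D.borelPos) : v = 1 := by
  by_contra h1
  obtain ⟨a, ha, a', ha', t, ht, e⟩ := exists_mul_eq_refl_of_mem_vs hv h1
  refine D.refl_notMem_borelPos i ?_
  have : D.refl i = a⁻¹ * v * a'⁻¹ * t⁻¹ := by rw [e]; group
  rw [this]
  exact mul_mem (mul_mem (mul_mem (inv_mem (us_le_borelPos i ha)) h)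
    (inv_mem (us_le_borelPos i ha'))) (inv_mem (T_le_borelPos ht))

theorem us_le_parabolicPos (i : B) : D.us i ≤ D.parabolicPos i :=
  (us_le_borelPos i).trans le_sup_left

theorem borelPos_le_parabolicPos (i : B) : D.borelPos ≤ D.parabolicPos i := le_sup_left

theorem vs_le_parabolicPos (i : B) : D.vs i ≤ D.parabolicPos i := le_sup_right

theorem refl_mem_parabolicPos (i : B) : D.refl i ∈ D.parabolicPos i :=
  (sup_le (us_le_parabolicPos i) (vs_le_parabolicPos i)) (refl_mem_sup i)

/-- `P_s = B₊ ∪ U_{α_s} s B₊`. -/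
theorem mem_parabolicPos {i : B} {h : Γ} (hh : h ∈ D.parabolicPos i) :
    h ∈ D.borelPos ∨ ∃ x ∈ D.us i, ∃ b ∈ D.borelPos, h = x * D.refl i * b := by
  have hm := D.acts_refl i
  set m := D.refl i with hmdef
  set S : Γ → Prop := fun h => h ∈ D.borelPos ∨ ∃ x ∈ D.us i, ∃ b ∈ D.borelPos, h = x * m * b
    with hS
  have hmm : m * m ∈ D.borelPos := T_le_borelPos (refl_mul_refl_mem i)
  have hus : D.us i ≤ leftStab S := by
    refine le_leftStab fun g hg x hx => ?_
    rcases hx with hx | ⟨y, hy, b, hb, rfl⟩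
    · exact Or.inl (mul_mem (us_le_borelPos i hg) hx)
    · exact Or.inr ⟨g * y, mul_mem hg hy, b, hb, by simp [mul_assoc]⟩
  have hT : D.T ≤ leftStab S := by
    refine le_leftStab fun g hg x hx => ?_
    rcases hx with hx | ⟨y, hy, b, hb, rfl⟩
    · exact Or.inl (mul_mem (T_le_borelPos hg) hx)
    · refine Or.inr ⟨g * y * g⁻¹, D.normalize g hg _ y hy, m⁻¹ * g * m * b,
        mul_mem (T_le_borelPos (conj_refl_mem hg i)) hb, by group⟩
  have hQ : D.usCompl i ≤ leftStab S := by
    refine le_leftStab fun g hg x hx => ?_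
    rcases hx with hx | ⟨y, hy, b, hb, rfl⟩
    · exact Or.inl (mul_mem (upos_le_borelPos (usCompl_le_upos i hg)) hx)
    · refine Or.inr ⟨y, hy, m⁻¹ * (y⁻¹ * g * y) * m * b, mul_mem ?_ hb, by group⟩
      refine upos_le_borelPos (usCompl_le_upos i (hm.conj_mem_usCompl' ?_))
      simpa using conj_us_mem_usCompl (inv_mem hy) hg
  have hvs : D.vs i ≤ leftStab S := by
    refine le_leftStab fun v hv x hx => ?_
    by_cases hv1 : v = 1
    · simpa [hv1] using hx
    obtain ⟨a, ha, a', ha', t, ht, e⟩ := exists_mul_eq_refl_of_mem_vs hv hv1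
    rw [← hmdef] at e
    rw [e]
    rcases hx with hx | ⟨y, hy, b, hb, rfl⟩
    · exact Or.inr ⟨a, ha, t * a' * x,
        mul_mem (mul_mem (T_le_borelPos ht) (us_le_borelPos i ha')) hx, by simp [mul_assoc]⟩
    -- The two factors `m` are brought together so that the middle factor `m (a' y) m⁻¹` lies in
    -- `U_{-α_s}`; it is then either trivial or decomposed once more through `m`.
    · have e2 : a * m * t * a' * (y * m * b) =
          a * (m * t * m⁻¹) * (m * (a' * y) * m⁻¹ * (m * m * b)) := by group
      rw [e2]
      refine (hus ha _).2 ((hT (conj_refl_mem' ht i) _).2 ?_) |> fun h => by rwa [mul_assoc]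
      have hv' : m * (a' * y) * m⁻¹ ∈ D.vs i := hm.us_to_vs (mul_mem ha' hy)
      by_cases h1 : m * (a' * y) * m⁻¹ = 1
      · rw [h1, one_mul]
        exact Or.inl (mul_mem hmm hb)
      · obtain ⟨c, hc, c', hc', t', ht', e3⟩ := exists_mul_eq_refl_of_mem_vs hv' h1
        rw [← hmdef] at e3
        rw [e3]
        refine Or.inr ⟨c, hc, t' * c' * (m * m * b), mul_mem (mul_mem (T_le_borelPos ht')
          (us_le_borelPos i hc')) (mul_mem hmm hb), by simp only [mul_assoc]⟩
  have hupos : D.upos ≤ leftStab S := by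
    intro x hx
    obtain ⟨u, hu, q, hq, rfl⟩ := exists_us_mul_usCompl (i := i) hx
    exact mul_mem (hus hu) (hQ hq)
  have key : D.parabolicPos i ≤ leftStab S := sup_le (sup_le hT hupos) hvs
  have := (key hh 1).2 (Or.inl (one_mem _))
  rwa [mul_one] at this

/-- `P_s = U_{-α_s} B₊ ∪ s B₊`. -/
theorem mem_parabolicPos' {i : B} {h : Γ} (hh : h ∈ D.parabolicPos i) :
    (∃ v ∈ D.vs i, ∃ b ∈ D.borelPos, h = v * b) ∨ ∃ b ∈ D.borelPos, h = D.refl i * b := by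
  rcases mem_parabolicPos hh with h' | ⟨x, hx, b, hb, rfl⟩
  · exact Or.inl ⟨1, one_mem _, h, h', by simp⟩
  by_cases hx1 : x = 1
  · exact Or.inr ⟨b, hb, by simp [hx1]⟩
  obtain ⟨a, ha, a', ha', t, ht, e⟩ := exists_mul_eq_refl_of_mem_us hx hx1
  have hm := D.acts_refl i
  refine Or.inl ⟨a, ha, D.refl i * t * (D.refl i)⁻¹ * (D.refl i * D.refl i) *
    ((D.refl i)⁻¹ * a' * D.refl i) * b, ?_, ?_⟩
  · exact mul_mem (mul_mem (mul_mem (T_le_borelPos (conj_refl_mem' ht i))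
      (T_le_borelPos (refl_mul_refl_mem i))) (us_le_borelPos i (hm.vs_to_us' ha'))) hb
  · rw [e]; group

/-! ### The Bruhat decomposition -/

theorem Acts.conj_us_pos {n : Γ} {w : W} (hn : D.Acts n w) {i : B}
    (hl : cs.length w < cs.length (w * cs.simple i)) {x : Γ} (hx : x ∈ D.us i) :
    n * x * n⁻¹ ∈ D.upos :=
  D.U_le_upos (Root.one_mem_translate_simple.2 hl) (hn.mem hx)

theorem Acts.conj_vs_pos {n : Γ} {w : W} (hn : D.Acts n w) {i : B}
    (hl : cs.length (w * cs.simple i) < cs.length w) {x : Γ} (hx : x ∈ D.vs i) :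
    n * x * n⁻¹ ∈ D.upos := by
  refine D.U_le_upos ?_ (hn.mem hx)
  rw [Root.translate_neg, isPos_neg]
  intro h
  have := Root.one_mem_translate_simple.1 h
  omega

variable (D) in
/-- The element `g` lies in the double coset `B₊ w B₊`. -/
def Bruhat (w : W) (g : Γ) : Prop :=
  ∃ b ∈ D.borelPos, ∃ n, D.Lifts n w ∧ ∃ b' ∈ D.borelPos, g = b * n * b'

theorem Lifts.bruhat {n : Γ} {w : W} (h : D.Lifts n w) : D.Bruhat w n :=
  ⟨1, one_mem _, n, h, 1, one_mem _, by simp⟩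

theorem Bruhat.mul_right {g b : Γ} {w : W} (h : D.Bruhat w g) (hb : b ∈ D.borelPos) :
    D.Bruhat w (g * b) := by
  obtain ⟨b₁, h₁, n, hn, b₂, h₂, rfl⟩ := h
  exact ⟨b₁, h₁, n, hn, b₂ * b, mul_mem h₂ hb, by group⟩

theorem Bruhat.mul_left {g b : Γ} {w : W} (h : D.Bruhat w g) (hb : b ∈ D.borelPos) :
    D.Bruhat w (b * g) := by
  obtain ⟨b₁, h₁, n, hn, b₂, h₂, rfl⟩ := h
  exact ⟨b * b₁, mul_mem hb h₁, n, hn, b₂, h₂, by group⟩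

theorem bruhat_one_iff {g : Γ} : D.Bruhat 1 g ↔ g ∈ D.borelPos := by
  constructor
  · rintro ⟨b₁, h₁, n, hn, b₂, h₂, rfl⟩
    exact mul_mem (mul_mem h₁ (T_le_borelPos (lifts_one_iff.1 hn))) h₂
  · intro hg
    exact ⟨g, hg, 1, lifts_one_iff.2 (one_mem _), 1, one_mem _, by simp⟩

/-- At an ascent `wα_s` is positive, so a factor from `U_{α_s}` can be moved to the left through the
lift of `w` and absorbed in `B₊`. -/
theorem Bruhat.mul_parabolic_of_lt {g h : Γ} {w : W} {i : B} (hg : D.Bruhat w g)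
    (hh : h ∈ D.parabolicPos i) (hl : cs.length w < cs.length (w * cs.simple i)) :
    (h ∈ D.borelPos ∧ D.Bruhat w (g * h)) ∨ D.Bruhat (w * cs.simple i) (g * h) := by
  by_cases hb : h ∈ D.borelPos
  · exact Or.inl ⟨hb, hg.mul_right hb⟩
  right
  obtain ⟨b₁, h₁, n, hn, b₂, h₂, rfl⟩ := hg
  have hb2 : b₂ * h ∈ D.parabolicPos i := mul_mem (borelPos_le_parabolicPos i h₂) hh
  rcases mem_parabolicPos hb2 with h' | ⟨x, hx, b, hb', e⟩
  · exact absurd (by simpa using mul_mem (inv_mem h₂) h') hb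
  · refine ⟨b₁ * (n * x * n⁻¹), mul_mem h₁ (upos_le_borelPos (hn.acts.conj_us_pos hl hx)),
      n * D.refl i, hn.mul_refl i, b, hb', ?_⟩
    rw [mul_assoc (b₁ * n), e]; group

theorem Bruhat.mul_parabolic {g h : Γ} {w : W} {i : B} (hg : D.Bruhat w g)
    (hh : h ∈ D.parabolicPos i) :
    D.Bruhat w (g * h) ∨ D.Bruhat (w * cs.simple i) (g * h) := by
  rcases cs.length_mul_simple w i with hl | hl
  · rcases hg.mul_parabolic_of_lt hh (by omega) with h | h
    · exact Or.inl h.2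
    · exact Or.inr h
  · obtain ⟨b₁, h₁, n, hn, b₂, h₂, rfl⟩ := hg
    have hn' : D.Lifts (n * (D.refl i)⁻¹) (w * cs.simple i) := by
      simpa using hn.mul (lifts_refl i).inv
    have hp : D.refl i * (b₂ * h) ∈ D.parabolicPos i :=
      mul_mem (refl_mem_parabolicPos i) (mul_mem (borelPos_le_parabolicPos i h₂) hh)
    have hg' : D.Bruhat (w * cs.simple i) (b₁ * (n * (D.refl i)⁻¹)) :=
      hn'.bruhat.mul_left h₁
    have e : b₁ * n * b₂ * h = b₁ * (n * (D.refl i)⁻¹) * (D.refl i * (b₂ * h)) := by group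
    rw [e]
    rcases hg'.mul_parabolic_of_lt hp (by simp; omega) with h | h
    · exact Or.inr h.2
    · left; simpa using h

/-- Induction on the shorter element, removing a final letter by right multiplication in a minimal
parabolic. If `B₊` is one of the double cosets and `w' ≠ 1`, a left descent of `w'` forces a
nontrivial element of some `U_{-α_s}` into `B₊`. -/
theorem Bruhat.unique {g : Γ} {w w' : W} (h : D.Bruhat w g) (h' : D.Bruhat w' g) : w = w' := by
  wlog hle : cs.length w ≤ cs.length w' generalizing w w'
  · exact (this h' h (by omega)).symm
  induction hk : cs.length w generalizing w w' g with
  | zero =>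
    obtain rfl := cs.length_eq_zero_iff.1 hk
    rw [bruhat_one_iff] at h
    obtain ⟨b₁, h₁, n, hn, b₂, h₂, rfl⟩ := h'
    have hnB : n ∈ D.borelPos := by
      have := mul_mem (mul_mem (inv_mem h₁) h) (inv_mem h₂)
      convert this using 1
      group
    by_contra hne
    obtain ⟨i, hi⟩ := cs.exists_leftDescent_of_ne_one (Ne.symm hne)
    obtain ⟨v, hv, hv1⟩ := D.exists_ne_one (Root.simple cs i).neg
    have hi' : cs.length (w'⁻¹ * cs.simple i) < cs.length w'⁻¹ := by
      rw [← cs.length_inv, cs.length_inv w']; simpa using! hi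
    have hpos := hn.acts.inv.conj_vs_pos hi' hv
    have := mul_mem (mul_mem hnB (upos_le_borelPos hpos)) (inv_mem hnB)
    refine hv1 (eq_one_of_mem_vs_of_mem_borelPos hv ?_)
    convert this using 1
    group
  | succ k ih =>
    have hw1 : w ≠ 1 := by rintro rfl; simp at hk
    obtain ⟨i, hi⟩ := cs.exists_rightDescent_of_ne_one hw1
    have hi' : cs.length (w * cs.simple i) = k := by
      have := cs.isRightDescent_iff.1 hi; omega
    obtain ⟨b₁, h₁, n, hn, b₂, h₂, rfl⟩ := h
    have hg' : D.Bruhat (w * cs.simple i) (b₁ * (n * (D.refl i)⁻¹)) := by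
      have hn' : D.Lifts (n * (D.refl i)⁻¹) (w * cs.simple i) := by
        simpa using hn.mul (lifts_refl i).inv
      exact hn'.bruhat.mul_left h₁
    have h2 := h'.mul_parabolic (i := i) (h := b₂⁻¹ * (D.refl i)⁻¹)
      (mul_mem (borelPos_le_parabolicPos i (inv_mem h₂)) (inv_mem (refl_mem_parabolicPos i)))
    rw [show b₁ * n * b₂ * (b₂⁻¹ * (D.refl i)⁻¹) = b₁ * (n * (D.refl i)⁻¹) by group] at h2
    rcases h2 with h2 | h2
    · have := ih hg' h2 (by omega) hi'
      rw [← this] at hle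
      omega
    · have h3 := cs.length_mul_simple w' i
      have := ih hg' h2 (by omega) hi'
      exact mul_right_cancel this

/-- The projection of a chamber to a panel is unique. -/
theorem Bruhat.eq_of_adj {g g' : Γ} {w : W} {i : B} (h : D.Bruhat w g) (h' : D.Bruhat w g')
    (hl : cs.length w < cs.length (w * cs.simple i)) (hp : g⁻¹ * g' ∈ D.parabolicPos i) :
    g⁻¹ * g' ∈ D.borelPos := by
  rcases h.mul_parabolic_of_lt hp hl with h1 | h1
  · exact h1.1
  · rw [mul_inv_cancel_left] at h1
    have := h1.unique h'
    rw [this] at hl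
    omega

end RootGroupDatum
end TwinLattice
end

noncomputable section
namespace TwinLattice
namespace RootGroupDatum

variable {B W : Type*} [Group W] {M : CoxeterMatrix B} {cs : CoxeterSystem M W}
  {Γ : Type*} [Group Γ] {D : RootGroupDatum cs Γ}

/-! ### The stabilizers in `B₋` of the chambers of the standard apartment -/

variable (D) in
/-- The group generated by `T` and the root groups of the negative roots containing `w`. It turns
out to be the stabilizer in `B₋` of the chamber `w B₊`. -/
def negStab (w : W) : Subgroup Γ := D.T ⊔ D.span fun α => (1 : W) ∉ α.halfSpace ∧ w ∈ α.halfSpace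

theorem T_le_negStab (w : W) : D.T ≤ D.negStab w := le_sup_left

theorem U_le_negStab {w : W} {α : Root cs} (h : (1 : W) ∉ α.halfSpace) (h' : w ∈ α.halfSpace) :
    D.U α ≤ D.negStab w :=
  (U_le_span (p := fun α => (1 : W) ∉ α.halfSpace ∧ w ∈ α.halfSpace) ⟨h, h'⟩).trans le_sup_right

theorem negStab_le {w : W} {H : Subgroup Γ} (hT : D.T ≤ H)
    (h : ∀ α : Root cs, (1 : W) ∉ α.halfSpace → w ∈ α.halfSpace → D.U α ≤ H) :
    D.negStab w ≤ H := sup_le hT (span_le.2 fun α hα => h α hα.1 hα.2)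

theorem negStab_le_borelNeg (w : W) : D.negStab w ≤ D.borelNeg :=
  negStab_le T_le_borelNeg fun _ h _ => (D.U_le_uneg h).trans uneg_le_borelNeg

theorem negStab_one : D.negStab 1 = D.T :=
  le_antisymm (negStab_le le_rfl fun _ h h' => absurd h' h) (T_le_negStab 1)

/-- The only root containing `w` but not `w s` is `wα_s`, which is positive at an ascent and so does
not occur in `negStab w`. -/
theorem negStab_le_mul_simple {w : W} {i : B} (hl : cs.length w < cs.length (w * cs.simple i)) :
    D.negStab w ≤ D.negStab (w * cs.simple i) := by
  refine negStab_le (T_le_negStab _) fun α h h' => U_le_negStab h ?_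
  by_contra hs
  rw [Root.eq_translate_of_mem h' hs] at h
  exact h (Root.one_mem_translate_simple.2 hl)

/-- With `δ = -wα_s`, both `δ` and `β` contain `w s` and omit `1`, so they are prenilpotent. A root
of the interval shares these properties, and if it missed `w` it would be `δ` itself. -/
theorem conj_U_mem_span {w : W} {i : B} (hl : cs.length w < cs.length (w * cs.simple i))
    {v y : Γ} (hv : v ∈ D.U ((Root.simple cs i).neg.translate w))
    (hy : y ∈ D.span fun α => (1 : W) ∉ α.halfSpace ∧ w ∈ α.halfSpace) :
    v * y * v⁻¹ ∈ D.span fun α => (1 : W) ∉ α.halfSpace ∧ w ∈ α.halfSpace := by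
  set δ := (Root.simple cs i).neg.translate w with hδ
  have h1 : (1 : W) ∉ δ.halfSpace := by
    rw [hδ, Root.translate_neg, Root.mem_neg, not_not]
    exact Root.one_mem_translate_simple.2 hl
  have hw : w ∉ δ.halfSpace := by
    rw [hδ, Root.mem_translate, Root.mem_neg, not_not, inv_mul_cancel]
    exact Root.one_mem_simple i
  have hws : w * cs.simple i ∈ δ.halfSpace := by
    rw [hδ, Root.mem_translate, Root.mem_neg, inv_mul_cancel_left]
    exact Root.simple_notMem_simple i
  have : D.span (fun α => (1 : W) ∉ α.halfSpace ∧ w ∈ α.halfSpace) ≤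
      (D.span fun α => (1 : W) ∉ α.halfSpace ∧ w ∈ α.halfSpace).comap
        (MulAut.conj v).toMonoidHom := by
    refine span_le.2 fun β hβ x hx => ?_
    have hβs : w * cs.simple i ∈ β.halfSpace := by
      by_contra hs
      have := Root.eq_translate_of_mem hβ.2 hs
      rw [this] at hβ
      exact hβ.1 (Root.one_mem_translate_simple.2 hl)
    refine conj_mem_span_of_commutator (p := fun α => (1 : W) ∉ α.halfSpace ∧ w ∈ α.halfSpace)
      (α := δ) (β := β) ?_ ?_ hβ ?_ hv hx
    · rintro h
      exact hw (h ▸ hβ.2)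
    · exact ⟨⟨_, hws, hβs⟩, ⟨1, h1, hβ.1⟩⟩
    · intro γ hγ
      have hγ1 : (1 : W) ∉ γ.halfSpace := hγ.2.2.2 ⟨h1, hβ.1⟩
      refine ⟨hγ1, ?_⟩
      by_contra hγw
      have hγs : w * cs.simple i ∈ γ.halfSpace := hγ.2.2.1 ⟨hws, hβs⟩
      refine hγ.1 ?_
      have := Root.eq_translate_of_mem (α := γ.neg) hγw (fun h => h hγs)
      rw [hδ, Root.translate_neg, ← this, Root.neg_neg]
  exact this hy

/-- Passing from `w` to `w s` adds the single negative root `-wα_s`, whose root group normalizes the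
span attached to `w`. -/
theorem exists_negStab_mul {w : W} {i : B} (hl : cs.length w < cs.length (w * cs.simple i))
    {x : Γ} (hx : x ∈ D.negStab (w * cs.simple i)) :
    ∃ y ∈ D.negStab w, ∃ v ∈ D.U ((Root.simple cs i).neg.translate w), x = y * v := by
  obtain ⟨t, ht, z, hz, rfl⟩ := mem_sup_T_span.1 hx
  obtain ⟨y, hy, v, hv, rfl⟩ : ∃ y ∈ D.span (fun α => (1 : W) ∉ α.halfSpace ∧ w ∈ α.halfSpace),
      ∃ v ∈ D.U ((Root.simple cs i).neg.translate w), z = y * v := by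
    refine Subgroup.iSup_induction (C := fun z => ∃ y ∈ D.span
      (fun α => (1 : W) ∉ α.halfSpace ∧ w ∈ α.halfSpace),
      ∃ v ∈ D.U ((Root.simple cs i).neg.translate w), z = y * v) _ hz ?_
      ⟨1, one_mem _, 1, one_mem _, by simp⟩ ?_
    · rintro ⟨α, hα1, hα⟩ x hx
      by_cases hw : w ∈ α.halfSpace
      · exact ⟨x, U_le_span (p := fun α => (1 : W) ∉ α.halfSpace ∧ w ∈ α.halfSpace) ⟨hα1, hw⟩ hx,
          1, one_mem _, by simp⟩
      · have := Root.eq_translate_of_mem (α := α.neg) (i := i) hw (fun h => h hα)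
        refine ⟨1, one_mem _, x, ?_, by simp⟩
        rw [Root.translate_neg, ← this, Root.neg_neg]
        exact hx
    · rintro _ _ ⟨y, hy, v, hv, rfl⟩ ⟨y', hy', v', hv', rfl⟩
      exact ⟨y * (v * y' * v⁻¹), mul_mem hy (conj_U_mem_span hl hv hy'), v * v', mul_mem hv hv',
        by group⟩
  exact ⟨t * y, mem_sup_T_span.2 ⟨t, ht, y, hy, rfl⟩, v, hv, by group⟩

theorem conj_negStab_mem {w : W} {n x : Γ} (hn : D.Lifts n w) (hx : x ∈ D.negStab w) :
    n⁻¹ * x * n ∈ D.borelPos := by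
  obtain ⟨t, ht, y, hy, rfl⟩ := mem_sup_T_span.1 hx
  have h1 := hn.inv.conj_mem ht
  have h2 : n⁻¹ * y * n⁻¹⁻¹ ∈ D.upos :=
    hn.inv.acts.conj_span (q := Root.IsPos)
      (fun α h => by simpa [Root.IsPos, Root.mem_translate] using h.2) hy
  have := mul_mem (T_le_borelPos h1) (upos_le_borelPos h2)
  convert this using 1
  group

theorem mem_negStab_of_conj_mem {w : W} {i : B} {n x : Γ} (hn : D.Lifts n w)
    (hl : cs.length w < cs.length (w * cs.simple i)) (hx : x ∈ D.negStab (w * cs.simple i))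
    (h : n⁻¹ * x * n ∈ D.borelPos) : x ∈ D.negStab w := by
  obtain ⟨y, hy, v, hv, rfl⟩ := exists_negStab_mul hl hx
  have hv' := hn.acts.mem_inv hv
  rw [Root.translate_translate, inv_mul_cancel, Root.translate_one] at hv'
  have h2 : n⁻¹ * v * n ∈ D.borelPos := by
    convert mul_mem (inv_mem (conj_negStab_mem hn hy)) h using 1
    group
  have h3 := eq_one_of_mem_vs_of_mem_borelPos hv' h2
  have : v = 1 := by
    by_contra hne
    exact conj_ne_one' hne h3
  simpa [this] using hy

theorem negStab_le_mul_wordProd {w : W} {ω : List B}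
    (h : cs.length (w * cs.wordProd ω) = cs.length w + ω.length) :
    D.negStab w ≤ D.negStab (w * cs.wordProd ω) := by
  induction ω using List.reverseRecOn with
  | nil => simp
  | append_singleton ω i ih =>
    rw [cs.wordProd_append, cs.wordProd_singleton, List.length_append, List.length_singleton,
      ← mul_assoc] at h
    have h1 := cs.length_mul_simple (w * cs.wordProd ω) i
    have h2 := cs.length_mul_le w (cs.wordProd ω)
    have h3 := cs.length_wordProd_le ω
    rw [cs.wordProd_append, cs.wordProd_singleton, ← mul_assoc]
    exact (ih (by omega)).trans (negStab_le_mul_simple (by omega))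

/-- An element fixing the chamber of `w` and the last chamber of a minimal gallery fixes the
intermediate ones: the image of the last but one stays in the same panel at the same Weyl distance
from `w`, and projections to panels are unique. -/
theorem mem_negStab_of_mul_wordProd {w : W} {ω : List B} {n x : Γ} (hn : D.Lifts n w)
    (h : cs.length (w * cs.wordProd ω) = cs.length w + ω.length)
    (hx : x ∈ D.negStab (w * cs.wordProd ω)) (hb : n⁻¹ * x * n ∈ D.borelPos) :
    x ∈ D.negStab w := by
  induction ω using List.reverseRecOn with
  | nil => simpa using hx
  | append_singleton ω i ih =>
    rw [cs.wordProd_append, cs.wordProd_singleton, List.length_append, List.length_singleton,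
      ← mul_assoc] at h
    rw [cs.wordProd_append, cs.wordProd_singleton, ← mul_assoc] at hx
    have h1 := cs.length_mul_simple (w * cs.wordProd ω) i
    have h2 := cs.length_mul_le w (cs.wordProd ω)
    have h3 := cs.length_wordProd_le ω
    have h4 := cs.length_mul_simple (cs.wordProd ω) i
    have h5 := cs.length_mul_le w (cs.wordProd ω * cs.simple i)
    rw [← mul_assoc] at h5
    have hl : cs.length (w * cs.wordProd ω) < cs.length (w * cs.wordProd ω * cs.simple i) := by
      omega
    obtain ⟨z, hz⟩ := D.exists_lifts (cs.wordProd ω)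
    have hnz := hn.mul hz
    refine ih (by omega) (mem_negStab_of_conj_mem hnz hl hx ?_)
    have hg : D.Bruhat (cs.wordProd ω) (n⁻¹ * x * n * z) := hz.bruhat.mul_left hb
    obtain ⟨y, hy, v, hv, e⟩ := exists_negStab_mul hl hx
    have hv' := hnz.acts.mem_inv hv
    rw [Root.translate_translate, inv_mul_cancel, Root.translate_one] at hv'
    have hp : z⁻¹ * (n⁻¹ * x * n * z) ∈ D.parabolicPos i := by
      have := mul_mem (borelPos_le_parabolicPos i (conj_negStab_mem hnz hy))
        (vs_le_parabolicPos i hv')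
      convert this using 1
      rw [e]; group
    have := hz.bruhat.eq_of_adj hg (by omega) hp
    convert this using 1
    group

variable (D) in
/-- A lift of `w` to `Γ`. -/
def wlift (w : W) : Γ := (D.exists_lifts w).choose

variable (D) in
theorem lifts_wlift (w : W) : D.Lifts (D.wlift w) w := (D.exists_lifts w).choose_spec

/-! ### Panels of the covering of `X₊` by `B₋`-translates of the standard apartment -/

open Classical in
variable (cs) in
/-- The longer of `w` and `w s_i`. -/
def upper (i : B) (w : W) : W :=
  if cs.length w < cs.length (w * cs.simple i) then w * cs.simple i else w

theorem upper_of_lt {i : B} {w : W} (h : cs.length w < cs.length (w * cs.simple i)) :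
    upper cs i w = w * cs.simple i := if_pos h

theorem upper_of_gt {i : B} {w : W} (h : cs.length (w * cs.simple i) < cs.length w) :
    upper cs i w = w := if_neg (by omega)

theorem upper_mul_simple (i : B) (w : W) : upper cs i (w * cs.simple i) = upper cs i w := by
  rcases Nat.lt_or_gt_of_ne (cs.length_mul_simple_ne w i) with h | h
  · rw [upper_of_gt h, upper_of_lt] <;> simp [h]
  · rw [upper_of_lt h, upper_of_gt]; simpa using h

theorem upper_descent (i : B) (w : W) :
    cs.length (upper cs i w * cs.simple i) < cs.length (upper cs i w) := by
  rcases Nat.lt_or_gt_of_ne (cs.length_mul_simple_ne w i) with h | h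
  · rwa [upper_of_gt h]
  · rw [upper_of_lt h]; simpa using h

theorem eq_upper_or (i : B) (w : W) : w = upper cs i w ∨ w = upper cs i w * cs.simple i := by
  rcases Nat.lt_or_gt_of_ne (cs.length_mul_simple_ne w i) with h | h
  · rw [upper_of_gt h]; simp
  · rw [upper_of_lt h]; simp

theorem negStab_le_upper (i : B) (w : W) : D.negStab w ≤ D.negStab (upper cs i w) := by
  rcases Nat.lt_or_gt_of_ne (cs.length_mul_simple_ne w i) with h | h
  · rw [upper_of_gt h]
  · rw [upper_of_lt h]; exact negStab_le_mul_simple h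

variable (D) in
/-- The pairs `(w, b A_w)` and `(w', b' A_{w'})` belong to the same `i`-panel. -/
def SamePanel (i : B) (w : W) (b : Γ) (w' : W) (b' : Γ) : Prop :=
  upper cs i w = upper cs i w' ∧ b⁻¹ * b' ∈ D.negStab (upper cs i w)

variable (D) in
/-- The pairs `(w, b A_w)` and `(w', b' A_{w'})` define the same chamber of `X₊`. -/
def SameChamber (w : W) (b : Γ) (w' : W) (b' : Γ) : Prop :=
  (b * D.wlift w)⁻¹ * (b' * D.wlift w') ∈ D.borelPos

theorem inv_wlift_mul_mem_parabolicPos {i : B} {w w' : W}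
    (h : upper cs i w = upper cs i w') : (D.wlift w)⁻¹ * D.wlift w' ∈ D.parabolicPos i := by
  have key : ∀ w, (D.wlift w)⁻¹ * D.wlift (upper cs i w) ∈ D.parabolicPos i := by
    intro w
    rcases eq_upper_or (cs := cs) i w with e | e
    · rw [← e, inv_mul_cancel]; exact one_mem _
    · have h1 := (D.lifts_wlift (upper cs i w)).mul_refl i
      rw [← e] at h1
      have h2 := (D.lifts_wlift w).inv_mul_mem h1
      have := mul_mem (borelPos_le_parabolicPos i (T_le_borelPos h2))
        (inv_mem (refl_mem_parabolicPos i))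
      convert this using 1
      group
  have := mul_mem (key w) (inv_mem (h ▸ key w'))
  convert this using 1
  rw [h]; group

theorem SamePanel.mem_parabolicPos {i : B} {w w' : W} {b b' : Γ} (h : D.SamePanel i w b w' b') :
    (b * D.wlift w)⁻¹ * (b' * D.wlift w') ∈ D.parabolicPos i := by
  have hu : upper cs i (upper cs i w) = upper cs i w := upper_of_gt (upper_descent i w)
  have h1 := inv_wlift_mul_mem_parabolicPos (D := D) (i := i) (w := w) (w' := upper cs i w) hu.symm
  have h2 := inv_wlift_mul_mem_parabolicPos (D := D) (i := i) (w := upper cs i w) (w' := w')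
    (hu.trans h.1)
  have h3 := borelPos_le_parabolicPos i (conj_negStab_mem (D.lifts_wlift _) h.2)
  convert mul_mem (mul_mem h1 h3) h2 using 1
  group

theorem eq_of_wlift_mem {w w' : W} (h : (D.wlift w)⁻¹ * D.wlift w' ∈ D.borelPos) : w = w' := by
  have h1 := ((D.lifts_wlift w).inv.mul (D.lifts_wlift w')).bruhat
  have := h1.unique (bruhat_one_iff.2 h)
  rwa [inv_mul_eq_one] at this

theorem SameChamber.symm {w w' : W} {b b' : Γ} (h : D.SameChamber w b w' b') :
    D.SameChamber w' b' w b := by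
  have := inv_mem h
  simpa [SameChamber] using this

theorem SameChamber.trans {w w' w'' : W} {b b' b'' : Γ} (h : D.SameChamber w b w' b')
    (h' : D.SameChamber w' b' w'' b'') : D.SameChamber w b w'' b'' := by
  have := mul_mem h h'
  rw [SameChamber]
  convert this using 1
  group

theorem sameChamber_of_mem_negStab {w : W} {b a : Γ} (ha : a ∈ D.negStab w) :
    D.SameChamber w b w (b * a) := by
  have := conj_negStab_mem (D.lifts_wlift w) ha
  rw [SameChamber]
  convert this using 1
  group

theorem SamePanel.symm {i : B} {w w' : W} {b b' : Γ} (h : D.SamePanel i w b w' b') :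
    D.SamePanel i w' b' w b := by
  refine ⟨h.1.symm, ?_⟩
  rw [← h.1]
  simpa using inv_mem h.2

theorem SamePanel.trans {i : B} {w w' w'' : W} {b b' b'' : Γ} (h : D.SamePanel i w b w' b')
    (h' : D.SamePanel i w' b' w'' b'') : D.SamePanel i w b w'' b'' := by
  refine ⟨h.1.trans h'.1, ?_⟩
  have := mul_mem h.2 (h.1 ▸ h'.2)
  convert this using 1
  group

theorem samePanel_of_mem_negStab {w : W} {b b' : Γ} (ha : b⁻¹ * b' ∈ D.negStab w) (i : B) :
    D.SamePanel i w b w b' := ⟨rfl, negStab_le_upper i w ha⟩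

/-- Two elements of a panel with the same chamber are equal. -/
theorem SamePanel.eq_of_sameChamber {i : B} {w w' : W} {b b' : Γ}
    (h : D.SamePanel i w b w' b') (h' : D.SameChamber w b w' b') :
    w = w' ∧ b⁻¹ * b' ∈ D.negStab w := by
  have key : ∀ {w w' : W} {b b' : Γ}, D.SamePanel i w b w' b' → D.SameChamber w b w' b' →
      w' = upper cs i w → w = w' := by
    intro w w' b b' h h' e
    have h1 := conj_negStab_mem (D.lifts_wlift _) h.2
    rw [← e] at h1
    refine eq_of_wlift_mem (D := D) ?_
    have := mul_mem h' (inv_mem h1)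
    convert this using 1
    group
  have hw : w = w' := by
    rcases eq_upper_or (cs := cs) i w' with e | e
    · exact key h h' (e.trans h.1.symm)
    · rcases eq_upper_or (cs := cs) i w with e' | e'
      · exact (key h.symm h'.symm (e'.trans h.1)).symm
      · rw [e, e', h.1]
  subst hw
  refine ⟨rfl, ?_⟩
  rcases eq_upper_or (cs := cs) i w with e | e
  · rw [e]; exact h.2
  · have hd := upper_descent (cs := cs) i w
    refine mem_negStab_of_conj_mem (D.lifts_wlift w) (i := i) ?_ ?_ ?_
    · rw [← e] at hd
      conv_rhs => rw [e]
      simpa using hd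
    · have h2 := h.2
      have e2 : w * cs.simple i = upper cs i w := by
        conv_lhs => rw [e]
        simp
      rwa [e2]
    · have : (b * D.wlift w)⁻¹ * (b' * D.wlift w) ∈ D.borelPos := h'
      convert this using 1
      group

/-- Representatives of the chambers of a panel. -/
def panelRep (D : RootGroupDatum cs Γ) (i : B) : Set Γ :=
  {e | e ∈ D.vs i ∨ ∃ x ∈ D.us i, e = x * D.refl i}

/-- The two descriptions of `P_s` are used according to whether `w` is the longer or the shorter
element of its pair. In either case `n` carries the root group in the representative to that of a
negative root containing the longer element. -/
theorem exists_panelRep {w : W} {i : B} {n h : Γ} (hn : D.Lifts n w)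
    (hh : h ∈ D.parabolicPos i) :
    ∃ e ∈ panelRep D i, e⁻¹ * h ∈ D.borelPos ∧ ∃ w', upper cs i w = upper cs i w' ∧
      ∃ c ∈ D.negStab (upper cs i w), ∃ n', D.Lifts n' w' ∧ n * e = c * n' := by
  rcases Nat.lt_or_gt_of_ne (cs.length_mul_simple_ne w i) with hl | hl
  · rw [upper_of_gt hl]
    rcases mem_parabolicPos hh with hb | ⟨x, hx, b, hb, rfl⟩
    · exact ⟨1, Or.inl (one_mem _), by simpa using hb, w, (upper_of_gt hl).symm, 1, one_mem _, n,
        hn, by simp⟩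
    · refine ⟨x * D.refl i, Or.inr ⟨x, hx, rfl⟩, by simpa [mul_assoc] using hb,
        w * cs.simple i, by rw [upper_mul_simple, upper_of_gt hl], n * x * n⁻¹, ?_,
        n * D.refl i, hn.mul_refl i, by group⟩
      refine U_le_negStab ?_ ?_ (hn.acts.mem hx)
      · intro h
        have := Root.one_mem_translate_simple.1 h
        omega
      · simp [Root.mem_translate, Root.one_mem_simple]
  · rw [upper_of_lt hl]
    rcases mem_parabolicPos' hh with ⟨v, hv, b, hb, rfl⟩ | ⟨b, hb, rfl⟩
    · refine ⟨v, Or.inl hv, by simpa using hb, w, (upper_of_lt hl).symm, n * v * n⁻¹, ?_, n, hn,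
        by group⟩
      refine U_le_negStab ?_ ?_ (hn.acts.mem hv)
      · rw [Root.translate_neg, Root.mem_neg, not_not]
        exact Root.one_mem_translate_simple.2 hl
      · rw [Root.mem_translate, inv_mul_cancel_left, Root.mem_neg]
        exact Root.simple_notMem_simple i
    · exact ⟨D.refl i, Or.inr ⟨1, one_mem _, by simp⟩, by simpa using hb, w * cs.simple i,
        by rw [upper_mul_simple, upper_of_lt hl], 1, one_mem _, n * D.refl i, hn.mul_refl i,
        by simp⟩

/-- Panels of the covering map onto panels of `X₊`; with `SamePanel.eq_of_sameChamber` this makes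
the covering bijective on panels. -/
theorem exists_samePanel {w : W} {i : B} {b g : Γ}
    (hh : (b * D.wlift w)⁻¹ * g ∈ D.parabolicPos i) :
    ∃ w' b', D.SamePanel i w b w' b' ∧ g⁻¹ * (b' * D.wlift w') ∈ D.borelPos := by
  obtain ⟨e, -, he, w', hu, c, hc, n', hn', e2⟩ := exists_panelRep (D.lifts_wlift w) hh
  refine ⟨w', b * c, ⟨hu, by simpa using hc⟩, ?_⟩
  have := mul_mem (inv_mem he) (T_le_borelPos (hn'.inv_mul_mem (D.lifts_wlift w')))
  convert this using 1
  have : c = D.wlift w * e * n'⁻¹ := by rw [e2]; group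
  rw [this]
  group

/-! ### Uniqueness in the Birkhoff decomposition -/

variable (D) in
/-- `(w, b)` is the end of the lift of a minimal gallery of type `u` starting at `B₊`. -/
inductive GalleryLift : W → W → Γ → Prop
  | base {t : Γ} (ht : t ∈ D.T) : GalleryLift 1 1 t
  | step {u w w' : W} {b b' : Γ} (i : B) (h : GalleryLift u w b)
      (hl : cs.length u < cs.length (u * cs.simple i)) (hp : D.SamePanel i w b w' b')
      (hne : ¬ D.SameChamber w b w' b') : GalleryLift (u * cs.simple i) w' b'

theorem GalleryLift.bruhat {u w : W} {b : Γ} (h : D.GalleryLift u w b) :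
    D.Bruhat u (b * D.wlift w) := by
  induction h with
  | base ht =>
    rw [bruhat_one_iff]
    exact mul_mem (T_le_borelPos ht) (T_le_borelPos (lifts_one_iff.1 (D.lifts_wlift 1)))
  | step i h hl hp hne ih =>
    rcases ih.mul_parabolic_of_lt hp.mem_parabolicPos hl with h1 | h1
    · exact absurd h1.1 hne
    · rwa [mul_inv_cancel_left] at h1

theorem GalleryLift.mul_negStab {u w : W} {b b' : Γ} (h : D.GalleryLift u w b)
    (ha : b⁻¹ * b' ∈ D.negStab w) : D.GalleryLift u w b' := by
  cases h with
  | base ht =>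
    rw [negStab_one] at ha
    exact .base (by simpa using mul_mem ht ha)
  | step i h hl hp hne =>
    refine .step i h hl (hp.trans (samePanel_of_mem_negStab ha i)) fun h' => hne (h'.trans ?_)
    have := (sameChamber_of_mem_negStab (b := b) ha).symm
    rwa [mul_inv_cancel_left] at this

theorem GalleryLift.extend {u w : W} {b g : Γ} {i : B} (h : D.GalleryLift u w b)
    (hl : cs.length u < cs.length (u * cs.simple i))
    (hg : (b * D.wlift w)⁻¹ * g ∈ D.parabolicPos i) (hb : D.Bruhat (u * cs.simple i) g) :
    ∃ w' b', D.GalleryLift (u * cs.simple i) w' b' ∧ D.SamePanel i w b w' b' ∧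
      g⁻¹ * (b' * D.wlift w') ∈ D.borelPos := by
  obtain ⟨w', b', hp, hc⟩ := exists_samePanel hg
  refine ⟨w', b', .step i h hl hp fun h' => ?_, hp, hc⟩
  have h1 := hb.mul_right (mul_mem hc (inv_mem h'))
  rw [show g * (g⁻¹ * (b' * D.wlift w') * ((b * D.wlift w)⁻¹ * (b' * D.wlift w'))⁻¹) =
    b * D.wlift w by group] at h1
  have := h.bruhat.unique h1
  rw [← this] at hl
  omega

theorem exists_galleryLift {u : W} {g : Γ} (hg : D.Bruhat u g) :
    ∃ w b, D.GalleryLift u w b ∧ g⁻¹ * (b * D.wlift w) ∈ D.borelPos := by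
  induction hk : cs.length u generalizing u g with
  | zero =>
    obtain rfl := cs.length_eq_zero_iff.1 hk
    rw [bruhat_one_iff] at hg
    exact ⟨1, 1, .base (one_mem _), mul_mem (inv_mem hg) (mul_mem (one_mem _)
      (T_le_borelPos (lifts_one_iff.1 (D.lifts_wlift 1))))⟩
  | succ k ih =>
    have hu1 : u ≠ 1 := by rintro rfl; simp at hk
    obtain ⟨i, hi⟩ := cs.exists_rightDescent_of_ne_one hu1
    have hi' : cs.length (u * cs.simple i) = k := by
      have := cs.isRightDescent_iff.1 hi; omega
    have hg0 := hg
    obtain ⟨b₁, h₁, n, hn, b₂, h₂, rfl⟩ := hg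
    have hn' : D.Lifts (n * (D.refl i)⁻¹) (u * cs.simple i) := by
      simpa using hn.mul (lifts_refl i).inv
    obtain ⟨w, b, hZ, hc⟩ := ih (hn'.bruhat.mul_left h₁) hi'
    obtain ⟨w', b', h1, -, h2⟩ := hZ.extend (i := i) (g := b₁ * n * b₂) (by simp; omega) (by
      have := mul_mem (mul_mem (borelPos_le_parabolicPos i (inv_mem hc))
        (refl_mem_parabolicPos i)) (borelPos_le_parabolicPos i h₂)
      convert this using 1
      group) (by simpa using hg0)
    exact ⟨w', b', by simpa using h1, h2⟩

theorem exists_max_length {S : Set W} (hne : S.Nonempty) {N : ℕ} (hN : ∀ x ∈ S, cs.length x ≤ N) :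
    ∃ x ∈ S, ∀ y ∈ S, cs.length y ≤ cs.length x := by
  have hb : BddAbove (cs.length '' S) := ⟨N, by rintro _ ⟨x, hx, rfl⟩; exact hN x hx⟩
  obtain ⟨x, hx, e⟩ := Nat.sSup_mem (hne.image cs.length) hb
  exact ⟨x, hx, fun y hy => e ▸ le_csSup hb ⟨y, hy, rfl⟩⟩

theorem negStab_mul_le_of_descents {J : Set B} {v : W}
    (hv : ∀ i ∈ J, cs.length (v * cs.simple i) < cs.length v) {x : W}
    (hx : x ∈ stdParabolic cs J) : D.negStab (v * x) ≤ D.negStab v := by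
  obtain ⟨ω, -, hr, e⟩ := exists_reduced_word_stdParabolic (inv_mem hx)
  have h1 := length_mul_of_descents hv hx
  have h2 := hr.eq
  rw [← e, cs.length_inv] at h2
  have := negStab_le_mul_wordProd (D := D) (w := v * x) (ω := ω) (by
    rw [← e]; simp; omega)
  rwa [← e, mul_inv_cancel_right] at this

/-- Elements of a spherical residue with the same chamber are equal. -/
theorem eq_of_sameChamber_of_residue {J : Set B} {v : W}
    (hv : ∀ i ∈ J, cs.length (v * cs.simple i) < cs.length v) {w w' : W} {b b' : Γ}
    (hw : v⁻¹ * w ∈ stdParabolic cs J) (ha : b⁻¹ * b' ∈ D.negStab v)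
    (hc : D.SameChamber w b w' b') : w = w' ∧ b⁻¹ * b' ∈ D.negStab w := by
  have hβ := conj_negStab_mem (D.lifts_wlift v) ha
  have h1 := ((D.lifts_wlift v).inv.mul (D.lifts_wlift w)).bruhat.mul_right hc
  have h2 := ((D.lifts_wlift v).inv.mul (D.lifts_wlift w')).bruhat.mul_left hβ
  have e : (D.wlift v)⁻¹ * D.wlift w * ((b * D.wlift w)⁻¹ * (b' * D.wlift w')) =
      (D.wlift v)⁻¹ * (b⁻¹ * b') * D.wlift v * ((D.wlift v)⁻¹ * D.wlift w') := by group
  rw [e] at h1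
  obtain rfl := mul_left_cancel (h1.unique h2)
  refine ⟨rfl, ?_⟩
  obtain ⟨ω, -, hr, e⟩ := exists_reduced_word_stdParabolic (inv_mem hw)
  have h3 := length_mul_of_descents hv hw
  have h4 := hr.eq
  rw [← e, cs.length_inv] at h4
  have hwω : w * cs.wordProd ω = v := by rw [← e]; group
  refine mem_negStab_of_mul_wordProd (ω := ω) (D.lifts_wlift w) ?_ (by rwa [hwω]) ?_
  · rw [hwω, ← h3, mul_inv_cancel_left, h4]
  · have : (b * D.wlift w)⁻¹ * (b' * D.wlift w) ∈ D.borelPos := hc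
    convert this using 1
    group

theorem SamePanel.residue {J : Set B} {v : W}
    (hv : ∀ i ∈ J, cs.length (v * cs.simple i) < cs.length v) {i : B} (hi : i ∈ J) {w w' : W}
    {b b' : Γ} (hp : D.SamePanel i w b w' b') (hw : v⁻¹ * w ∈ stdParabolic cs J) :
    v⁻¹ * w' ∈ stdParabolic cs J ∧ b⁻¹ * b' ∈ D.negStab v := by
  have hs := simple_mem_stdParabolic (cs := cs) hi
  have hup : v⁻¹ * upper cs i w ∈ stdParabolic cs J := by
    rcases eq_upper_or (cs := cs) i w with e | e
    · rwa [← e]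
    · have := mul_mem hw hs
      rwa [mul_assoc, show w * cs.simple i = upper cs i w by conv_lhs => rw [e]; simp] at this
  constructor
  · rcases eq_upper_or (cs := cs) i w' with e | e
    · rwa [e, ← hp.1]
    · rw [e, ← hp.1, ← mul_assoc]
      exact mul_mem hup hs
  · have h := negStab_mul_le_of_descents (D := D) hv hup
    rw [mul_inv_cancel_left] at h
    exact h hp.2

/-- Lifting with control of position: as long as the gallery has type in `J`, its lift remains in
one spherical residue of the covering, over prescribed chambers of `X₊`. -/
theorem GalleryLift.residue {J : Set B} {v : W}
    (hv : ∀ i ∈ J, cs.length (v * cs.simple i) < cs.length v) {u₀ w₀ : W} {b₀ β : Γ}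
    (h : D.GalleryLift u₀ w₀ b₀) (hw₀ : v⁻¹ * w₀ ∈ stdParabolic cs J) (hβ : β ∈ D.borelPos)
    (hc : (β * D.wlift u₀)⁻¹ * (b₀ * D.wlift w₀) ∈ D.borelPos) {ω : List B} (hω : ∀ i ∈ ω, i ∈ J)
    (hl : cs.length (u₀ * cs.wordProd ω) = cs.length u₀ + ω.length) :
    ∃ w b, D.GalleryLift (u₀ * cs.wordProd ω) w b ∧ v⁻¹ * w ∈ stdParabolic cs J ∧
      b₀⁻¹ * b ∈ D.negStab v ∧
      (β * D.wlift (u₀ * cs.wordProd ω))⁻¹ * (b * D.wlift w) ∈ D.borelPos := by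
  induction ω using List.reverseRecOn with
  | nil => exact ⟨w₀, b₀, by simpa using h, hw₀, by simp, by simpa using hc⟩
  | append_singleton ω i ih =>
    rw [cs.wordProd_append, cs.wordProd_singleton, List.length_append, List.length_singleton,
      ← mul_assoc] at hl
    have h1 := cs.length_mul_simple (u₀ * cs.wordProd ω) i
    have h2 := cs.length_mul_le u₀ (cs.wordProd ω)
    have h3 := cs.length_wordProd_le ω
    obtain ⟨w, b, hZ, hw, hb, hc'⟩ := ih (fun k hk => hω k (List.mem_append_left _ hk)) (by omega)
    rw [cs.wordProd_append, cs.wordProd_singleton, ← mul_assoc]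
    set u := u₀ * cs.wordProd ω with hu
    have hiJ : i ∈ J := hω i (by simp)
    have hlift := D.lifts_wlift (u * cs.simple i)
    have hT := ((D.lifts_wlift u).mul_refl i).inv_mul_mem hlift
    obtain ⟨w', b', hZ', hp, hc''⟩ := hZ.extend (i := i)
      (g := β * D.wlift (u * cs.simple i)) (by omega) (by
        have := mul_mem (mul_mem (borelPos_le_parabolicPos i (inv_mem hc'))
          (refl_mem_parabolicPos i)) (borelPos_le_parabolicPos i (T_le_borelPos hT))
        convert this using 1
        group) (hlift.bruhat.mul_left hβ)
    obtain ⟨h4, h5⟩ := hp.residue hv hiJ hw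
    refine ⟨w', b', hZ', h4, ?_, hc''⟩
    have := mul_mem hb h5
    convert this using 1
    group

/-- A chamber of `X₊` has at most one lift along minimal galleries. -/
theorem GalleryLift.eq_of_sameChamber {u w w' : W} {b b' : Γ} (h : D.GalleryLift u w b)
    (h' : D.GalleryLift u w' b') (hc : D.SameChamber w b w' b') :
    w = w' ∧ b⁻¹ * b' ∈ D.negStab w := by
  induction hk : cs.length u generalizing u w w' b b' with
  | zero =>
    have key : ∀ {u w : W} {b : Γ}, D.GalleryLift u w b → cs.length u = 0 → w = 1 ∧ b ∈ D.T := by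
      intro u w b h hu
      cases h with
      | base ht => exact ⟨rfl, ht⟩
      | step i h hl => omega
    obtain ⟨rfl, hb⟩ := key h hk
    obtain ⟨rfl, hb'⟩ := key h' hk
    exact ⟨rfl, T_le_negStab 1 (mul_mem (inv_mem hb) hb')⟩
  | succ k ih =>
    have key : ∀ {w : W} {b : Γ}, D.GalleryLift u w b → ∃ u₁ i w₁ b₁, u = u₁ * cs.simple i ∧
        D.GalleryLift u₁ w₁ b₁ ∧ cs.length u₁ < cs.length (u₁ * cs.simple i) ∧
        D.SamePanel i w₁ b₁ w b := by
      intro w b h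
      cases h with
      | base ht => simp at hk
      | step i hZ hl hp hne => exact ⟨_, i, _, _, rfl, hZ, hl, hp⟩
    obtain ⟨u₁, i, w₁, b₁, e₁, hZ₁, hl₁, hp₁⟩ := key h
    obtain ⟨u₂, j, w₂, b₂, e₂, hZ₂, hl₂, hp₂⟩ := key h'
    have hu : ∀ l ∈ ({i, j} : Set B), cs.length (u * cs.simple l) < cs.length u := by
      rintro l (rfl | rfl)
      · rw [e₁]; simpa using hl₁
      · rw [e₂]; simpa using hl₂
    set J : Set B := {i, j} with hJ
    -- With `x₀` longest in `W_J`, the element `u x₀` is shortest in `u W_J`. The chamber `β (u x₀)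
    -- B₊` is thus the projection of `c₊` to the `J`-residue, and its lift `(w₀, b₀)` anchors the
    -- residue of the covering.
    obtain ⟨x₀, hx₀, hmax⟩ := exists_max_length (cs := cs)
      (S := (stdParabolic cs J : Set W)) ⟨1, one_mem _⟩ (N := cs.length u) fun x hx => by
        have := length_mul_of_descents hu hx; omega
    obtain ⟨β, hβ, n, hn, β', hβ', e⟩ := h.bruhat
    have hlx₀ := length_mul_of_descents hu hx₀
    obtain ⟨w₀, b₀, hZ₀, hc₀⟩ :=
      exists_galleryLift ((D.lifts_wlift (u * x₀)).bruhat.mul_left hβ)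
    obtain ⟨v, ⟨x₁, hx₁, rfl⟩, hvmax⟩ := exists_max_length (cs := cs)
      (S := (fun x => w₀ * x) '' (stdParabolic cs J : Set W)) ⟨w₀, 1, one_mem _, by simp⟩
      (N := cs.length w₀ + cs.length u) (by
        rintro _ ⟨x, hx, rfl⟩
        have h1 := length_mul_of_descents hu hx
        have h2 := cs.length_mul_le w₀ x
        simp only at h2 ⊢
        omega)
    have hv : ∀ l ∈ J, cs.length (w₀ * x₁ * cs.simple l) < cs.length (w₀ * x₁) := by
      intro l hl
      refine lt_of_le_of_ne (hvmax _ ⟨x₁ * cs.simple l, mul_mem hx₁ (simple_mem_stdParabolic hl),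
        by simp [mul_assoc]⟩) (cs.length_mul_simple_ne _ _)
    have hw₀ : (w₀ * x₁)⁻¹ * w₀ ∈ stdParabolic cs J := by simpa using inv_mem hx₁
    -- every predecessor of the given chamber lies in the residue
    have main : ∀ l ∈ J, ∀ {u₁ w₁ w : W} {b₁ b : Γ}, u = u₁ * cs.simple l →
        D.GalleryLift u₁ w₁ b₁ → cs.length u₁ < cs.length (u₁ * cs.simple l) →
        D.SamePanel l w₁ b₁ w b → (β * n)⁻¹ * (b * D.wlift w) ∈ D.borelPos →
        (w₀ * x₁)⁻¹ * w ∈ stdParabolic cs J ∧ b₀⁻¹ * b ∈ D.negStab (w₀ * x₁) := by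
      intro l hl u₁ w₁ w b₁ b e₁ hZ hl₁ hp hcb
      obtain ⟨ω, hω, hr, eω⟩ := exists_reduced_word_stdParabolic
        (mul_mem (inv_mem hx₀) (simple_mem_stdParabolic (cs := cs) hl))
      have hu₁ : u * x₀ * cs.wordProd ω = u₁ := by rw [← eω, e₁]; simp [mul_assoc]
      have h1 : cs.length (cs.simple l * x₀) + 1 = cs.length x₀ := by
        have := hmax _ (mul_mem (simple_mem_stdParabolic (cs := cs) hl) hx₀)
        rcases cs.length_simple_mul x₀ l with h | h <;> omega
      have h2 : ω.length + 1 = cs.length x₀ := by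
        rw [← h1, ← hr.eq, ← eω, ← cs.length_inv]; simp
      have h3 : cs.length u = cs.length u₁ + 1 := by
        rw [e₁]
        rcases cs.length_mul_simple u₁ l with h | h <;> omega
      obtain ⟨w', b', hZ', hw', hb', hc'⟩ := hZ₀.residue hv hw₀ hβ hc₀ hω (by rw [hu₁]; omega)
      rw [hu₁] at hZ' hc'
      -- Both chambers lie in the same `l`-panel at distance `u₁` from `c₊`, so each is the
      -- projection of `c₊` to that panel.
      have hsame : D.SameChamber w₁ b₁ w' b' := by
        refine hZ.bruhat.eq_of_adj hZ'.bruhat hl₁ ?_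
        have hT := (hn.inv_mul_mem (e₁ ▸ (D.lifts_wlift u₁).mul_refl l : D.Lifts _ u))
        have h4 := mul_mem (mul_mem (mul_mem (mul_mem hp.mem_parabolicPos
          (borelPos_le_parabolicPos l (inv_mem hcb)))
          (borelPos_le_parabolicPos l (T_le_borelPos hT)))
          (inv_mem (refl_mem_parabolicPos l))) (borelPos_le_parabolicPos l hc')
        convert h4 using 1
        group
      obtain ⟨rfl, h5⟩ := ih hZ hZ' hsame (by omega)
      obtain ⟨h6, h7⟩ := hp.residue hv hl hw'
      refine ⟨h6, ?_⟩
      have h8 := negStab_mul_le_of_descents (D := D) hv hw'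
      rw [mul_inv_cancel_left] at h8
      have := mul_mem (mul_mem hb' (inv_mem (h8 h5))) h7
      convert this using 1
      group
    have hcb : (β * n)⁻¹ * (b * D.wlift w) ∈ D.borelPos := by
      rw [e]; simpa [mul_assoc] using hβ'
    have hcb' : (β * n)⁻¹ * (b' * D.wlift w') ∈ D.borelPos := by
      have := mul_mem hcb hc
      convert this using 1
      group
    obtain ⟨h1, h2⟩ := main i (by simp [hJ]) e₁ hZ₁ hl₁ hp₁ hcb
    obtain ⟨h3, h4⟩ := main j (by simp [hJ]) e₂ hZ₂ hl₂ hp₂ hcb'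
    refine eq_of_sameChamber_of_residue hv h1 ?_ hc
    have := mul_mem (inv_mem h2) h4
    convert this using 1
    group

/-- If `u` descends along `i`, the panel is re-entered from its chamber nearest to `c₊`: uniqueness
of lifts shows that the lift of that chamber lies in the same panel of the covering, so one step
reaches the neighbour. -/
theorem GalleryLift.adj {u w w' : W} {b b' : Γ} {i : B} (h : D.GalleryLift u w b)
    (hp : D.SamePanel i w b w' b') : ∃ u', D.GalleryLift u' w' b' := by
  by_cases hc : D.SameChamber w b w' b'
  · obtain ⟨rfl, h1⟩ := hp.eq_of_sameChamber hc
    exact ⟨u, h.mul_negStab h1⟩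
  rcases Nat.lt_or_gt_of_ne (cs.length_mul_simple_ne u i) with hl | hl
  · obtain ⟨β, hβ, n, hn, β', hβ', e⟩ := h.bruhat
    have hn' : D.Lifts (n * (D.refl i)⁻¹) (u * cs.simple i) := by
      simpa using hn.mul (lifts_refl i).inv
    have hl' : cs.length (u * cs.simple i) < cs.length (u * cs.simple i * cs.simple i) := by
      simpa using hl
    obtain ⟨w₁, b₁, hZ₁, hc₁⟩ := exists_galleryLift (hn'.bruhat.mul_left hβ)
    obtain ⟨w₂, b₂, hZ₂, hp₂, hc₂⟩ := hZ₁.extend (i := i) (g := b * D.wlift w) hl' (by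
      rw [e]
      have := mul_mem (mul_mem (borelPos_le_parabolicPos i (inv_mem hc₁))
        (refl_mem_parabolicPos i)) (borelPos_le_parabolicPos i hβ')
      convert this using 1
      group) (by simpa using h.bruhat)
    rw [cs.simple_mul_simple_cancel_right] at hZ₂
    obtain ⟨rfl, h2⟩ := h.eq_of_sameChamber hZ₂ hc₂
    have hp₃ : D.SamePanel i w₁ b₁ w' b' :=
      (hp₂.trans (samePanel_of_mem_negStab h2 i).symm).trans hp
    by_cases hc₃ : D.SameChamber w₁ b₁ w' b'
    · obtain ⟨rfl, h1⟩ := hp₃.eq_of_sameChamber hc₃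
      exact ⟨_, hZ₁.mul_negStab h1⟩
    · exact ⟨_, .step i hZ₁ hl' hp₃ hc₃⟩
  · exact ⟨_, .step i h hl hp hc⟩

/-- The pairs with fixed `b` are connected through panels. Right multiplication of `b` by an element
of some `A_v` does not change the pair over `v`, and `T` and the negative root groups, which
generate `B₋`, all lie in such groups. -/
theorem exists_galleryLift_of_mem_borelNeg {b : Γ} (hb : b ∈ D.borelNeg) (w : W) :
    ∃ u, D.GalleryLift u w b := by
  have move : ∀ (b : Γ) (v w : W), (∃ u, D.GalleryLift u v b) → ∃ u, D.GalleryLift u w b := by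
    intro b v w h
    have h1 : ∀ x : W, ∃ u, D.GalleryLift u (v * x) b := by
      intro x
      induction x using cs.simple_induction_right with
      | one => simpa using h
      | mul_simple_right x i ih =>
        obtain ⟨u, hu⟩ := ih
        refine hu.adj (i := i) ⟨?_, by simp⟩
        rw [← mul_assoc, upper_mul_simple]
    simpa using h1 (v⁻¹ * w)
  have key : ∀ (b a : Γ) (v : W), a ∈ D.negStab v → (∀ w, ∃ u, D.GalleryLift u w b) →
      ∀ w, ∃ u, D.GalleryLift u w (b * a) := by
    intro b a v ha h w
    obtain ⟨u, hu⟩ := h v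
    exact move _ v w ⟨u, hu.mul_negStab (by simpa using ha)⟩
  have base : ∀ w, ∃ u, D.GalleryLift u w (1 : Γ) := fun w => move _ 1 w ⟨1, .base (one_mem _)⟩
  obtain ⟨t, ht, y, hy, rfl⟩ := mem_sup_T_span.1 hb
  have ht' : ∀ w, ∃ u, D.GalleryLift u w t := by
    simpa using key 1 t 1 (T_le_negStab 1 ht) base
  have : ∀ b : Γ, (∀ w, ∃ u, D.GalleryLift u w b) → ∀ w, ∃ u, D.GalleryLift u w (b * y) := by
    refine Subgroup.iSup_induction (C := fun y => ∀ b : Γ, (∀ w, ∃ u, D.GalleryLift u w b) →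
      ∀ w, ∃ u, D.GalleryLift u w (b * y)) _ hy ?_ (by simp) ?_
    · rintro ⟨α, hα⟩ x hx b h
      obtain ⟨v, hv⟩ := α.nonempty_halfSpace
      exact key b x v (U_le_negStab hα hv hx) h
    · intro x y hx hy b h w
      rw [← mul_assoc]
      exact hy _ (hx b h) w
  exact this t ht' w

/-- The uniqueness part of the Birkhoff decomposition. -/
theorem birkhoff_unique {w w' : W} {b b' n n' : Γ} (hb : b ∈ D.borelNeg) (hb' : b' ∈ D.borelNeg)
    (hn : D.Lifts n w) (hn' : D.Lifts n' w') (h : (b * n)⁻¹ * (b' * n') ∈ D.borelPos) :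
    w = w' ∧ b⁻¹ * b' ∈ D.negStab w := by
  have hc : D.SameChamber w b w' b' := by
    have h1 := T_le_borelPos ((D.lifts_wlift w).inv_mul_mem hn)
    have h2 := T_le_borelPos (hn'.inv_mul_mem (D.lifts_wlift w'))
    rw [SameChamber]
    convert mul_mem (mul_mem h1 h) h2 using 1
    group
  obtain ⟨u, hu⟩ := exists_galleryLift_of_mem_borelNeg hb w
  obtain ⟨u', hu'⟩ := exists_galleryLift_of_mem_borelNeg hb' w'
  have := hu.bruhat.mul_right hc
  rw [mul_inv_cancel_left] at this
  obtain rfl := this.unique hu'.bruhat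
  exact hu.eq_of_sameChamber hu' hc

theorem exists_birkhoff (g : Γ) :
    ∃ w, ∃ b ∈ D.borelNeg, ∃ n, D.Lifts n w ∧ (b * n)⁻¹ * g ∈ D.borelPos := by
  -- The property is stated for `g⁻¹` because parabolics act on the right of the decomposition,
  -- whereas `leftStab` records left multiplication.
  let S : Γ → Prop := fun g => ∃ w, ∃ b ∈ D.borelNeg, ∃ n, D.Lifts n w ∧
    (b * n)⁻¹ * g⁻¹ ∈ D.borelPos
  have hB : D.borelPos ≤ leftStab S := by
    refine le_leftStab fun x hx g hg => ?_
    obtain ⟨w, b, hb, n, hn, h⟩ := hg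
    refine ⟨w, b, hb, n, hn, ?_⟩
    have := mul_mem h (inv_mem hx)
    convert this using 1
    group
  have hP : ∀ i, D.parabolicPos i ≤ leftStab S := by
    refine fun i => le_leftStab fun x hx g hg => ?_
    obtain ⟨w, b, hb, n, hn, h⟩ := hg
    obtain ⟨e, -, he, w', -, c, hc, n', hn', e2⟩ := exists_panelRep (i := i) hn
      (mul_mem (borelPos_le_parabolicPos i h) (inv_mem hx))
    refine ⟨w', b * c, mul_mem hb (negStab_le_borelNeg _ hc), n', hn', ?_⟩
    convert he using 1
    have : c = n * e * n'⁻¹ := by rw [e2]; group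
    rw [this]; group
  have htop : leftStab S = ⊤ := eq_top_of_le (D := D) (T_le_borelPos.trans hB)
    (fun i => (us_le_parabolicPos i).trans (hP i)) (fun i => (vs_le_parabolicPos i).trans (hP i))
  have hm : g⁻¹ ∈ leftStab S := htop ▸ Subgroup.mem_top _
  have := (hm 1).2 ⟨1, 1, one_mem _, 1, lifts_one_iff.2 (one_mem _), by simp⟩
  simpa [S] using this

/-! ### The orders of the stabilizers -/

theorem finite_negStab (hT : Finite D.T) (hU : ∀ α, Finite (D.U α)) (w : W) :
    Finite (D.negStab w) := by
  induction w using cs.simple_induction_right with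
  | one => rw [negStab_one]; exact hT
  | mul_simple_right w i ih =>
    rcases Nat.lt_or_gt_of_ne (cs.length_mul_simple_ne w i) with hl | hl
    · have := negStab_le_mul_simple (D := D) (w := w * cs.simple i) (i := i) (by simpa using hl)
      rw [cs.simple_mul_simple_cancel_right] at this
      exact Set.Finite.subset (s := (D.negStab w : Set Γ)) ih this
    · have := Set.Finite.mul (s := (D.negStab w : Set Γ))
        (t := (D.U ((Root.simple cs i).neg.translate w) : Set Γ)) ih (hU _)
      refine Set.Finite.subset this fun x hx => ?_
      obtain ⟨y, hy, v, hv, rfl⟩ := exists_negStab_mul hl hx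
      exact Set.mul_mem_mul hy hv

theorem qMin_le (α : Root cs) : D.qMin ≤ Nat.card (D.U α) := ciInf_le' _ α

/-- At an ascent the product map from `A_v × U_δ` to `A_{vs}` is injective, since `U_{-α_s}` meets
`B₊` trivially. Each letter therefore contributes a factor of at least `qMin`. -/
theorem qMin_pow_le_card_negStab (hT : Finite D.T) (hU : ∀ α, Finite (D.U α)) (w : W) :
    D.qMin ^ cs.length w ≤ Nat.card (D.negStab w) := by
  induction hk : cs.length w generalizing w with
  | zero =>
    have := finite_negStab hT hU w
    rw [pow_zero]
    exact Nat.card_pos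
  | succ k ih =>
    have hw1 : w ≠ 1 := by rintro rfl; simp at hk
    obtain ⟨i, hi⟩ := cs.exists_rightDescent_of_ne_one hw1
    obtain ⟨v, rfl⟩ : ∃ v, w = v * cs.simple i := ⟨w * cs.simple i, by simp⟩
    have hl : cs.length v < cs.length (v * cs.simple i) := by
      simpa [CoxeterSystem.IsRightDescent] using! hi
    have hk' : cs.length v = k := by
      rcases cs.length_mul_simple v i with h | h <;> omega
    have := finite_negStab hT hU (v * cs.simple i)
    set δ := (Root.simple cs i).neg.translate v with hδ
    have hle := negStab_le_mul_simple (D := D) hl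
    have hδle : D.U δ ≤ D.negStab (v * cs.simple i) := by
      refine U_le_negStab ?_ ?_
      · rw [hδ, Root.translate_neg, Root.mem_neg, not_not]
        exact Root.one_mem_translate_simple.2 hl
      · rw [hδ, Root.mem_translate, inv_mul_cancel_left, Root.mem_neg]
        exact Root.simple_notMem_simple i
    let f : D.negStab v × D.U δ → D.negStab (v * cs.simple i) := fun p =>
      ⟨p.1 * p.2, mul_mem (hle p.1.2) (hδle p.2.2)⟩
    have hf : Function.Injective f := by
      rintro ⟨⟨y, hy⟩, ⟨x, hx⟩⟩ ⟨⟨y', hy'⟩, ⟨x', hx'⟩⟩ h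
      have h : y * x = y' * x' := congrArg Subtype.val h
      have h1 : y'⁻¹ * y = x' * x⁻¹ := by
        rw [inv_mul_eq_iff_eq_mul, ← mul_assoc, eq_mul_inv_iff_mul_eq, h]
      have h2 := conj_negStab_mem (D.lifts_wlift v) (mul_mem (inv_mem hy') hy)
      have h3 := (D.lifts_wlift v).acts.mem_inv (mul_mem hx' (inv_mem hx))
      rw [hδ, Root.translate_translate, inv_mul_cancel, Root.translate_one] at h3
      rw [h1] at h2
      have h4 := eq_one_of_mem_vs_of_mem_borelPos h3 h2
      have h5 : x' * x⁻¹ = 1 := by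
        by_contra hne
        exact conj_ne_one' hne h4
      rw [h5] at h1
      simp only [Prod.mk.injEq, Subtype.mk.injEq]
      exact ⟨(inv_mul_eq_one.1 h1).symm, (mul_inv_eq_one.1 h5).symm⟩
    have hcard := Nat.card_le_card_of_injective f hf
    rw [Nat.card_prod] at hcard
    rw [pow_succ]
    exact (Nat.mul_le_mul (ih v hk') (D.qMin_le δ)).trans hcard

end RootGroupDatum
end TwinLattice
end

noncomputable section

namespace TwinLattice

/-! ### Balls in a chamber system -/

section Ball

variable {B C : Type*} {adj : B → C → C → Prop}

/-- The chambers at gallery distance at most `n` from a chamber `c` (if adjacency is reflexive). -/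
def ball (adj : B → C → C → Prop) (c : C) : ℕ → Set C
  | 0 => {c}
  | n + 1 => {y | ∃ x ∈ ball adj c n, ∃ i, adj i x y}

theorem mem_ball_zero {c x : C} : x ∈ ball adj c 0 ↔ x = c := Iff.rfl

theorem apply_mem_ball (σ : chamberAut adj) {c x : C} {n : ℕ} (h : x ∈ ball adj c n) :
    σ.1 x ∈ ball adj (σ.1 c) n := by
  induction n generalizing x with
  | zero => rw [mem_ball_zero] at h ⊢; rw [h]
  | succ n ih =>
    obtain ⟨y, hy, i, hi⟩ := h
    obtain ⟨π, hπ⟩ := σ.2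
    exact ⟨σ.1 y, ih hy, π i, (hπ i y x).1 hi⟩

theorem mem_ball_add {x y z : C} {m n : ℕ} (h : y ∈ ball adj x m) (h' : z ∈ ball adj y n) :
    z ∈ ball adj x (m + n) := by
  induction n generalizing z with
  | zero => rw [mem_ball_zero] at h'; rwa [h']
  | succ n ih =>
    obtain ⟨w, hw, i, hi⟩ := h'
    exact ⟨w, ih hw, i, hi⟩

theorem mem_ball_symm (hs : ∀ i x y, adj i x y → adj i y x) {x y : C} {n : ℕ}
    (h : y ∈ ball adj x n) : x ∈ ball adj y n := by
  induction n generalizing y with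
  | zero => rw [mem_ball_zero] at h ⊢; rw [h]
  | succ n ih =>
    obtain ⟨w, hw, i, hi⟩ := h
    have h1 : w ∈ ball adj y 1 := ⟨y, rfl, i, hs _ _ _ hi⟩
    have := mem_ball_add h1 (ih hw)
    rwa [add_comm] at this

theorem finite_ball [Finite B] (hf : ∀ i x, {y | adj i x y}.Finite) (c : C) (n : ℕ) :
    (ball adj c n).Finite := by
  induction n with
  | zero => exact Set.finite_singleton c
  | succ n ih =>
    have : ball adj c (n + 1) ⊆ ⋃ x ∈ ball adj c n, ⋃ i, {y | adj i x y} := by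
      rintro y ⟨x, hx, i, hi⟩
      simp only [Set.mem_iUnion]
      exact ⟨x, hx, i, hi⟩
    exact (ih.biUnion fun x _ => Set.finite_iUnion fun i => hf i x).subset this

end Ball

/-! ### The automorphism group of a chamber system as a topological group -/

section ChamberAut

variable {B C : Type*} {adj : B → C → C → Prop}

theorem isOpen_setOf_apply_eq (x y : C) : IsOpen {σ : chamberAut adj | σ.1 x = y} := by
  let _ : TopologicalSpace C := ⊥
  have : DiscreteTopology C := ⟨rfl⟩
  have hc : Continuous fun σ : chamberAut adj => ((σ : Equiv.Perm C) : C → C) :=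
    continuous_induced_dom
  exact (isOpen_discrete {y}).preimage ((continuous_apply x).comp hc)

theorem continuous_chamberAut_iff {X : Type*} [TopologicalSpace X] {f : X → chamberAut adj} :
    Continuous f ↔ ∀ x y, IsOpen {z | (f z).1 x = y} := by
  refine ⟨fun h x y => (isOpen_setOf_apply_eq x y).preimage h, fun h => ?_⟩
  let _ : TopologicalSpace C := ⊥
  have : DiscreteTopology C := ⟨rfl⟩
  refine continuous_induced_rng.2 (continuous_pi fun x => ?_)
  refine continuous_discrete_rng.2 fun y => h x y

theorem nhds_chamberAut_ge {f : Filter (chamberAut adj)} {τ : chamberAut adj}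
    (h : ∀ x, ∀ᶠ σ in f, σ.1 x = τ.1 x) : f ≤ nhds τ := by
  let _ : TopologicalSpace C := ⊥
  have : DiscreteTopology C := ⟨rfl⟩
  rw [nhds_induced, ← Filter.tendsto_iff_comap]
  refine tendsto_pi_nhds.2 fun x => ?_
  rw [nhds_discrete]
  exact Filter.tendsto_pure.2 (h x)

instance isTopologicalGroup_chamberAut : IsTopologicalGroup (chamberAut adj) where
  continuous_mul := by
    refine continuous_chamberAut_iff.2 fun x y => ?_
    have : {z : chamberAut adj × chamberAut adj | (z.1 * z.2).1 x = y} =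
        ⋃ c, {z | z.2.1 x = c} ∩ {z | z.1.1 c = y} := by
      ext z
      simp
    rw [this]
    exact isOpen_iUnion fun c => ((isOpen_setOf_apply_eq x c).preimage continuous_snd).inter
      ((isOpen_setOf_apply_eq c y).preimage continuous_fst)
  continuous_inv := by
    refine continuous_chamberAut_iff.2 fun x y => ?_
    convert isOpen_setOf_apply_eq (adj := adj) y x using 3 with σ
    exact Equiv.Perm.inv_eq_iff_eq.trans eq_comm

instance t2Space_chamberAut : T2Space (chamberAut adj) := by
  let _ : TopologicalSpace C := ⊥
  have : DiscreteTopology C := ⟨rfl⟩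
  have hc : Continuous fun σ : chamberAut adj => ((σ : Equiv.Perm C) : C → C) :=
    continuous_induced_dom
  exact T2Space.of_injective_continuous
    (fun σ τ h => Subtype.ext (Equiv.coe_fn_injective h)) hc

theorem secondCountableTopology_chamberAut [Countable C] :
    SecondCountableTopology (chamberAut adj) := by
  let _ : TopologicalSpace C := ⊥
  have : DiscreteTopology C := ⟨rfl⟩
  exact TopologicalSpace.secondCountableTopology_induced (chamberAut adj) (C → C)
    (fun σ => ((σ : Equiv.Perm C) : C → C))

/-- Automorphisms fixing `c` preserve the finite balls about `c`, so along an ultrafilter the image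
of each chamber is eventually constant. The same holds for inverse images and for the permutation of
the finite type set, so the pointwise limit is an automorphism. -/
theorem isCompact_stabilizer [Finite B] (hf : ∀ i x, {y | adj i x y}.Finite) (c : C)
    (hc : ∀ x, ∃ n, x ∈ ball adj c n) : IsCompact {σ : chamberAut adj | σ.1 c = c} := by
  refine isCompact_iff_ultrafilter_le_nhds.2 fun f hfK => ?_
  have hK : ∀ᶠ σ in (f : Filter (chamberAut adj)), σ.1 c = c := Filter.le_principal_iff.1 hfK
  have key : ∀ φ : chamberAut adj → chamberAut adj, (∀ᶠ σ in (f : Filter (chamberAut adj)),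
      (φ σ).1 c = c) → ∀ x, ∃ y, ∀ᶠ σ in (f : Filter (chamberAut adj)), (φ σ).1 x = y := by
    intro φ hφ x
    obtain ⟨n, hn⟩ := hc x
    have : ∀ᶠ σ in (f : Filter (chamberAut adj)), ∃ y ∈ ball adj c n, (φ σ).1 x = y := by
      filter_upwards [hφ] with σ hσ
      refine ⟨_, ?_, rfl⟩
      have := apply_mem_ball (φ σ) hn
      rwa [hσ] at this
    obtain ⟨y, -, hy⟩ := (Ultrafilter.eventually_exists_mem_iff (finite_ball hf c n)).1 this
    exact ⟨y, hy⟩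
  choose τ hτ using key id hK
  have hK' : ∀ᶠ σ in (f : Filter (chamberAut adj)), (σ⁻¹).1 c = c := by
    filter_upwards [hK] with σ hσ
    exact Equiv.Perm.inv_eq_iff_eq.2 hσ.symm
  choose τ' hτ' using key (fun σ => σ⁻¹) hK'
  let π : chamberAut adj → Equiv.Perm B := fun σ => σ.2.choose
  have hπ : ∀ σ : chamberAut adj, ∀ i x y, adj i x y ↔ adj (π σ i) (σ.1 x) (σ.1 y) :=
    fun σ => σ.2.choose_spec
  obtain ⟨ρ, hρ⟩ : ∃ ρ, ∀ᶠ σ in (f : Filter (chamberAut adj)), π σ = ρ := by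
    have : ∀ᶠ σ in (f : Filter (chamberAut adj)), ∃ ρ ∈ (Set.univ : Set (Equiv.Perm B)),
        π σ = ρ := Filter.Eventually.of_forall fun σ => ⟨_, trivial, rfl⟩
    obtain ⟨ρ, -, hρ⟩ := (Ultrafilter.eventually_exists_mem_iff Set.finite_univ).1 this
    exact ⟨ρ, hρ⟩
  have h1 : ∀ x, τ' (τ x) = x := by
    intro x
    obtain ⟨σ, h, h'⟩ := ((hτ x).and (hτ' (τ x))).exists
    rw [← h', ← h]
    exact σ.1.symm_apply_apply x
  have h2 : ∀ x, τ (τ' x) = x := by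
    intro x
    obtain ⟨σ, h, h'⟩ := ((hτ' x).and (hτ (τ' x))).exists
    rw [← h', ← h]
    exact σ.1.apply_symm_apply x
  let t : chamberAut adj := ⟨⟨τ, τ', h1, h2⟩, ρ, fun i x y => by
    obtain ⟨σ, ⟨hx, hy⟩, h⟩ := (((hτ x).and (hτ y)).and hρ).exists
    have := hπ σ i x y
    rw [h] at this
    change σ.1 x = τ x at hx
    change σ.1 y = τ y at hy
    rwa [hx, hy] at this⟩
  refine ⟨t, ?_, nhds_chamberAut_ge fun x => hτ x⟩
  obtain ⟨σ, h, h'⟩ := (hK.and (hτ c)).exists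
  exact h'.symm.trans h

end ChamberAut

/-! ### Coset chamber systems -/

section Coset

variable {B Γ : Type*} [Group Γ] {H : Subgroup Γ} {P : B → Subgroup Γ}

theorem cosetAdj_mk (hP : ∀ i, H ≤ P i) {i : B} {g h : Γ} :
    cosetAdj H P i (g : Γ ⧸ H) (h : Γ ⧸ H) ↔ g⁻¹ * h ∈ P i := by
  refine ⟨?_, fun hh => ⟨g, h, rfl, rfl, hh⟩⟩
  rintro ⟨g', h', hg, hh, hm⟩
  have h1 := hP i (QuotientGroup.eq.1 hg)
  have h2 := hP i (QuotientGroup.eq.1 hh)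
  have := mul_mem (mul_mem (inv_mem h1) hm) h2
  convert this using 1
  group

theorem cosetAdj_symm (i : B) (x y : Γ ⧸ H) (h : cosetAdj H P i x y) : cosetAdj H P i y x := by
  obtain ⟨g, g', rfl, rfl, hm⟩ := h
  exact ⟨g', g, rfl, rfl, by simpa using inv_mem hm⟩

theorem finite_cosetAdj (hP : ∀ i, H ≤ P i)
    (hR : ∀ i, ∃ R : Set Γ, R.Finite ∧ ∀ h ∈ P i, ∃ e ∈ R, e⁻¹ * h ∈ H) (i : B) (x : Γ ⧸ H) :
    {y | cosetAdj H P i x y}.Finite := by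
  obtain ⟨g, rfl⟩ := QuotientGroup.mk_surjective x
  obtain ⟨R, hR, h⟩ := hR i
  refine (hR.image fun e => ((g * e : Γ) : Γ ⧸ H)).subset ?_
  intro y hy
  obtain ⟨k, rfl⟩ := QuotientGroup.mk_surjective y
  obtain ⟨e, he, hm⟩ := h _ ((cosetAdj_mk hP).1 hy)
  refine ⟨e, he, QuotientGroup.eq.2 ?_⟩
  convert hm using 1
  group

theorem smul_mem_ball (γ : Γ) {x y : Γ ⧸ H} {n : ℕ} (h : y ∈ ball (cosetAdj H P) x n) :
    γ • y ∈ ball (cosetAdj H P) (γ • x) n :=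
  apply_mem_ball (cosetAction H P γ) h

theorem exists_mem_ball_of_generate (hP : ∀ i, H ≤ P i) (hgen : H ⊔ ⨆ i, P i = ⊤)
    (x : Γ ⧸ H) : ∃ n, x ∈ ball (cosetAdj H P) ((1 : Γ) : Γ ⧸ H) n := by
  let S : Subgroup Γ :=
    { carrier := {g | ∃ n, (g : Γ ⧸ H) ∈ ball (cosetAdj H P) ((1 : Γ) : Γ ⧸ H) n}
      one_mem' := ⟨0, rfl⟩
      mul_mem' := by
        rintro g h ⟨m, hm⟩ ⟨n, hn⟩
        have := smul_mem_ball g hn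
        simp only [MulAction.Quotient.smul_coe, smul_eq_mul, mul_one] at this
        exact ⟨m + n, mem_ball_add hm this⟩
      inv_mem' := by
        rintro g ⟨m, hm⟩
        have := smul_mem_ball g⁻¹ hm
        simp only [MulAction.Quotient.smul_coe, smul_eq_mul, mul_one, inv_mul_cancel] at this
        exact ⟨m, mem_ball_symm cosetAdj_symm this⟩ }
  have hS : S = ⊤ := by
    rw [eq_top_iff, ← hgen]
    refine sup_le (fun b hb => ⟨0, ?_⟩) (iSup_le fun i p hp => ⟨1, _, rfl, i, ?_⟩)
    · exact (QuotientGroup.eq.2 (by simpa using hb) : ((1 : Γ) : Γ ⧸ H) = b).symm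
    · exact (cosetAdj_mk hP).2 (by simpa using hp)
  obtain ⟨g, rfl⟩ := QuotientGroup.mk_surjective x
  exact (hS ▸ Subgroup.mem_top g : g ∈ S)

end Coset

end TwinLattice

end

noncomputable section

namespace TwinLattice

namespace RootGroupDatum

variable {B W : Type*} [Group W] {M : CoxeterMatrix B} {cs : CoxeterSystem M W}
  {Γ : Type*} [Group Γ] {D : RootGroupDatum cs Γ}

/-! ### Local finiteness and connectedness of the twin buildings -/

theorem finite_coe_of_finite {H : Subgroup Γ} (h : Finite H) : (H : Set Γ).Finite :=
  Set.toFinite _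

theorem finite_panelRep (hU : ∀ α, Finite (D.U α)) (i : B) : (panelRep D i).Finite := by
  have hu : (D.us i : Set Γ).Finite := finite_coe_of_finite (hU _)
  have hv : (D.vs i : Set Γ).Finite := finite_coe_of_finite (hU _)
  refine (hv.union (hu.image (· * D.refl i))).subset ?_
  rintro e (he | ⟨x, hx, rfl⟩)
  · exact Or.inl he
  · exact Or.inr ⟨x, hx, rfl⟩

theorem exists_panelRep_mem {i : B} {h : Γ} (hh : h ∈ D.parabolicPos i) :
    ∃ e ∈ panelRep D i, e⁻¹ * h ∈ D.borelPos := by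
  obtain ⟨e, he, h', -⟩ := exists_panelRep (lifts_one_iff.2 (one_mem D.T)) hh
  exact ⟨e, he, h'⟩

theorem exists_panelRep_op_mem {i : B} {h : Γ} (hh : h ∈ D.parabolicNeg i) :
    ∃ e ∈ panelRep D.op i, e⁻¹ * h ∈ D.borelNeg := by
  rw [← op_parabolicPos] at hh
  rw [← op_borelPos]
  exact exists_panelRep_mem hh

theorem panelRep_op_subset_parabolicPos {i : B} {e : Γ} (he : e ∈ panelRep D.op i) :
    e ∈ D.parabolicPos i := by
  have hv : ∀ x ∈ D.op.vs i, x ∈ D.parabolicPos i := fun x hx =>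
    us_le_parabolicPos i (by rwa [op_vs] at hx)
  have hu : ∀ x ∈ D.op.us i, x ∈ D.parabolicPos i := fun x hx => vs_le_parabolicPos i hx
  rcases he with he | ⟨x, hx, rfl⟩
  · exact hv _ he
  · exact mul_mem (hu x hx) ((sup_le hu hv : D.op.us i ⊔ D.op.vs i ≤ D.parabolicPos i) (D.op.refl_mem_sup i))

theorem borelNeg_le_parabolicNeg (i : B) : D.borelNeg ≤ D.parabolicNeg i := le_sup_left

variable (D) in
theorem generate_pos : D.borelPos ⊔ ⨆ i, D.parabolicPos i = ⊤ :=
  eq_top_of_le (T_le_borelPos.trans le_sup_left)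
    (fun i => (us_le_borelPos i).trans le_sup_left)
    (fun i => (vs_le_parabolicPos i).trans ((le_iSup D.parabolicPos i).trans le_sup_right))

variable (D) in
theorem generate_neg : D.borelNeg ⊔ ⨆ i, D.parabolicNeg i = ⊤ := by
  have := D.op.generate_pos
  simpa only [op_borelPos, op_parabolicPos] using this

variable (D) in
/-- The base chamber of `X₊`. -/
def basePos : Γ ⧸ D.borelPos := ((1 : Γ) : Γ ⧸ D.borelPos)

variable (D) in
/-- The base chamber of `X₋`. -/
def baseNeg : Γ ⧸ D.borelNeg := ((1 : Γ) : Γ ⧸ D.borelNeg)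

variable (D) in
/-- Balls in `X₊`. -/
abbrev ballPos : Γ ⧸ D.borelPos → ℕ → Set (Γ ⧸ D.borelPos) := ball (cosetAdj D.borelPos D.parabolicPos)

variable (D) in
/-- Balls in `X₋`. -/
abbrev ballNeg : Γ ⧸ D.borelNeg → ℕ → Set (Γ ⧸ D.borelNeg) := ball (cosetAdj D.borelNeg D.parabolicNeg)

theorem finite_adjPos (hU : ∀ α, Finite (D.U α)) (i : B) (x : Γ ⧸ D.borelPos) :
    {y | cosetAdj D.borelPos D.parabolicPos i x y}.Finite :=
  finite_cosetAdj borelPos_le_parabolicPos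
    (fun i => ⟨_, finite_panelRep hU i, fun _ => exists_panelRep_mem⟩) i x

theorem finite_adjNeg (hU : ∀ α, Finite (D.U α)) (i : B) (x : Γ ⧸ D.borelNeg) :
    {y | cosetAdj D.borelNeg D.parabolicNeg i x y}.Finite :=
  finite_cosetAdj borelNeg_le_parabolicNeg
    (fun i => ⟨_, finite_panelRep (D := D.op) (fun α => hU α.neg) i,
      fun _ => exists_panelRep_op_mem⟩) i x

theorem exists_mem_ballPos (x : Γ ⧸ D.borelPos) : ∃ n, x ∈ D.ballPos D.basePos n :=
  exists_mem_ball_of_generate borelPos_le_parabolicPos D.generate_pos x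

theorem exists_mem_ballNeg (x : Γ ⧸ D.borelNeg) : ∃ n, x ∈ D.ballNeg D.baseNeg n :=
  exists_mem_ball_of_generate borelNeg_le_parabolicNeg D.generate_neg x

/-! ### Finiteness properties of `Γ` -/

variable (D) in
/-- The elements of `T` that centralize all simple root groups and their opposites. -/
def centralT : Subgroup Γ :=
  D.T ⊓ ⨅ i, Subgroup.centralizer (D.us i : Set Γ) ⊓ Subgroup.centralizer (D.vs i : Set Γ)

theorem mem_centralT {t : Γ} : t ∈ D.centralT ↔ t ∈ D.T ∧
    ∀ i, (∀ u ∈ D.us i, u * t = t * u) ∧ ∀ v ∈ D.vs i, v * t = t * v := by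
  simp [centralT, Subgroup.mem_iInf, Subgroup.mem_centralizer_iff]

/-- `T` normalizes the simple root groups and their opposites, and these centralize `centralT`;
together they generate `Γ`. -/
theorem conj_mem_centralT (g : Γ) : ∀ t ∈ D.centralT, g * t * g⁻¹ ∈ D.centralT := by
  have key : ∀ H : Subgroup Γ, (∀ h ∈ H, ∀ t ∈ D.centralT, h * t * h⁻¹ ∈ D.centralT) →
      H ≤ Subgroup.normalizer (D.centralT : Set Γ) := by
    intro H hH h hh
    rw [Subgroup.mem_normalizer_iff]
    refine fun t => ⟨hH h hh t, fun ht => ?_⟩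
    have := hH h⁻¹ (inv_mem hh) _ ht
    convert this using 1
    group
  have hn : Subgroup.normalizer (D.centralT : Set Γ) = ⊤ := by
    refine eq_top_of_le (D := D) (key _ fun s hs t ht => ?_) (fun i => key _ fun u hu t ht => ?_)
      (fun i => key _ fun u hu t ht => ?_)
    · rw [mem_centralT] at ht ⊢
      have aux : ∀ (α : Root cs) (u : Γ), u ∈ D.U α → (∀ u ∈ D.U α, u * t = t * u) →
          u * (s * t * s⁻¹) = s * t * s⁻¹ * u := by
        intro α u hu hc
        have h1 := hc _ (D.normalize _ (inv_mem hs) α u hu)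
        calc u * (s * t * s⁻¹) = s * (s⁻¹ * u * s⁻¹⁻¹ * t) * s⁻¹ := by group
          _ = s * (t * (s⁻¹ * u * s⁻¹⁻¹)) * s⁻¹ := by rw [h1]
          _ = s * t * s⁻¹ * u := by group
      exact ⟨mul_mem (mul_mem hs ht.1) (inv_mem hs), fun i =>
        ⟨fun u hu => aux _ u hu (ht.2 i).1, fun u hu => aux _ u hu (ht.2 i).2⟩⟩
    · rwa [((mem_centralT.1 ht).2 i).1 u hu, mul_inv_cancel_right]
    · rwa [((mem_centralT.1 ht).2 i).2 u hu, mul_inv_cancel_right]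
  have hg : g ∈ Subgroup.normalizer (D.centralT : Set Γ) := hn ▸ Subgroup.mem_top g
  exact fun t ht => (Subgroup.mem_normalizer_iff.1 hg t).1 ht

/-- A normal subgroup inside `T` lies in every conjugate of `B₊` and `B₋`, hence acts trivially on
both buildings. -/
theorem centralT_eq_bot (hinj : Function.Injective D.toAmbient) : D.centralT = ⊥ := by
  rw [eq_bot_iff]
  intro t ht
  have key : ∀ g : Γ, g⁻¹ * t * g ∈ D.T := fun g =>
    (mem_centralT.1 (by simpa using conj_mem_centralT g⁻¹ t ht)).1
  have aux : ∀ H : Subgroup Γ, D.T ≤ H → ∀ x : Γ ⧸ H, t • x = x := by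
    intro H hH x
    obtain ⟨g, rfl⟩ := QuotientGroup.mk_surjective x
    rw [MulAction.Quotient.smul_coe, smul_eq_mul, QuotientGroup.eq]
    have := inv_mem (hH (key g))
    convert this using 1
    group
  refine Subgroup.mem_bot.2 (hinj ?_)
  rw [map_one]
  refine Prod.ext (Subtype.ext (Equiv.ext fun x => ?_)) (Subtype.ext (Equiv.ext fun x => ?_))
  · exact aux _ T_le_borelPos x
  · exact aux _ T_le_borelNeg x

/-- `T` acts by conjugation on finitely many finite root groups, and the kernel of this action is
the trivial group `centralT`. -/
theorem finite_T [Finite B] (hU : ∀ α, Finite (D.U α)) (hinj : Function.Injective D.toAmbient) :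
    Finite D.T := by
  have h1 : ∀ i, Finite (D.us i) := fun i => hU _
  have h2 : ∀ i, Finite (D.vs i) := fun i => hU _
  let φ : D.T → ∀ i, (D.us i → D.us i) × (D.vs i → D.vs i) := fun t i =>
    (fun u => ⟨t.1 * u.1 * t.1⁻¹, D.normalize _ t.2 _ _ u.2⟩,
      fun u => ⟨t.1 * u.1 * t.1⁻¹, D.normalize _ t.2 _ _ u.2⟩)
  refine Finite.of_injective φ fun s t h => ?_
  have aux : ∀ u : Γ, s.1 * u * s.1⁻¹ = t.1 * u * t.1⁻¹ → u * (s.1⁻¹ * t.1) = s.1⁻¹ * t.1 * u := by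
    intro u hu
    calc u * (s.1⁻¹ * t.1) = s.1⁻¹ * (s.1 * u * s.1⁻¹) * t.1 := by group
      _ = s.1⁻¹ * (t.1 * u * t.1⁻¹) * t.1 := by rw [hu]
      _ = s.1⁻¹ * t.1 * u := by group
  have hc : s.1⁻¹ * t.1 ∈ D.centralT := by
    refine mem_centralT.2 ⟨mul_mem (inv_mem s.2) t.2, fun i => ⟨fun u hu => aux u ?_,
      fun u hu => aux u ?_⟩⟩
    · have := congrFun (congrArg Prod.fst (congrFun h i)) ⟨u, hu⟩
      exact congrArg Subtype.val this
    · have := congrFun (congrArg Prod.snd (congrFun h i)) ⟨u, hu⟩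
      exact congrArg Subtype.val this
  rw [centralT_eq_bot hinj, Subgroup.mem_bot] at hc
  exact Subtype.ext (inv_mul_eq_one.1 hc)

theorem group_fg [Finite B] (hU : ∀ α, Finite (D.U α)) (hinj : Function.Injective D.toAmbient) :
    Group.FG Γ := by
  have hT := finite_T hU hinj
  have h1 : ∀ i, (D.us i : Set Γ).Finite := fun i => finite_coe_of_finite (hU _)
  have h2 : ∀ i, (D.vs i : Set Γ).Finite := fun i => finite_coe_of_finite (hU _)
  refine Group.fg_iff.2 ⟨(D.T : Set Γ) ∪ ⋃ i, ((D.us i : Set Γ) ∪ (D.vs i : Set Γ)), ?_,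
    (finite_coe_of_finite hT).union (Set.finite_iUnion fun i => (h1 i).union (h2 i))⟩
  refine eq_top_of_le (fun t ht => Subgroup.subset_closure (Or.inl ht))
    (fun i u hu => Subgroup.subset_closure (Or.inr (Set.mem_iUnion.2 ⟨i, Or.inl hu⟩)))
    (fun i u hu => Subgroup.subset_closure (Or.inr (Set.mem_iUnion.2 ⟨i, Or.inr hu⟩)))

/-- An element of finite order has image `1`, and `Γ` is generated by finite subgroups. The lemma is
meant for the modular character. -/
theorem map_eq_one_of_finite [Finite B] (hU : ∀ α, Finite (D.U α)) (hT : Finite D.T)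
    (φ : Γ →* NNReal) (γ : Γ) : φ γ = 1 := by
  have key : ∀ H : Subgroup Γ, Finite H → H ≤ φ.ker := by
    intro H hH x hx
    have hf : IsOfFinOrder (⟨x, hx⟩ : H) := isOfFinOrder_of_finite _
    obtain ⟨n, hn, e⟩ := isOfFinOrder_iff_pow_eq_one.1 hf
    have e' : x ^ n = 1 := congrArg Subtype.val e
    have := congrArg φ e'
    rw [map_pow, map_one] at this
    exact (pow_eq_one_iff_of_nonneg zero_le hn.ne').1 this
  have : φ.ker = ⊤ := eq_top_of_le (key _ hT) (fun i => key _ (hU _)) (fun i => key _ (hU _))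
  exact (this ▸ Subgroup.mem_top γ : γ ∈ φ.ker)

/-! ### A bound for subadditive functions on `Γ` -/

theorem Lifts.mem_ballPos {n : Γ} {w : W} (hn : D.Lifts n w) :
    (n : Γ ⧸ D.borelPos) ∈ D.ballPos D.basePos (cs.length w) := by
  induction hk : cs.length w generalizing n w with
  | zero =>
    rw [cs.length_eq_zero_iff] at hk
    subst hk
    refine (QuotientGroup.eq.2 ?_ : ((1 : Γ) : Γ ⧸ D.borelPos) = n).symm
    simpa using T_le_borelPos (lifts_one_iff.1 hn)
  | succ k ih =>
    have hw : w ≠ 1 := by rintro rfl; simp at hk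
    obtain ⟨i, hi⟩ := cs.exists_rightDescent_of_ne_one hw
    rw [CoxeterSystem.isRightDescent_iff] at hi
    refine ⟨_, ih (hn.mul_refl i) (by omega), i, ?_⟩
    rw [cosetAdj_mk borelPos_le_parabolicPos, mul_inv_rev, inv_mul_cancel_right]
    exact inv_mem (refl_mem_parabolicPos i)

variable {N : Γ → ℕ} {C : ℕ}

/-- Panel representatives of `X₋` also lie in the positive parabolics. The product that follows a
gallery in `X₋` therefore traces one of the same length in `X₊`. -/
theorem exists_prod_panelRep_op (h1 : N 1 = 0) (hmul : ∀ x y, N (x * y) ≤ N x + N y)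
    (hN : ∀ i, ∀ e ∈ panelRep D.op i, N e ≤ C) {l : ℕ} {γ : Γ}
    (h : (γ : Γ ⧸ D.borelNeg) ∈ D.ballNeg D.baseNeg l) :
    ∃ g, N g ≤ C * l ∧ (g : Γ ⧸ D.borelPos) ∈ D.ballPos D.basePos l ∧ g⁻¹ * γ ∈ D.borelNeg := by
  induction l generalizing γ with
  | zero =>
    refine ⟨1, h1.le, rfl, ?_⟩
    exact QuotientGroup.eq.1 (show ((1 : Γ) : Γ ⧸ D.borelNeg) = γ from h.symm)
  | succ l ih =>
    obtain ⟨x, hx, i, hi⟩ := h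
    obtain ⟨γ₀, rfl⟩ := QuotientGroup.mk_surjective x
    obtain ⟨g, hg, hg', hb⟩ := ih hx
    rw [cosetAdj_mk borelNeg_le_parabolicNeg] at hi
    have hp := mul_mem (borelNeg_le_parabolicNeg i hb) hi
    obtain ⟨e, he, hb'⟩ := exists_panelRep_op_mem hp
    refine ⟨g * e, (hmul g e).trans ?_, ⟨_, hg', i, ?_⟩, ?_⟩
    · have := hN i e he
      rw [mul_add, mul_one]
      omega
    · rw [cosetAdj_mk borelPos_le_parabolicPos, inv_mul_cancel_left]
      exact panelRep_op_subset_parabolicPos he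
    · convert hb' using 1
      group

/-- Along a gallery in `X₊`, each step multiplies `b n` on the right by one panel representative,
keeps the first factor in `B₋`, and changes `w` by at most one letter. -/
theorem exists_prod_panelRep (h1 : N 1 = 0) (hmul : ∀ x y, N (x * y) ≤ N x + N y)
    (hN : ∀ i, ∀ e ∈ panelRep D i, N e ≤ C) {m : ℕ} {γ : Γ}
    (h : (γ : Γ ⧸ D.borelPos) ∈ D.ballPos D.basePos m) :
    ∃ b ∈ D.borelNeg, ∃ n w, D.Lifts n w ∧ N (b * n) ≤ C * m ∧ cs.length w ≤ m ∧
      (b * n)⁻¹ * γ ∈ D.borelPos := by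
  induction m generalizing γ with
  | zero =>
    refine ⟨1, one_mem _, 1, 1, lifts_one_iff.2 (one_mem _), by simp [h1], by simp, ?_⟩
    simpa using QuotientGroup.eq.1 (show ((1 : Γ) : Γ ⧸ D.borelPos) = γ from h.symm)
  | succ m ih =>
    obtain ⟨x, hx, i, hi⟩ := h
    obtain ⟨γ₀, rfl⟩ := QuotientGroup.mk_surjective x
    obtain ⟨b, hb, n, w, hn, hNb, hl, hb'⟩ := ih hx
    rw [cosetAdj_mk borelPos_le_parabolicPos] at hi
    have hp := mul_mem (borelPos_le_parabolicPos i hb') hi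
    obtain ⟨e, he, he', w', hw', c, hc, n', hn', e1⟩ := exists_panelRep hn hp
    have e2 : b * c * n' = b * n * e := by rw [mul_assoc, ← e1, mul_assoc]
    refine ⟨b * c, mul_mem hb (negStab_le_borelNeg _ hc), n', w', hn', ?_, ?_, ?_⟩
    · rw [e2]
      refine (hmul _ e).trans ?_
      have := hN i e he
      rw [mul_add, mul_one]
      omega
    · have : w' = w ∨ w' = w * cs.simple i := by
        rcases eq_upper_or (cs := cs) i w with h | h <;>
          rcases eq_upper_or (cs := cs) i w' with h' | h' <;> rw [← hw'] at h'
        · exact Or.inl (h'.trans h.symm)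
        · rw [← h] at h'
          exact Or.inr h'
        · refine Or.inr ?_
          rw [h', h]
          conv_lhs => rw [← h]
          simp
        · exact Or.inl (h'.trans h.symm)
      rcases this with rfl | rfl
      · omega
      · have := cs.length_mul_le w (cs.simple i)
        rw [cs.length_simple] at this
        omega
    · rw [e2]
      convert he' using 1
      group

/-- Choose `g` following a gallery to `γ c₋`, so that `g⁻¹ γ` lies in `B₋`. Uniqueness in the
Birkhoff decomposition gives `ℓ(w') ≤ l + k`, hence `g⁻¹ γ c₊` is within `2k + 2l` of `c₊`. An
element of `B₋` has trivial Weyl component, so the product following that gallery recovers `g⁻¹ γ`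
up to `T`. The costs are `C l`, `C (2k + 2l)` and `C`. -/
theorem le_of_mem_ball (h1 : N 1 = 0) (hmul : ∀ x y, N (x * y) ≤ N x + N y)
    (hT : ∀ t ∈ D.T, N t ≤ C) (hN : ∀ i, ∀ e ∈ panelRep D i, N e ≤ C)
    (hN' : ∀ i, ∀ e ∈ panelRep D.op i, N e ≤ C) {k l : ℕ} {γ n' : Γ} {w' : W}
    (hn' : D.Lifts n' w') (hk : ((γ * n' : Γ) : Γ ⧸ D.borelPos) ∈ D.ballPos D.basePos k)
    (hl : (γ : Γ ⧸ D.borelNeg) ∈ D.ballNeg D.baseNeg l) :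
    N γ ≤ C * (2 * k + 3 * l + 1) := by
  obtain ⟨g, hg, hgl, hb⟩ := exists_prod_panelRep_op h1 hmul hN' hl
  have hgl' : ((g⁻¹ : Γ) : Γ ⧸ D.borelPos) ∈ D.ballPos D.basePos l := by
    have := mem_ball_symm cosetAdj_symm (smul_mem_ball g⁻¹ hgl)
    simpa [basePos, MulAction.Quotient.smul_coe] using this
  have hmove : ∀ {x : Γ} {k : ℕ}, (x : Γ ⧸ D.borelPos) ∈ D.ballPos D.basePos k →
      ((g⁻¹ * x : Γ) : Γ ⧸ D.borelPos) ∈ D.ballPos D.basePos (l + k) := by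
    intro x k hx
    have := smul_mem_ball g⁻¹ hx
    rw [basePos, MulAction.Quotient.smul_coe, MulAction.Quotient.smul_coe, smul_eq_mul,
      smul_eq_mul, mul_one] at this
    exact mem_ball_add hgl' this
  have hlw : cs.length w' ≤ l + k := by
    obtain ⟨b, hb1, n, w, hn, -, hw, hb2⟩ := exists_prod_panelRep h1 hmul hN (hmove hk)
    rw [← mul_assoc g⁻¹] at hb2
    rwa [← (birkhoff_unique hb1 hb hn hn' hb2).1]
  have hγ : (γ : Γ ⧸ D.borelPos) ∈ D.ballPos D.basePos (k + cs.length w') := by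
    have h2 := smul_mem_ball γ hn'.mem_ballPos
    rw [basePos, MulAction.Quotient.smul_coe, MulAction.Quotient.smul_coe, smul_eq_mul,
      smul_eq_mul, mul_one] at h2
    exact mem_ball_add hk (mem_ball_symm cosetAdj_symm h2)
  obtain ⟨b, hb1, n, w, hn, hNb, hw, hb2⟩ := exists_prod_panelRep h1 hmul hN (hmove hγ)
  have h1T : D.Lifts 1 1 := lifts_one_iff.2 (one_mem D.T)
  obtain ⟨rfl, hbT⟩ := birkhoff_unique hb1 hb hn h1T (by rwa [mul_one])
  rw [negStab_one] at hbT
  have hnT := lifts_one_iff.1 hn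
  have e : γ = g * ((b * n) * (n⁻¹ * (b⁻¹ * (g⁻¹ * γ)))) := by group
  have hlast := hT _ (mul_mem (inv_mem hnT) hbT)
  calc N γ = N (g * ((b * n) * (n⁻¹ * (b⁻¹ * (g⁻¹ * γ))))) := by rw [← e]
    _ ≤ N g + (N (b * n) + N (n⁻¹ * (b⁻¹ * (g⁻¹ * γ)))) :=
      (hmul _ _).trans (Nat.add_le_add_left (hmul _ _) _)
    _ ≤ C * l + (C * (l + (k + cs.length w')) + C) := by gcongr
    _ ≤ C * l + (C * (l + (k + (l + k))) + C) := by gcongr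
    _ = C * (2 * k + 3 * l + 1) := by ring

end RootGroupDatum

end TwinLattice

end

noncomputable section

namespace TwinLattice

/-! ### Growth estimates -/

/-- Summability yields one index `k > 0` with `a k ≤ 1/2`, and submultiplicativity then halves the
bound every `k` steps. -/
theorem exists_le_geometric {a : ℕ → ℝ} (h0 : ∀ n, 0 ≤ a n) (hmul : ∀ m n, a (m + n) ≤ a m * a n)
    (hs : Summable a) : ∃ A ρ : ℝ, 0 ≤ ρ ∧ ρ < 1 ∧ ∀ n, a n ≤ A * ρ ^ n := by
  obtain ⟨k, hk1, hk0⟩ : ∃ k, a k ≤ 1 / 2 ∧ 0 < k := by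
    have h1 : ∀ᶠ n in Filter.atTop, a n < 1 / 2 :=
      hs.tendsto_atTop_zero.eventually (gt_mem_nhds (by norm_num))
    obtain ⟨n, h, h'⟩ := (h1.and (Filter.eventually_gt_atTop 0)).exists
    exact ⟨n, h.le, h'⟩
  obtain ⟨S, hS⟩ : ∃ S, ∀ n, a n ≤ S := ⟨∑' n, a n, fun n => hs.le_tsum n fun m _ => h0 m⟩
  have hS0 : 0 ≤ S := (h0 0).trans (hS 0)
  have hpow : ∀ j r, a (k * j + r) ≤ (1 / 2) ^ j * S := by
    intro j r
    induction j with
    | zero => simpa using hS r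
    | succ j ih =>
      calc a (k * (j + 1) + r) = a (k + (k * j + r)) := by congr 1; ring
        _ ≤ a k * a (k * j + r) := hmul _ _
        _ ≤ 1 / 2 * ((1 / 2) ^ j * S) := by
          gcongr
          exact h0 _
        _ = (1 / 2) ^ (j + 1) * S := by ring
  obtain ⟨ρ, hρ0, hρ1, hρ⟩ : ∃ ρ : ℝ, 0 < ρ ∧ ρ < 1 ∧ ρ ^ k = 1 / 2 := by
    refine ⟨(1 / 2 : ℝ) ^ ((k : ℝ)⁻¹), by positivity, ?_, ?_⟩
    · exact Real.rpow_lt_one (by norm_num) (by norm_num) (by positivity)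
    · exact Real.rpow_inv_natCast_pow (by norm_num) hk0.ne'
  refine ⟨2 * S, ρ, hρ0.le, hρ1, fun n => ?_⟩
  have h1 := hpow (n / k) (n % k)
  rw [Nat.div_add_mod, ← hρ, ← pow_mul] at h1
  -- Rounding `n` down to a multiple of `k` costs at most `ρ ^ (-k) = 2`.
  have h2 : ρ ^ (k * (n / k)) ≤ 2 * ρ ^ n := by
    have h3 : ρ ^ k ≤ ρ ^ (n % k) := pow_le_pow_of_le_one hρ0.le hρ1.le (Nat.mod_lt n hk0).le
    have h4 : ρ ^ n = ρ ^ (k * (n / k)) * ρ ^ (n % k) := by rw [← pow_add, Nat.div_add_mod]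
    rw [hρ] at h3
    rw [h4]
    have : 0 < ρ ^ (k * (n / k)) := by positivity
    nlinarith
  calc a n ≤ ρ ^ (k * (n / k)) * S := h1
    _ ≤ 2 * ρ ^ n * S := by gcongr
    _ = 2 * S * ρ ^ n := by ring

theorem summable_pow_mul_of_submultiplicative {a : ℕ → ℝ} (h0 : ∀ n, 0 ≤ a n)
    (hmul : ∀ m n, a (m + n) ≤ a m * a n) (hs : Summable a) (P : ℕ) :
    Summable fun n : ℕ => ((n : ℝ) + 1) ^ P * a n := by
  obtain ⟨A, ρ, hρ0, hρ1, hA⟩ := exists_le_geometric h0 hmul hs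
  have h1 : Summable fun n : ℕ => (n : ℝ) ^ P * ρ ^ n :=
    summable_pow_mul_geometric_of_norm_lt_one P (by rwa [Real.norm_of_nonneg hρ0])
  have h2 : Summable fun n : ℕ => ρ ^ n := summable_geometric_of_lt_one hρ0 hρ1
  have hA0 : 0 ≤ A := by simpa using (h0 0).trans (hA 0)
  refine Summable.of_nonneg_of_le (fun n => mul_nonneg (by positivity) (h0 n)) (fun n => ?_)
    ((h1.add h2).mul_left (2 ^ P * A))
  have h3 : ((n : ℝ) + 1) ^ P ≤ 2 ^ P * ((n : ℝ) ^ P + 1) := by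
    have : ((n : ℝ) + 1) ^ P ≤ 2 ^ (P - 1) * ((n : ℝ) ^ P + 1 ^ P) :=
      add_pow_le (by positivity) zero_le_one P
    rw [one_pow] at this
    refine this.trans ?_
    gcongr
    · norm_num
    · omega
  calc ((n : ℝ) + 1) ^ P * a n ≤ 2 ^ P * ((n : ℝ) ^ P + 1) * (A * ρ ^ n) :=
        mul_le_mul h3 (hA n) (h0 n) (by positivity)
    _ = 2 ^ P * A * ((n : ℝ) ^ P * ρ ^ n + ρ ^ n) := by ring

/-! ### Word length -/

section WordLength

variable {Γ : Type*} [Group Γ] {A : Set Γ}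

theorem wordLength_le {γ : Γ} (l : List Γ) (hl : ∀ x ∈ l, x ∈ A ∨ x⁻¹ ∈ A) (h : l.prod = γ) :
    wordLength A γ ≤ l.length := Nat.sInf_le ⟨l, rfl, hl, h⟩

theorem wordLength_one : wordLength A (1 : Γ) = 0 :=
  Nat.le_zero.1 (wordLength_le [] (by simp) rfl)

theorem exists_wordLength_eq (hA : Subgroup.closure A = ⊤) (γ : Γ) :
    ∃ l : List Γ, l.length = wordLength A γ ∧ (∀ x ∈ l, x ∈ A ∨ x⁻¹ ∈ A) ∧ l.prod = γ := by
  have hγ : γ ∈ Subgroup.closure A := hA ▸ Subgroup.mem_top γ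
  rw [← Subgroup.mem_toSubmonoid, Subgroup.closure_toSubmonoid] at hγ
  obtain ⟨l, hl, h⟩ := Submonoid.exists_list_of_mem_closure hγ
  exact Nat.sInf_mem (s := {n | ∃ l : List Γ, l.length = n ∧ (∀ x ∈ l, x ∈ A ∨ x⁻¹ ∈ A) ∧
    l.prod = γ}) ⟨l.length, l, rfl, hl, h⟩

theorem wordLength_mul_le (hA : Subgroup.closure A = ⊤) (x y : Γ) :
    wordLength A (x * y) ≤ wordLength A x + wordLength A y := by
  obtain ⟨l, hl, h, rfl⟩ := exists_wordLength_eq hA x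
  obtain ⟨l', hl', h', rfl⟩ := exists_wordLength_eq hA y
  rw [← hl, ← hl', ← List.length_append, ← List.prod_append]
  refine wordLength_le _ (fun z hz => ?_) rfl
  rcases List.mem_append.1 hz with hz | hz
  · exact h z hz
  · exact h' z hz

end WordLength

/-! ### The twin buildings as locally compact topological groups -/

namespace RootGroupDatum

variable {B W : Type*} [Group W] {M : CoxeterMatrix B} {cs : CoxeterSystem M W}
  {Γ : Type*} [Group Γ] {D : RootGroupDatum cs Γ}

theorem countable_of_fg {G : Type*} [Group G] (h : Group.FG G) : Countable G := by
  obtain ⟨S, hS, φ, hφ⟩ := Group.fg_iff_exists_freeGroup_hom_surjective.1 h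
  have : Finite S := hS
  exact hφ.countable

theorem secondCountableTopology_ambient [Countable Γ] : SecondCountableTopology D.Ambient := by
  have : Countable (Γ ⧸ D.borelPos) := QuotientGroup.mk_surjective.countable
  have : Countable (Γ ⧸ D.borelNeg) := QuotientGroup.mk_surjective.countable
  have : SecondCountableTopology D.AutPos := secondCountableTopology_chamberAut
  have : SecondCountableTopology D.AutNeg := secondCountableTopology_chamberAut
  infer_instance

variable (D) in
/-- The stabilizer of the pair of base chambers. -/
def baseStab : Set D.Ambient := {g | g.1.1 D.basePos = D.basePos ∧ g.2.1 D.baseNeg = D.baseNeg}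

theorem isOpen_setOf_apply_eq_and (x x' : Γ ⧸ D.borelPos) (y y' : Γ ⧸ D.borelNeg) :
    IsOpen {g : D.Ambient | g.1.1 x = x' ∧ g.2.1 y = y'} :=
  ((isOpen_setOf_apply_eq x x').preimage continuous_fst).inter
    ((isOpen_setOf_apply_eq y y').preimage continuous_snd)

theorem isCompact_baseStab [Finite B] (hU : ∀ α, Finite (D.U α)) : IsCompact D.baseStab := by
  have h := (isCompact_stabilizer (finite_adjPos hU) D.basePos exists_mem_ballPos).prod
    (isCompact_stabilizer (finite_adjNeg hU) D.baseNeg exists_mem_ballNeg)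
  exact h

theorem locallyCompactSpace_ambient [Finite B] (hU : ∀ α, Finite (D.U α)) :
    LocallyCompactSpace D.Ambient :=
  (isCompact_baseStab hU).locallyCompactSpace_of_mem_nhds_of_group (x := 1)
    ((isOpen_setOf_apply_eq_and _ _ _ _).mem_nhds ⟨rfl, rfl⟩)

/-! ### The fundamental domain -/

variable (D) in
/-- The elements of `G` that move the pair of chambers `(w c₊, c₋)` to `(c₊, c₋)`. -/
def cell (w : W) : Set D.Ambient :=
  {g | g.1.1 ((D.wlift w : Γ) : Γ ⧸ D.borelPos) = D.basePos ∧ g.2.1 D.baseNeg = D.baseNeg}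

theorem mul_toAmbient_mem_cell_iff {g : D.Ambient} {γ : Γ} {w : W} :
    g * D.toAmbient γ ∈ D.cell w ↔
      g.1.1 ((γ * D.wlift w : Γ) : Γ ⧸ D.borelPos) = D.basePos ∧
      g.2.1 (γ : Γ ⧸ D.borelNeg) = D.baseNeg := by
  have h : (g * D.toAmbient γ).2.1 D.baseNeg = g.2.1 ((γ * 1 : Γ) : Γ ⧸ D.borelNeg) := rfl
  rw [mul_one] at h
  change _ ∧ (g * D.toAmbient γ).2.1 D.baseNeg = _ ↔ _
  rw [h]
  rfl

theorem mul_toAmbient_mem_cell {g : D.Ambient} {γ : Γ} {w : W} (hg : g ∈ D.cell w)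
    (hγ : γ ∈ D.negStab w) : g * D.toAmbient γ ∈ D.cell w := by
  refine mul_toAmbient_mem_cell_iff.2 ⟨?_, ?_⟩
  · rw [← hg.1]
    congr 1
    refine (QuotientGroup.eq.2 ?_).symm
    have := conj_negStab_mem (D.lifts_wlift w) hγ
    rwa [mul_assoc] at this
  · conv_rhs => rw [← hg.2]
    congr 1
    exact (QuotientGroup.eq.2 (by simpa using negStab_le_borelNeg w hγ) :
      ((1 : Γ) : Γ ⧸ D.borelNeg) = γ).symm

/-- This is existence in the Birkhoff decomposition, applied to the pair of chambers that `g` sends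
to `(c₊, c₋)`; `cell_unique` is the corresponding uniqueness. -/
theorem exists_mem_cell (g : D.Ambient) : ∃ γ w, g * D.toAmbient γ ∈ D.cell w := by
  obtain ⟨a, ha⟩ := QuotientGroup.mk_surjective (g.1.1.symm D.basePos)
  obtain ⟨b, hb⟩ := QuotientGroup.mk_surjective (g.2.1.symm D.baseNeg)
  obtain ⟨w, β, hβ, n, hn, h⟩ := D.exists_birkhoff (b⁻¹ * a)
  refine ⟨b * β, w, mul_toAmbient_mem_cell_iff.2 ⟨?_, ?_⟩⟩
  · rw [← Equiv.eq_symm_apply, ← ha]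
    refine QuotientGroup.eq.2 ?_
    have := mul_mem (T_le_borelPos ((D.lifts_wlift w).inv_mul_mem hn)) h
    convert this using 1
    group
  · rw [← Equiv.eq_symm_apply, ← hb]
    refine QuotientGroup.eq.2 ?_
    simpa using inv_mem hβ

theorem cell_unique {g : D.Ambient} {γ γ' : Γ} {w w' : W} (h : g * D.toAmbient γ ∈ D.cell w)
    (h' : g * D.toAmbient γ' ∈ D.cell w') : w = w' ∧ γ⁻¹ * γ' ∈ D.negStab w := by
  rw [mul_toAmbient_mem_cell_iff] at h h'
  have h1 := QuotientGroup.eq.1 (g.1.1.injective (h.1.trans h'.1.symm))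
  have h2 := QuotientGroup.eq.1 (g.2.1.injective (h.2.trans h'.2.symm))
  have := birkhoff_unique (one_mem _) h2 (D.lifts_wlift w) (D.lifts_wlift w')
    (by convert h1 using 1; group)
  simpa using this

variable (D) in
/-- The part of the fundamental domain in a cell: a fundamental domain for the finite stabilizer
of `(w c₊, c₋)`, given by an injective function `f`. -/
def cellDomain (f : D.Ambient → ℝ) (w : W) : Set D.Ambient :=
  {g | g ∈ D.cell w ∧ ∀ γ ∈ D.negStab w, γ ≠ 1 → f g < f (g * D.toAmbient γ)}

variable (D) in
/-- A fundamental domain for `G / Γ`. -/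
def domain (f : D.Ambient → ℝ) : Set D.Ambient := ⋃ w, D.cellDomain f w

/-- Two such translates would lie in one `A_w`-orbit, and each would have a strictly smaller value
of `f` than the other. -/
theorem toAmbient_mul_cellDomain_unique {f : D.Ambient → ℝ} {g : D.Ambient} {γ γ' : Γ} {w w' : W}
    (h : g * D.toAmbient γ ∈ D.cellDomain f w) (h' : g * D.toAmbient γ' ∈ D.cellDomain f w') :
    γ = γ' := by
  obtain ⟨rfl, hm⟩ := cell_unique h.1 h'.1
  by_contra hne
  have h1 := h.2 _ hm (fun e => hne (inv_mul_eq_one.1 e))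
  have h2 := h'.2 (γ'⁻¹ * γ) (by simpa using inv_mem hm) (fun e => hne (inv_mul_eq_one.1 e).symm)
  rw [mul_assoc, ← map_mul, mul_inv_cancel_left] at h1 h2
  exact lt_asymm h1 h2

theorem existsUnique_mem_domain (hT : Finite D.T) (hU : ∀ α, Finite (D.U α))
    (hinj : Function.Injective D.toAmbient) {f : D.Ambient → ℝ} (hf : Function.Injective f)
    (g : D.Ambient) : ∃! γ : Γ, g * D.toAmbient γ ∈ D.domain f := by
  refine existsUnique_of_exists_of_unique ?_ ?_
  · obtain ⟨γ₀, w, h⟩ := exists_mem_cell g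
    have := finite_negStab hT hU w
    -- A minimum exists because `A_w` is finite; it is strict because `f` is injective and `A_w`
    -- acts freely, `Γ` being embedded in `G`.
    obtain ⟨a, ha⟩ := Finite.exists_min fun a : D.negStab w => f (g * D.toAmbient (γ₀ * a.1))
    have hmul : ∀ c : Γ, g * D.toAmbient (γ₀ * a.1) * D.toAmbient c =
        g * D.toAmbient (γ₀ * (a.1 * c)) := fun c => by
      rw [mul_assoc g, ← map_mul, mul_assoc]
    refine ⟨γ₀ * a.1, Set.mem_iUnion.2 ⟨w, ?_, fun c hc hc1 => ?_⟩⟩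
    · rw [map_mul, ← mul_assoc]
      exact mul_toAmbient_mem_cell h a.2
    · refine lt_of_le_of_ne ?_ fun e => hc1 ?_
      · rw [hmul]
        exact ha ⟨a.1 * c, mul_mem a.2 hc⟩
      · have := hf e
        rw [left_eq_mul] at this
        exact hinj (this.trans (map_one _).symm)
  · intro γ γ' h h'
    obtain ⟨w, hw⟩ := Set.mem_iUnion.1 h
    obtain ⟨w', hw'⟩ := Set.mem_iUnion.1 h'
    exact toAmbient_mul_cellDomain_unique hw hw'

theorem countable_weyl [Finite B] (cs : CoxeterSystem M W) : Countable W :=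
  (cs.wordProd_surjective).countable

/-! ### Haar measure of the cells and of their fundamental domains -/

section Measure

variable [MeasurableSpace D.Ambient] [BorelSpace D.Ambient]

theorem measurableSet_cell (w : W) : MeasurableSet (D.cell w) :=
  (isOpen_setOf_apply_eq_and _ _ _ _).measurableSet

theorem measurableSet_cellDomain [Countable Γ] {f : D.Ambient → ℝ} (hf : Measurable f) (w : W) :
    MeasurableSet (D.cellDomain f w) := by
  have : D.cellDomain f w = D.cell w ∩ ⋂ γ : Γ, {g | γ ∈ D.negStab w → γ ≠ 1 →
      f g < f (g * D.toAmbient γ)} := by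
    ext g
    simp only [cellDomain, Set.mem_inter_iff, Set.mem_iInter]
    rfl
  rw [this]
  refine (measurableSet_cell w).inter (MeasurableSet.iInter fun γ => ?_)
  by_cases h : γ ∈ D.negStab w ∧ γ ≠ 1
  · simp only [h.1, h.2, true_imp_iff, ne_eq, not_false_eq_true]
    exact measurableSet_lt hf (hf.comp (measurable_mul_const _))
  · convert MeasurableSet.univ
    refine Set.eq_univ_of_forall fun g h1 h2 => absurd ⟨h1, h2⟩ h

theorem measurableSet_domain [Finite B] [Countable Γ] {f : D.Ambient → ℝ} (hf : Measurable f) :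
    MeasurableSet (D.domain f) := by
  have := countable_weyl cs
  exact MeasurableSet.iUnion fun w => measurableSet_cellDomain hf w

theorem exists_measurable_injective [Countable Γ] :
    ∃ f : D.Ambient → ℝ, Measurable f ∧ Function.Injective f := by
  have := secondCountableTopology_ambient (D := D)
  obtain ⟨f, hf, hf'⟩ := MeasurableSpace.measurable_injection_nat_bool_of_countablySeparated
    D.Ambient
  have he := measurableEmbedding_embeddingReal (ℕ → Bool)
  exact ⟨_, he.measurable.comp hf, he.injective.comp hf'⟩

variable {μ : Measure D.Ambient} [μ.IsHaarMeasure]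

/-- The modular character composed with `φ` is trivial on `Γ`. An arbitrary `φ` is allowed because
both the diagonal map and the action on the first factor alone are needed. -/
theorem measure_preimage_mul_right [Finite B] [Countable Γ] (hU : ∀ α, Finite (D.U α))
    (hT : Finite D.T) (φ : Γ →* D.Ambient) (γ : Γ) {S : Set D.Ambient} (hS : MeasurableSet S) :
    μ {g | g * φ γ ∈ S} = μ S := by
  have := secondCountableTopology_ambient (D := D)
  have := locallyCompactSpace_ambient hU
  have h := Measure.map_right_mul_eq_modularCharacterFun_smul μ (φ γ)
  have h1 : Measure.modularCharacterFun (φ γ) = 1 :=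
    map_eq_one_of_finite hU hT (Measure.modularCharacter.comp φ) γ
  rw [h1, one_smul] at h
  conv_rhs => rw [← h, Measure.map_apply (measurable_mul_const _) hS]
  rfl

/-- Translation by `(w, 1)`, which acts on `X₊` only, matches the cell with the base stabilizer. -/
theorem measure_cell [Finite B] [Countable Γ] (hU : ∀ α, Finite (D.U α))
    (hT : Finite D.T) (w : W) : μ (D.cell w) = μ D.baseStab := by
  let φ : Γ →* D.Ambient := (cosetAction D.borelPos D.parabolicPos).prod 1
  have hK : MeasurableSet D.baseStab := (isOpen_setOf_apply_eq_and _ _ _ _).measurableSet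
  rw [← measure_preimage_mul_right hU hT φ (D.wlift w) hK]
  congr 1
  ext g
  have h : (g * φ (D.wlift w)).1.1 D.basePos = g.1.1 ((D.wlift w * 1 : Γ) : Γ ⧸ D.borelPos) := rfl
  rw [mul_one] at h
  change _ ↔ (g * φ (D.wlift w)).1.1 D.basePos = _ ∧ _
  rw [h]
  rfl

/-- The translates of the domain by `A_w` are disjoint, have equal measure and stay inside the cell.
-/
theorem card_mul_measure_cellDomain_le [Finite B] [Countable Γ] (hU : ∀ α, Finite (D.U α))
    (hT : Finite D.T) {f : D.Ambient → ℝ} (hf : Measurable f) (w : W) :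
    (Nat.card (D.negStab w) : ℝ≥0∞) * μ (D.cellDomain f w) ≤ μ D.baseStab := by
  have := finite_negStab hT hU w
  let S : D.negStab w → Set D.Ambient := fun γ => {g | g * D.toAmbient γ.1 ∈ D.cellDomain f w}
  have hS : ∀ γ, MeasurableSet (S γ) := fun γ =>
    (measurable_mul_const _) (measurableSet_cellDomain hf w)
  have hdisj : Pairwise (Function.onFun Disjoint S) := by
    intro γ γ' hne
    refine Set.disjoint_left.2 fun g h h' => hne (Subtype.ext ?_)
    exact toAmbient_mul_cellDomain_unique h h'
  have h1 : μ (⋃ γ, S γ) = (Nat.card (D.negStab w) : ℝ≥0∞) * μ (D.cellDomain f w) := by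
    rw [measure_iUnion hdisj hS]
    have : ∀ γ, μ (S γ) = μ (D.cellDomain f w) := fun γ =>
      measure_preimage_mul_right hU hT D.toAmbient γ.1 (measurableSet_cellDomain hf w)
    simp only [this, ENNReal.tsum_const, ENat.card_eq_coe_natCard]
    rfl
  rw [← h1, ← measure_cell hU hT w]
  refine measure_mono (Set.iUnion_subset fun γ g hg => ?_)
  have := mul_toAmbient_mem_cell hg.1 (inv_mem γ.2)
  rwa [mul_assoc, ← map_mul, mul_inv_cancel, map_one, mul_one] at this

end Measure

end RootGroupDatum

end TwinLattice

end

noncomputable section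

namespace TwinLattice

namespace RootGroupDatum

variable {B W : Type*} [Group W] {M : CoxeterMatrix B} {cs : CoxeterSystem M W}
  {Γ : Type*} [Group Γ] {D : RootGroupDatum cs Γ}

/-! ### Integrability of the induction cocycle -/

/-- Without roots the infimum `qMin` is `0` by convention, but then `W` is trivial and the exponent
vanishes. -/
theorem qMin_pow_length_ne_zero (hU : ∀ α, Finite (D.U α)) (w : W) : D.qMin ^ cs.length w ≠ 0 := by
  by_cases hw : w = 1
  · simp [hw]
  · obtain ⟨i, -⟩ := cs.exists_rightDescent_of_ne_one hw
    have : Nonempty (Root cs) := ⟨Root.simple cs i⟩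
    obtain ⟨α, hα⟩ := Nat.sInf_mem (Set.range_nonempty fun α : Root cs => Nat.card (D.U α))
    have := hU α
    refine pow_ne_zero _ ?_
    rw [qMin, iInf, ← hα]
    exact Nat.card_pos.ne'

variable (D) in
/-- The union of the parts of the fundamental domain in the cells of length `n`. -/
def layer (f : D.Ambient → ℝ) (n : ℕ) : Set D.Ambient :=
  ⋃ w ∈ {w : W | cs.length w = n}, D.cellDomain f w

theorem domain_eq_iUnion_layer (f : D.Ambient → ℝ) : D.domain f = ⋃ n, D.layer f n := by
  ext g
  simp [domain, layer]

theorem cocycle_spec {f : D.Ambient → ℝ}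
    (hF : IsBorelFundamentalDomain D.toAmbient (D.domain f)) (g h : D.Ambient) :
    g * h * D.toAmbient (inductionCocycle hF g h) ∈ D.domain f :=
  (hF.existsUnique (g * h)).choose_spec.1

theorem cocycle_eq_iff {f : D.Ambient → ℝ}
    (hF : IsBorelFundamentalDomain D.toAmbient (D.domain f)) (g h : D.Ambient) (γ : Γ) :
    inductionCocycle hF g h = γ ↔ g * h * D.toAmbient γ ∈ D.domain f :=
  ⟨fun e => e ▸ cocycle_spec hF g h,
    fun e => ((hF.existsUnique (g * h)).choose_spec.2 γ e).symm⟩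

/-- For `h` over `w` one has `h⁻¹ c₊ = w c₊` and `h⁻¹ c₋ = c₋`. Hence `γ w' c₊` and `γ c₋`, the
images of `c₊` and `c₋` under `h⁻¹ g⁻¹`, are within `n + k` and `l` of the base chambers, where `k`
and `l` depend only on `g`. -/
theorem exists_wordLength_cocycle_le [Finite B] (hU : ∀ α, Finite (D.U α)) (hT : Finite D.T)
    {f : D.Ambient → ℝ} (hF : IsBorelFundamentalDomain D.toAmbient (D.domain f))
    {A : Set Γ} (hA : Subgroup.closure A = ⊤) (g : D.Ambient) :
    ∃ C : ℕ, 1 ≤ C ∧ ∀ n, ∀ h ∈ D.layer f n,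
      wordLength A (inductionCocycle hF g h) ≤ C * (n + 1) := by
  obtain ⟨C, hC⟩ : ∃ C, ∀ e ∈ (D.T : Set Γ) ∪ ⋃ i, (panelRep D i ∪ panelRep D.op i),
      wordLength A e ≤ C := by
    have hfin : ((D.T : Set Γ) ∪ ⋃ i, (panelRep D i ∪ panelRep D.op i)).Finite :=
      (finite_coe_of_finite hT).union (Set.finite_iUnion fun i => (finite_panelRep hU i).union
        (finite_panelRep (D := D.op) (fun α => hU α.neg) i))
    obtain ⟨C, hC⟩ := (hfin.image (wordLength A)).bddAbove
    exact ⟨C, fun e he => hC (Set.mem_image_of_mem _ he)⟩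
  obtain ⟨k, hk⟩ := exists_mem_ballPos ((g⁻¹).1.1 D.basePos)
  obtain ⟨l, hl⟩ := exists_mem_ballNeg ((g⁻¹).2.1 D.baseNeg)
  -- The final `+ 1` makes the constant positive, so that the bound is at least `1` and its powers
  -- increase with the exponent.
  refine ⟨C * (2 * k + 3 * l + 2) + 1, by omega, fun n h hh => ?_⟩
  simp only [layer, Set.mem_iUnion] at hh
  obtain ⟨w, hw, hh⟩ := hh
  change cs.length w = n at hw
  obtain ⟨w', hγ⟩ := Set.mem_iUnion.1 (cocycle_spec hF g h)
  set γ := inductionCocycle hF g h with hγdef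
  obtain ⟨h1, h2⟩ := mul_toAmbient_mem_cell_iff.1 hγ.1
  have e1 : ((γ * D.wlift w' : Γ) : Γ ⧸ D.borelPos) = (h⁻¹).1.1 ((g⁻¹).1.1 D.basePos) := by
    rw [← h1]
    change _ = h.1.1.symm (g.1.1.symm (g.1.1 (h.1.1 _)))
    simp
  have e2 : (γ : Γ ⧸ D.borelNeg) = (h⁻¹).2.1 ((g⁻¹).2.1 D.baseNeg) := by
    rw [← h2]
    change _ = h.2.1.symm (g.2.1.symm (g.2.1 (h.2.1 _)))
    simp
  have e3 : (h⁻¹).1.1 D.basePos = ((D.wlift w : Γ) : Γ ⧸ D.borelPos) := by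
    rw [← hh.1.1]
    exact h.1.1.symm_apply_apply _
  have e4 : (h⁻¹).2.1 D.baseNeg = D.baseNeg := by
    conv_lhs => rw [← hh.1.2]
    exact h.2.1.symm_apply_apply _
  have hk' : ((γ * D.wlift w' : Γ) : Γ ⧸ D.borelPos) ∈ D.ballPos D.basePos (cs.length w + k) := by
    have := apply_mem_ball (h⁻¹).1 hk
    rw [e3, ← e1] at this
    exact mem_ball_add (D.lifts_wlift w).mem_ballPos this
  have hl' : (γ : Γ ⧸ D.borelNeg) ∈ D.ballNeg D.baseNeg l := by
    have := apply_mem_ball (h⁻¹).2 hl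
    rwa [e4, ← e2] at this
  have := le_of_mem_ball (N := wordLength A) (C := C) wordLength_one (wordLength_mul_le hA)
    (fun t ht => hC t (Or.inl ht))
    (fun i e he => hC e (Or.inr (Set.mem_iUnion.2 ⟨i, Or.inl he⟩)))
    (fun i e he => hC e (Or.inr (Set.mem_iUnion.2 ⟨i, Or.inr he⟩))) (D.lifts_wlift w') hk' hl'
  refine this.trans ?_
  rw [hw]
  calc C * (2 * (n + k) + 3 * l + 1) ≤ C * ((2 * k + 3 * l + 2) * (n + 1)) := by
        gcongr
        nlinarith [Nat.zero_le (k * n), Nat.zero_le (l * n)]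
    _ ≤ (C * (2 * k + 3 * l + 2) + 1) * (n + 1) := by nlinarith

section Measure

variable [MeasurableSpace D.Ambient] [BorelSpace D.Ambient]

theorem measurable_wordLength_cocycle [Countable Γ] {f : D.Ambient → ℝ}
    (hF : IsBorelFundamentalDomain D.toAmbient (D.domain f)) (A : Set Γ) (g : D.Ambient) :
    Measurable fun h => (wordLength A (inductionCocycle hF g h) : ℝ) := by
  let _ : MeasurableSpace Γ := ⊤
  have hmeas : MeasurableSet (D.domain f) := by
    have := hF.measurableSet
    rwa [← BorelSpace.measurable_eq (α := D.Ambient)] at this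
  have h1 : Measurable fun h => inductionCocycle hF g h := by
    refine measurable_to_countable' fun γ => ?_
    have : (fun h => inductionCocycle hF g h) ⁻¹' {γ} =
        (fun h => g * h * D.toAmbient γ) ⁻¹' D.domain f :=
      Set.ext fun h => cocycle_eq_iff hF g h γ
    rw [this]
    have hc : Continuous fun h => g * h * D.toAmbient γ := by fun_prop
    exact hc.measurable hmeas
  have h2 : Measurable fun γ : Γ => (wordLength A γ : ℝ) := measurable_from_top
  exact h2.comp h1

theorem measurableSet_layer [Finite B] [Countable Γ] {f : D.Ambient → ℝ} (hf : Measurable f)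
    (n : ℕ) : MeasurableSet (D.layer f n) := by
  have := countable_weyl cs
  exact MeasurableSet.iUnion fun w => MeasurableSet.iUnion fun _ => measurableSet_cellDomain hf w

variable {μ : Measure D.Ambient} [μ.IsHaarMeasure]

theorem measure_layer_le [Finite B] [Countable Γ] (hU : ∀ α, Finite (D.U α)) (hT : Finite D.T)
    {f : D.Ambient → ℝ} (hf : Measurable f) (n : ℕ) :
    μ (D.layer f n) ≤
      ENNReal.ofReal ((growthCoeff cs n : ℝ) * ((D.qMin : ℝ) ^ n)⁻¹) * μ D.baseStab := by
  have hfin := finite_length_eq (cs := cs) n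
  have h1 : ∀ w ∈ hfin.toFinset, μ (D.cellDomain f w) ≤
      ENNReal.ofReal (((D.qMin : ℝ) ^ n)⁻¹) * μ D.baseStab := by
    intro w hw
    have hw : cs.length w = n := hfin.mem_toFinset.1 hw
    have hq : D.qMin ^ n ≠ 0 := hw ▸ qMin_pow_length_ne_zero hU w
    have hq0 : (0 : ℝ) < (D.qMin : ℝ) ^ n := by exact_mod_cast Nat.pos_of_ne_zero hq
    have e : ENNReal.ofReal ((D.qMin : ℝ) ^ n) = ((D.qMin ^ n : ℕ) : ℝ≥0∞) := by
      rw [← Nat.cast_pow, ENNReal.ofReal_natCast]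
    rw [ENNReal.ofReal_inv_of_pos hq0, e, mul_comm, ← div_eq_mul_inv,
      ENNReal.le_div_iff_mul_le (Or.inl (by exact_mod_cast hq)) (Or.inl (ENNReal.natCast_ne_top _)),
      mul_comm]
    refine le_trans ?_ (card_mul_measure_cellDomain_le hU hT hf w)
    gcongr
    rw [← hw]
    exact qMin_pow_le_card_negStab hT hU w
  have h2 : D.layer f n = ⋃ w ∈ hfin.toFinset, D.cellDomain f w := by
    simp [layer]
  rw [h2]
  refine (measure_biUnion_finset_le _ _).trans ((Finset.sum_le_sum h1).trans (le_of_eq ?_))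
  rw [Finset.sum_const, nsmul_eq_mul, ENNReal.ofReal_mul (by positivity), ENNReal.ofReal_natCast,
    growthCoeff, Set.ncard_eq_toFinset_card _ hfin, mul_assoc]

theorem tsum_layer_lt_top [Finite B] [Countable Γ] (hU : ∀ α, Finite (D.U α)) (hT : Finite D.T)
    (hsum : Summable fun n : ℕ => (growthCoeff cs n : ℝ) * ((D.qMin : ℝ) ^ n)⁻¹)
    {f : D.Ambient → ℝ} (hf : Measurable f) (C : ℝ) (hC : 0 ≤ C) (P : ℕ) :
    ∑' n : ℕ, ENNReal.ofReal (C * (n + 1)) ^ P * μ (D.layer f n) < ∞ := by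
  have hs := (summable_pow_mul_of_submultiplicative (fun n => by positivity) (fun m n => ?_)
    hsum P).mul_left (C ^ P)
  · have hle : ∀ n : ℕ, ENNReal.ofReal (C * (n + 1)) ^ P * μ (D.layer f n) ≤
        ENNReal.ofReal (C ^ P * (((n : ℝ) + 1) ^ P *
          ((growthCoeff cs n : ℝ) * ((D.qMin : ℝ) ^ n)⁻¹))) * μ D.baseStab := by
      intro n
      rw [← mul_assoc (C ^ P), ← mul_pow,
        ENNReal.ofReal_mul (p := (C * ((n : ℝ) + 1)) ^ P) (by positivity), ENNReal.ofReal_pow (by positivity), mul_assoc]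
      gcongr
      exact measure_layer_le hU hT hf n
    refine (ENNReal.tsum_le_tsum hle).trans_lt ?_
    rw [ENNReal.tsum_mul_right, ← ENNReal.ofReal_tsum_of_nonneg (fun n => by positivity) hs]
    exact ENNReal.mul_lt_top ENNReal.ofReal_lt_top (isCompact_baseStab hU).measure_lt_top
  · calc (growthCoeff cs (m + n) : ℝ) * ((D.qMin : ℝ) ^ (m + n))⁻¹
        ≤ (growthCoeff cs m * growthCoeff cs n : ℝ) * ((D.qMin : ℝ) ^ (m + n))⁻¹ := by
          gcongr
          exact_mod_cast growthCoeff_add_le m n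
      _ = _ := by rw [pow_add, mul_inv]; ring

theorem measure_domain_lt_top [Finite B] [Countable Γ] (hU : ∀ α, Finite (D.U α))
    (hT : Finite D.T)
    (hsum : Summable fun n : ℕ => (growthCoeff cs n : ℝ) * ((D.qMin : ℝ) ^ n)⁻¹)
    {f : D.Ambient → ℝ} (hf : Measurable f) : μ (D.domain f) < ∞ := by
  rw [domain_eq_iUnion_layer]
  refine (measure_iUnion_le _).trans_lt ?_
  simpa using tsum_layer_lt_top (μ := μ) hU hT hsum hf 1 zero_le_one 0

theorem memLp_wordLength_cocycle [Finite B] [Countable Γ] (hU : ∀ α, Finite (D.U α))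
    (hT : Finite D.T)
    (hsum : Summable fun n : ℕ => (growthCoeff cs n : ℝ) * ((D.qMin : ℝ) ^ n)⁻¹)
    {f : D.Ambient → ℝ} (hf : Measurable f)
    (hF : IsBorelFundamentalDomain D.toAmbient (D.domain f)) {A : Set Γ}
    (hA : Subgroup.closure A = ⊤) (g : D.Ambient) {p : ℝ≥0∞} (hp : 1 ≤ p) (hp' : p ≠ ∞) :
    MemLp (fun h => (wordLength A (inductionCocycle hF g h) : ℝ)) p
      (μ.restrict (D.domain f)) := by
  have hp0 : p ≠ 0 := (zero_lt_one.trans_le hp).ne'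
  refine ⟨(measurable_wordLength_cocycle hF A g).aestronglyMeasurable, ?_⟩
  have hr : μ.restrict (D.domain f) = μ.restrict (⋃ n, D.layer f n) := by
    rw [domain_eq_iUnion_layer]
  rw [eLpNorm_lt_top_iff_lintegral_rpow_enorm_lt_top hp0 hp', hr]
  obtain ⟨C, hC1, hC⟩ := exists_wordLength_cocycle_le hU hT hF hA g
  -- The integral is split over layers of constant length; on each the integrand is at most `C (n +
  -- 1) ≥ 1` to the power `p`, and `p` may be rounded up to a natural number.
  refine (lintegral_iUnion_le _ _).trans_lt (lt_of_le_of_lt (ENNReal.tsum_le_tsum fun n => ?_)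
    (tsum_layer_lt_top (μ := μ) hU hT hsum hf (C : ℝ) (by positivity) ⌈p.toReal⌉₊))
  rw [← setLIntegral_const]
  refine setLIntegral_mono' (measurableSet_layer hf n) fun h hh => ?_
  have h1 : (wordLength A (inductionCocycle hF g h) : ℝ) ≤ C * (n + 1) := by
    exact_mod_cast hC n h hh
  have h2 : (1 : ℝ) ≤ C * (n + 1) := by
    have : 1 ≤ C * (n + 1) := Nat.mul_pos hC1 n.succ_pos
    exact_mod_cast this
  calc ‖(wordLength A (inductionCocycle hF g h) : ℝ)‖ₑ ^ p.toReal
      ≤ ENNReal.ofReal (C * (n + 1)) ^ p.toReal := by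
        rw [Real.enorm_of_nonneg (by positivity)]
        gcongr
    _ ≤ ENNReal.ofReal (C * (n + 1)) ^ ((⌈p.toReal⌉₊ : ℕ) : ℝ) :=
        ENNReal.rpow_le_rpow_of_exponent_le (ENNReal.one_le_ofReal.2 h2) (Nat.le_ceil _)
    _ = ENNReal.ofReal (C * (n + 1)) ^ ⌈p.toReal⌉₊ := ENNReal.rpow_natCast _ _

end Measure

end RootGroupDatum

end TwinLattice

end

/-! ### The main theorem -/

theorem mainTheorem6 {B W Γ : Type*} [Finite B] [Group W] [Group Γ] {M : CoxeterMatrix B}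
    (cs : CoxeterSystem M W) (D : TwinLattice.RootGroupDatum cs Γ)
    (hfin : ∀ α, Finite (D.U α))
    (hinj : Function.Injective D.toAmbient)
    (hsum : Summable fun n : ℕ => (TwinLattice.growthCoeff cs n : ℝ) * ((D.qMin : ℝ) ^ n)⁻¹)
    [MeasurableSpace D.Ambient] [BorelSpace D.Ambient]
    (μ : Measure D.Ambient) [μ.IsHaarMeasure] :
    Group.FG Γ ∧
    ∃ (F : Set D.Ambient) (hF : TwinLattice.IsBorelFundamentalDomain D.toAmbient F),
      μ F < ∞ ∧
      ∀ A : Set Γ, A.Finite → Subgroup.closure A = ⊤ →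
        ∀ (g : D.Ambient) (p : ℝ≥0∞), 1 ≤ p → p ≠ ∞ →
          MemLp (fun h => (TwinLattice.wordLength A (TwinLattice.inductionCocycle hF g h) : ℝ)) p
            (μ.restrict F) := by
  have hfg := TwinLattice.RootGroupDatum.group_fg hfin hinj
  have hT := TwinLattice.RootGroupDatum.finite_T hfin hinj
  have := TwinLattice.RootGroupDatum.countable_of_fg hfg
  obtain ⟨f, hf, hf'⟩ := TwinLattice.RootGroupDatum.exists_measurable_injective (D := D)
  have hF : TwinLattice.IsBorelFundamentalDomain D.toAmbient (D.domain f) :=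
    ⟨by
      rw [← BorelSpace.measurable_eq (α := D.Ambient)]
      exact TwinLattice.RootGroupDatum.measurableSet_domain hf,
      TwinLattice.RootGroupDatum.existsUnique_mem_domain hT hfin hinj hf'⟩
  exact ⟨hfg, D.domain f, hF, TwinLattice.RootGroupDatum.measure_domain_lt_top hfin hT hsum hf,
    fun A _ hA g p hp hp' =>
      TwinLattice.RootGroupDatum.memLp_wordLength_cocycle hfin hT hsum hf hF hA g hp hp'⟩
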